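/- **Theorem 2 (QI-$k$-means++).** Let $V=\{v_1,\dots,v_N\}\subset\mathbb{R}^d$ be $N$ distinct points, $d\ge 1$, $1\le k\le N$. For a finite non-empty $S\subset\mathbb{R}^d$ put $\Phi(V,S)=\sum_{i}\min_{c\in S}\|v_i-c\|^2$, let $\mathrm{OPT}_k=\inf_{c_1,\dots,c_k\in\mathbb{R}^d}\Phi(V,\{c_1,\dots,c_k\})$, and let $\zeta=\max_{i\ne j}\|v_i-v_j\|/\min_{i\ne j}\|v_i-v_j\|$ be the aspect ratio (irrelevant if $N=1$, since then $\log k=0$). The exact $k$-means++ seeding chooses $s_1$ uniformly from $\{1,\dots,N\}$ and then, for $t=2,\dots,k$, chooses $s_t=i$ with probability $\min_{r<t}\|v_i-v_{s_r}\|^2\big/\sum_{l}\min_{r<t}\|v_l-v_{s_r}\|^2$; let $P_V(s)$ be the probability of the sequence $s=(s_1,\dots,s_k)$. Sample-query access to a matrix with rows $a_1,\dots,a_N\in\mathbb{R}^d$ means that one can read any entry, any row norm $\|a_i\|$ and the Frobenius norm, and draw independent samples of a row index $i$ with probability $\|a_i\|^2/\sum_l\|a_l\|^2$ (if some row is non-zero)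 and, for a given row $a_i\neq 0$, of a column index $j$ with probability $a_{i}(j)^2/\|a_i\|^2$. There are an absolute constant $C>0$ and a classical randomized algorithm (a fixed real-RAM program with unit-cost real arithmetic, square roots and biased coin flips) with the following properties for all $N,d,k,V$ as above; the algorithm is given $N,d,k,V$ but not $\zeta$. 1. Its first phase takes time at most $CNd$ and sets up sample-query access to the data matrix, translated so that $v_1$ is the origin. Afterwards the Frobenius norm is available in time $C$ and every other operation takes time at most $C(1+\log(Nd))$. Its second phase accesses the data only through these operations and, if $k\ge 2$, takes time at most $C\,\zeta^2k^2d\,\log k\,\log(Nd)$. 2. In every execution the total running time is at most $C\left(Nd+\zeta^2k^2d\,\log k\,\log(Nd)\right)$. 3. The algorithm outputs either a sequence of $k$ indices of data points or "failure", and with probability at least $0.99$ its output is an exact $k$-means++ seeding: for every sequence $s$, $$0.99\,P_V(s)\le \Pr[\text{output}=s]\le P_V(s),$$ and $\Pr[\text{no failure}]\ge 0.99$. 4. Conditionally on no failure, the output is an $O(\log k)$-approximation in expectation: $\mathbb{E}\left[\Phi(V,\{v_{s_1},\dots,v_{s_k}\})\mid\text{no failure}\right]\le C(1+\log k)\,\mathrm{OPT}_k$.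 -/

import Mathlib

noncomputable section

/-! ### The k-means problem and the exact k-means++ seeding -/

/-- The `k`-means cost `Φ(V, S) = ∑ᵢ min_{c ∈ S} ‖vᵢ - c‖²` of a (non-empty, finite) set `S` of
centers. -/
def kmeansCost {N d : ℕ} (V : Fin N → EuclideanSpace ℝ (Fin d))
    (S : Set (EuclideanSpace ℝ (Fin d))) : ℝ :=
  ∑ i, Metric.infDist (V i) S ^ 2

/-- The optimal cost over all choices of `k` centers in `ℝᵈ`. -/
def kmeansOpt {N d : ℕ} (V : Fin N → EuclideanSpace ℝ (Fin d)) (k : ℕ) : ℝ :=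
  ⨅ c : Fin k → EuclideanSpace ℝ (Fin d), kmeansCost V (Set.range c)

/-- The aspect ratio: the largest interpoint distance divided by the smallest one. -/
def aspectRatio {N d : ℕ} (V : Fin N → EuclideanSpace ℝ (Fin d)) : ℝ :=
  (⨆ p : {p : Fin N × Fin N // p.1 ≠ p.2}, dist (V p.1.1) (V p.1.2)) /
    (⨅ p : {p : Fin N × Fin N // p.1 ≠ p.2}, dist (V p.1.1) (V p.1.2))

/-- The `D²`-sampling probability of the data point with index `i`, given that the data points with
indices in `S` are the current centers (uniform if there is no center yet). -/
def dsqProb {N d : ℕ} (V : Fin N → EuclideanSpace ℝ (Fin d)) (S : Finset (Fin N))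
    (i : Fin N) : ℝ :=
  if S = ∅ then 1 / (N : ℝ)
  else Metric.infDist (V i) (V '' (S : Set (Fin N))) ^ 2 /
    ∑ l, Metric.infDist (V l) (V '' (S : Set (Fin N))) ^ 2

/-- The probability that `k`-means++ picks the data points with indices `s 0, s 1, …` as its first,
second, … center. -/
def seedingProb {N d k : ℕ} (V : Fin N → EuclideanSpace ℝ (Fin d)) (s : Fin k → Fin N) : ℝ :=
  ∏ t : Fin k, dsqProb V ((Finset.univ.filter (fun r => r < t)).image s) (s t)

/-- The data set translated so that its first point is the origin. -/
def centered {N d : ℕ} (V : Fin N → EuclideanSpace ℝ (Fin d)) :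
    Fin N → EuclideanSpace ℝ (Fin d) :=
  fun i => V i - V ⟨0, i.pos⟩

/-! ### A randomized real RAM

Programs are finite texts of a structured language over integer and real scalars and
two-dimensional integer and real arrays.  Every command takes one unit of time.  The integer
instructions are addition, truncated subtraction, halving and comparison; the real ones are the
field operations, square root, comparison and conversion from integers.  There are no real constants
other than the converted integers.  The only source of randomness is the flip of a biased coin. -/

/-- One bank of memory: integer scalars, real scalars, integer arrays, real arrays. The first
argument is always the name of the variable. -/
@[ext] structure Store where
  nv : ℕ → ℕ
  rv : ℕ → ℝ
  na : ℕ → ℕ → ℕ → ℕ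
  ra : ℕ → ℕ → ℕ → ℝ

/-- The memory has a public and a hidden bank. -/
inductive Side
  | pub
  | hid
  deriving DecidableEq

abbrev Mem := Side → Store

namespace Store

def setNV (σ : Store) (x : ℕ) (v : ℕ) : Store := { σ with nv := Function.update σ.nv x v }

def setRV (σ : Store) (x : ℕ) (v : ℝ) : Store := { σ with rv := Function.update σ.rv x v }

def setNA (σ : Store) (x i j : ℕ) (v : ℕ) : Store :=
  { σ with na := Function.update σ.na x (Function.update (σ.na x) i
      (Function.update (σ.na x i) j v)) }

def setRA (σ : Store) (x i j : ℕ) (v : ℝ) : Store :=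
  { σ with ra := Function.update σ.ra x (Function.update (σ.ra x) i
      (Function.update (σ.ra x i) j v)) }

end Store

/-- Integer expressions. -/
inductive NExp
  | lit (n : ℕ)
  | var (s : Side) (x : ℕ)
  | arr (s : Side) (x : ℕ) (i j : NExp)
  | add (a b : NExp)
  | sub (a b : NExp)
  | half (a : NExp)

namespace NExp

def eval (m : Mem) : NExp → ℕ
  | lit n => n
  | var s x => (m s).nv x
  | arr s x i j => (m s).na x (i.eval m) (j.eval m)
  | add a b => a.eval m + b.eval m
  | sub a b => a.eval m - b.eval m
  | half a => a.eval m / 2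

/-- The expression mentions only the public bank. -/
def IsPublic : NExp → Prop
  | lit _ => True
  | var s _ => s = Side.pub
  | arr s _ i j => s = Side.pub ∧ i.IsPublic ∧ j.IsPublic
  | add a b => a.IsPublic ∧ b.IsPublic
  | sub a b => a.IsPublic ∧ b.IsPublic
  | half a => a.IsPublic

end NExp

/-- Real expressions. -/
inductive RExp
  | ofNat (e : NExp)
  | var (s : Side) (x : ℕ)
  | arr (s : Side) (x : ℕ) (i j : NExp)
  | add (a b : RExp)
  | sub (a b : RExp)
  | mul (a b : RExp)
  | div (a b : RExp)
  | sqrt (a : RExp)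

namespace RExp

def eval (m : Mem) : RExp → ℝ
  | ofNat e => (e.eval m : ℝ)
  | var s x => (m s).rv x
  | arr s x i j => (m s).ra x (i.eval m) (j.eval m)
  | add a b => a.eval m + b.eval m
  | sub a b => a.eval m - b.eval m
  | mul a b => a.eval m * b.eval m
  | div a b => a.eval m / b.eval m
  | sqrt a => Real.sqrt (a.eval m)

/-- The expression mentions only the public bank. -/
def IsPublic : RExp → Prop
  | ofNat e => e.IsPublic
  | var s _ => s = Side.pub
  | arr s _ i j => s = Side.pub ∧ i.IsPublic ∧ j.IsPublic
  | add a b => a.IsPublic ∧ b.IsPublic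
  | sub a b => a.IsPublic ∧ b.IsPublic
  | mul a b => a.IsPublic ∧ b.IsPublic
  | div a b => a.IsPublic ∧ b.IsPublic
  | sqrt a => a.IsPublic

end RExp

/-- Tests. -/
inductive Test
  | neq (a b : NExp)
  | nlt (a b : NExp)
  | rlt (a b : RExp)
  | not (t : Test)

namespace Test

def Holds (m : Mem) : Test → Prop
  | neq a b => a.eval m = b.eval m
  | nlt a b => a.eval m < b.eval m
  | rlt a b => a.eval m < b.eval m
  | not t => ¬ t.Holds m

/-- The test mentions only the public bank. -/
def IsPublic : Test → Prop
  | neq a b => a.IsPublic ∧ b.IsPublic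
  | nlt a b => a.IsPublic ∧ b.IsPublic
  | rlt a b => a.IsPublic ∧ b.IsPublic
  | not t => t.IsPublic

end Test

/-- The operations of sample-query access to a matrix: read an entry, read the norm of a row, read
the Frobenius norm, sample a row with probability proportional to its squared norm, sample an entry
of a given row with probability proportional to its square. -/
inductive SQOp
  | entry
  | rowNorm
  | frobNorm
  | sampleRow
  | sampleEntry

/-- Commands. `flip s x p` assigns to the integer variable `x` the outcome (`1` or `0`) of a fresh
coin of bias `p`; `call q` runs the subroutine for the operation `q`. -/
inductive Cmd
  | skip
  | setNV (s : Side) (x : ℕ) (e : NExp)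
  | setRV (s : Side) (x : ℕ) (e : RExp)
  | setNA (s : Side) (x : ℕ) (i j : NExp) (e : NExp)
  | setRA (s : Side) (x : ℕ) (i j : NExp) (e : RExp)
  | flip (s : Side) (x : ℕ) (p : RExp)
  | seq (a b : Cmd)
  | ite (t : Test) (a b : Cmd)
  | loop (t : Test) (a : Cmd)
  | call (q : SQOp)

/-- The command accesses the hidden bank at most through subroutine calls. -/
def Cmd.IsPublic : Cmd → Prop
  | skip => True
  | setNV s _ e => s = Side.pub ∧ e.IsPublic
  | setRV s _ e => s = Side.pub ∧ e.IsPublic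
  | setNA s _ i j e => s = Side.pub ∧ i.IsPublic ∧ j.IsPublic ∧ e.IsPublic
  | setRA s _ i j e => s = Side.pub ∧ i.IsPublic ∧ j.IsPublic ∧ e.IsPublic
  | flip s _ p => s = Side.pub ∧ p.IsPublic
  | seq a b => a.IsPublic ∧ b.IsPublic
  | ite t a b => t.IsPublic ∧ a.IsPublic ∧ b.IsPublic
  | loop t a => t.IsPublic ∧ a.IsPublic
  | call _ => True

/-- A coin that shows `true` with probability `p` (clamped to `[0, 1]`). -/
def coin (p : ℝ) : PMF Bool :=
  PMF.ofFintype
    (fun b => if b then ENNReal.ofReal (max 0 (min 1 p))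
      else ENNReal.ofReal (1 - max 0 (min 1 p)))
    (by
      have h0 : (0 : ℝ) ≤ max 0 (min 1 p) := le_max_left _ _
      have h1 : max 0 (min 1 p) ≤ 1 := max_le zero_le_one (min_le_left _ _)
      simp only [Fintype.sum_bool, if_true, Bool.false_eq_true, if_false]
      rw [← ENNReal.ofReal_add h0 (sub_nonneg.2 h1)]
      simp)

/-- A configuration: the stack of commands still to be executed, and the memory. The machine has
halted when the stack is empty. -/
abbrev Config := List Cmd × Mem

/-- Replace bank `s` of the memory. -/
def Mem.upd (m : Mem) (s : Side) (σ : Store) : Mem := Function.update m s σ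

open Classical in
/-- One step of the machine, where `env` contains the bodies of the subroutines. -/
def step (env : SQOp → Cmd) : Config → PMF Config
  | ([], m) => PMF.pure ([], m)
  | (Cmd.skip :: K, m) => PMF.pure (K, m)
  | (Cmd.setNV s x e :: K, m) => PMF.pure (K, m.upd s ((m s).setNV x (e.eval m)))
  | (Cmd.setRV s x e :: K, m) => PMF.pure (K, m.upd s ((m s).setRV x (e.eval m)))
  | (Cmd.setNA s x i j e :: K, m) =>
      PMF.pure (K, m.upd s ((m s).setNA x (i.eval m) (j.eval m) (e.eval m)))
  | (Cmd.setRA s x i j e :: K, m) =>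
      PMF.pure (K, m.upd s ((m s).setRA x (i.eval m) (j.eval m) (e.eval m)))
  | (Cmd.flip s x p :: K, m) =>
      (coin (p.eval m)).map (fun b => (K, m.upd s ((m s).setNV x (if b then 1 else 0))))
  | (Cmd.seq a b :: K, m) => PMF.pure (a :: b :: K, m)
  | (Cmd.ite t a b :: K, m) => PMF.pure (if t.Holds m then a :: K else b :: K, m)
  | (Cmd.loop t a :: K, m) => PMF.pure (if t.Holds m then a :: Cmd.loop t a :: K else K, m)
  | (Cmd.call q :: K, m) => PMF.pure (env q :: K, m)

/-- The law of the configuration after `T` steps. -/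
def runSteps (env : SQOp → Cmd) : ℕ → Config → PMF Config
  | 0, c => PMF.pure c
  | T + 1, c => (step env c).bind (runSteps env T)

/-- Whatever the coins show, the command `c` started in memory `m` halts within `T` steps. -/
def HaltsWithin (env : SQOp → Cmd) (c : Cmd) (m : Mem) (T : ℕ) : Prop :=
  ∀ cfg ∈ (runSteps env T ([c], m)).support, cfg.1 = []

/-- The law of the memory after `T` steps. -/
def memLaw (env : SQOp → Cmd) (c : Cmd) (m : Mem) (T : ℕ) : PMF Mem :=
  (runSteps env T ([c], m)).map Prod.snd

/-! ### Sample-query access -/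

/-- Called in memory `m`, the subroutine for `q` halts within `τ` steps and restores the invariant
`Inv` of the hidden bank. -/
def Answers (env : SQOp → Cmd) (Inv : Store → Prop) (q : SQOp) (m : Mem) (τ : ℝ)
    (post : PMF Store → Prop) : Prop :=
  ∃ T : ℕ, (T : ℝ) ≤ τ ∧ HaltsWithin env (Cmd.call q) m T ∧
    (∀ m' ∈ (memLaw env (Cmd.call q) m T).support, Inv (m' Side.hid)) ∧
    post ((memLaw env (Cmd.call q) m T).map (fun m' => m' Side.pub))

/-- The subroutines `env` together with the contents `D` of the hidden bank provide sample-query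
access to the matrix with rows `A 0, …, A (N-1)`: the norm of the whole matrix takes time at most
`C`, every other operation takes time at most `C (1 + log (N d))`, and the access can be used
arbitrarily often, with independent samples. The arguments of an operation are passed in the public
integer variables `3` (row) and `4` (column); a real answer is returned in the public real variable
`0`, a sampled index in the public integer variable `5`, and nothing else in the public bank is
changed. -/
def ProvidesSQ (env : SQOp → Cmd) (C : ℝ) {N d : ℕ} (A : Fin N → EuclideanSpace ℝ (Fin d))
    (D : Store) : Prop :=
  ∃ Inv : Store → Prop, Inv D ∧
    ∀ m : Mem, Inv (m Side.hid) →
      (m Side.pub).nv 0 = N → (m Side.pub).nv 1 = d →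
      (∀ (i : Fin N) (j : Fin d), (m Side.pub).nv 3 = i → (m Side.pub).nv 4 = j →
        Answers env Inv SQOp.entry m (C * (1 + Real.log (N * d)))
          (fun μ => μ = PMF.pure ((m Side.pub).setRV 0 (A i j)))) ∧
      (∀ i : Fin N, (m Side.pub).nv 3 = i →
        Answers env Inv SQOp.rowNorm m (C * (1 + Real.log (N * d)))
          (fun μ => μ = PMF.pure ((m Side.pub).setRV 0 ‖A i‖))) ∧
      Answers env Inv SQOp.frobNorm m C
        (fun μ => μ = PMF.pure ((m Side.pub).setRV 0 (Real.sqrt (∑ i, ‖A i‖ ^ 2)))) ∧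
      (A ≠ 0 →
        Answers env Inv SQOp.sampleRow m (C * (1 + Real.log (N * d)))
          (fun μ => ∀ i : Fin N, μ ((m Side.pub).setNV 5 i) =
            ENNReal.ofReal (‖A i‖ ^ 2 / ∑ l, ‖A l‖ ^ 2))) ∧
      (∀ i : Fin N, (m Side.pub).nv 3 = i → A i ≠ 0 →
        Answers env Inv SQOp.sampleEntry m (C * (1 + Real.log (N * d)))
          (fun μ => ∀ j : Fin d, μ ((m Side.pub).setNV 5 j) =
            ENNReal.ofReal (A i j ^ 2 / ‖A i‖ ^ 2)))

/-! ### Input and output -/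

/-- The initial memory: `N`, `d`, `k` in the public integer variables `0`, `1`, `2`, the data matrix
in array `0` of the hidden bank, and zeros everywhere else. -/
def inputMem {N d : ℕ} (V : Fin N → EuclideanSpace ℝ (Fin d)) (k : ℕ) : Mem
  | Side.pub =>
    { nv := fun x => if x = 0 then N else if x = 1 then d else if x = 2 then k else 0
      rv := fun _ => 0
      na := fun _ _ _ => 0
      ra := fun _ _ _ => 0 }
  | Side.hid =>
    { nv := fun _ => 0
      rv := fun _ => 0
      na := fun _ _ _ => 0
      ra := fun x i j =>
        if x = 0 then (if h : i < N ∧ j < d then V ⟨i, h.1⟩ ⟨j, h.2⟩ else 0) else 0 }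

/-- The output read off the final memory: if the public integer variable `6` is `1`, the sequence of
the indices of the `k` chosen data points in row `0` of the public integer array `0`; otherwise
failure. -/
def readOutput (N k : ℕ) (m : Mem) : Option (Fin k → Fin N) :=
  if h : (m Side.pub).nv 6 = 1 ∧ ∀ t : Fin k, (m Side.pub).na 0 0 t < N then
    some (fun t => ⟨(m Side.pub).na 0 0 t, h.2 t⟩)
  else none

/-- The probability that the output of the command `c` after `T` steps is the sequence `s`. -/
def outputProb (env : SQOp → Cmd) (c : Cmd) {N d k : ℕ} (V : Fin N → EuclideanSpace ℝ (Fin d))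
    (T : ℕ) (s : Fin k → Fin N) : ℝ :=
  (((memLaw env c (inputMem V k) T).map (readOutput N k)) (some s)).toReal

end

noncomputable section

/-! ### Coupling triples for randomized programs -/

/-! The exact seeding is simulated by rejection sampling. Write a_i for the rows of `centered V`, i₀
for the first center, z = ‖a_{i₀}‖², D²(i) = `dsq V S i` and Φ = `potential V S`. As i₀ is in S, the
triangle inequality through the first data point gives D²(i) ≤ 2(‖a_i‖² + z). The law proportional
to ‖a_i‖² + z is a mixture of row sampling and uniform sampling; let Z be its normalization
(`proposalMass`). If a proposal i is accepted with probability `acceptProb`, then i is proposed and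
accepted with probability D²(i)/(2Z). So an accepted proposal has exactly the D² law, and the number
of proposals for a center is geometric with mean 2Z/Φ, whichever index is finally accepted.

The difficulty is to stop in time in every execution when ζ is unknown and Φ too expensive to
compute. Before each center a uniform index j is drawn, and every proposal for this center is
charged X = D²(j). The mean of X is Φ/N, so the mean total charge is (Φ/N)(2Z/Φ) = 2Z/N: the unknown
Φ cancels. If j is already a center, then X = 0 and j is drawn again; each such draw is itself
charged M = Z/N. With t centers a useful j takes N/(N - t) draws on average, so a center costs 3Z/(N
- t) in expectation, whatever the later centers are. The fuel is 100 times the sum of these costs.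
By Markov's inequality, applied separately to each possible sequence of centers, exhaustion destroys
at most one hundredth of its probability (`le_endProb`), and it never adds any (`endProb_le`). On
the other hand every round burns at least δ²/2, where δ is the smallest distance, while the fuel is
at most 600 Δ² k (1 + log k), Δ being the largest; this bounds the number of rounds surely, by O(ζ²
k log k) for k ≥ 2 (`exists_rounds`). A round takes time O(kd + log N).

The approximation guarantee of the exact seeding (`seeding_cost_le`) follows the classical induction
over rounds and uncovered optimal clusters (`expCost_le`). It passes to the output because output
probabilities are at most the exact ones and the success probability is at least 0.99.

Sample-query access is implemented with prefix sums of squares; a sample is a binary search in which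
a biased coin chooses the half (`bisect_law`). Programs are tied to these laws by couplings (`Sim`):
`Sim.loop` turns a loop into a stopped Markov chain, after which only the chain has to be analysed.
-/

/-- From the configuration `cfg` the machine halts within `n` steps, with `ν` as the law of the
final memory. -/
def Reaches (env : SQOp → Cmd) (cfg : Config) (n : ℕ) (ν : PMF Mem) : Prop :=
  runSteps env n cfg = ν.map (fun m => (([], m) : Config))

theorem runSteps_nil (env : SQOp → Cmd) (n : ℕ) (m : Mem) :
    runSteps env n ([], m) = PMF.pure ([], m) := by
  induction n with
  | zero => rfl
  | succ n ih => simp [runSteps, step, PMF.pure_bind, ih]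

theorem runSteps_add (env : SQOp → Cmd) (a b : ℕ) (cfg : Config) :
    runSteps env (a + b) cfg = (runSteps env a cfg).bind (runSteps env b) := by
  induction a generalizing cfg with
  | zero => simp [runSteps, PMF.pure_bind]
  | succ a ih =>
    rw [Nat.add_right_comm]
    simp only [runSteps, PMF.bind_bind]
    congr 1
    funext c
    exact ih c

/-- A halted configuration never changes, so time bounds may be rounded up freely. -/
theorem Reaches.le {env : SQOp → Cmd} {cfg : Config} {n n' : ℕ} {ν : PMF Mem}
    (h : Reaches env cfg n ν) (hn : n ≤ n') : Reaches env cfg n' ν := by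
  obtain ⟨j, rfl⟩ := Nat.exists_eq_add_of_le hn
  unfold Reaches at h ⊢
  rw [runSteps_add, h, PMF.bind_map]
  rw [← PMF.bind_pure_comp]
  congr 1
  funext m
  simp [runSteps_nil]

theorem Reaches.of_step {env : SQOp → Cmd} {cfg cfg' : Config} {n : ℕ} {ν : PMF Mem}
    (hs : step env cfg = PMF.pure cfg') (h : Reaches env cfg' n ν) :
    Reaches env cfg (n + 1) ν := by
  unfold Reaches at h ⊢
  rw [runSteps, hs, PMF.pure_bind, h]

theorem PMF.bind_congr_support {α β : Type*} (p : PMF α) {f g : α → PMF β}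
    (h : ∀ a ∈ p.support, f a = g a) : p.bind f = p.bind g := by
  ext b
  simp only [PMF.bind_apply]
  refine tsum_congr fun a => ?_
  by_cases ha : p a = 0
  · simp [ha]
  · rw [h a ((PMF.mem_support_iff _ _).2 ha)]

/-- Started in memory `m`, the command `c` takes at most `T` steps, whatever the coins show, and the
law of the final memory can be coupled with the law `ν` such that the relation `R` holds. -/
def Sim (env : SQOp → Cmd) (c : Cmd) (m : Mem) (T : ℕ) {α : Type} (ν : PMF α)
    (R : α → Mem → Prop) : Prop :=
  ∃ μ : PMF (α × Mem), μ.map Prod.fst = ν ∧ (∀ p ∈ μ.support, R p.1 p.2) ∧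
    ∀ (K : List Cmd) (n : ℕ) (f : α × Mem → PMF Mem),
      (∀ p ∈ μ.support, Reaches env (K, p.2) n (f p)) →
        Reaches env (c :: K, m) (T + n) (μ.bind f)

/-- Started in memory `m`, the command `c` takes at most `T` steps and its outcome, which satisfies
`Q`, does not depend on the coins. -/
def Det (env : SQOp → Cmd) (c : Cmd) (m : Mem) (T : ℕ) (Q : Mem → Prop) : Prop :=
  Sim env c m T (PMF.pure ()) (fun _ => Q)

variable {env : SQOp → Cmd} {c a b : Cmd} {m : Mem} {T T₁ T₂ : ℕ} {α β : Type}

theorem Sim.le {ν : PMF α} {R : α → Mem → Prop} (h : Sim env c m T₁ ν R) (hT : T₁ ≤ T) :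
    Sim env c m T ν R := by
  obtain ⟨μ, h1, h2, h3⟩ := h
  exact ⟨μ, h1, h2, fun K n f hf => (h3 K n f hf).le (by omega)⟩

theorem Det.le {Q : Mem → Prop} (h : Det env c m T₁ Q) (hT : T₁ ≤ T) : Det env c m T Q :=
  Sim.le h hT

theorem Sim.map {ν : PMF α} {R : α → Mem → Prop} {R' : β → Mem → Prop} (g : α → β)
    (h : Sim env c m T ν R) (hR : ∀ x ∈ ν.support, ∀ m', R x m' → R' (g x) m') :
    Sim env c m T (ν.map g) R' := by
  obtain ⟨μ, h1, h2, h3⟩ := h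
  refine ⟨μ.map (fun p => (g p.1, p.2)), ?_, ?_, ?_⟩
  · rw [← h1, PMF.map_comp, PMF.map_comp]; rfl
  · rintro p hp
    rw [PMF.mem_support_map_iff] at hp
    obtain ⟨q, hq, rfl⟩ := hp
    refine hR _ ?_ _ (h2 q hq)
    rw [← h1, PMF.mem_support_map_iff]
    exact ⟨q, hq, rfl⟩
  · intro K n f hf
    rw [PMF.bind_map]
    refine h3 K n _ fun p hp => hf (g p.1, p.2) ?_
    rw [PMF.mem_support_map_iff]
    exact ⟨p, hp, rfl⟩

theorem Sim.conseq {ν : PMF α} {R R' : α → Mem → Prop} (h : Sim env c m T ν R)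
    (hR : ∀ x ∈ ν.support, ∀ m', R x m' → R' x m') : Sim env c m T ν R' := by
  have := h.map (R' := R') id hR
  rwa [PMF.map_id] at this

theorem Det.conseq {Q Q' : Mem → Prop} (h : Det env c m T Q) (hQ : ∀ m', Q m' → Q' m') :
    Det env c m T Q' :=
  Sim.conseq h fun _ _ => hQ

theorem Det.sim {R : α → Mem → Prop} {x : α} (h : Det env c m T (R x)) :
    Sim env c m T (PMF.pure x) R := by
  have := Sim.map (R' := R) (fun _ : Unit => x) h (fun _ _ _ => id)
  rwa [PMF.pure_map] at this

theorem Det.of_step {Q : Mem → Prop} {m' : Mem}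
    (hs : ∀ K, step env (c :: K, m) = PMF.pure (K, m')) (hQ : Q m') : Det env c m 1 Q := by
  refine ⟨PMF.pure ((), m'), PMF.pure_map _ _, ?_, ?_⟩
  · simpa using hQ
  · intro K n f hf
    rw [PMF.pure_bind, Nat.add_comm]
    exact Reaches.of_step (hs K) (hf ((), m') (by simp))

theorem Det.skip {Q : Mem → Prop} (h : Q m) : Det env Cmd.skip m 1 Q :=
  Det.of_step (fun _ => rfl) h

theorem Det.setNV {Q : Mem → Prop} {s : Side} {x : ℕ} {e : NExp}
    (h : Q (m.upd s ((m s).setNV x (e.eval m)))) : Det env (Cmd.setNV s x e) m 1 Q :=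
  Det.of_step (fun _ => rfl) h

theorem Det.setRV {Q : Mem → Prop} {s : Side} {x : ℕ} {e : RExp}
    (h : Q (m.upd s ((m s).setRV x (e.eval m)))) : Det env (Cmd.setRV s x e) m 1 Q :=
  Det.of_step (fun _ => rfl) h

theorem Det.setNA {Q : Mem → Prop} {s : Side} {x : ℕ} {i j e : NExp}
    (h : Q (m.upd s ((m s).setNA x (i.eval m) (j.eval m) (e.eval m)))) :
    Det env (Cmd.setNA s x i j e) m 1 Q :=
  Det.of_step (fun _ => rfl) h

theorem Det.setRA {Q : Mem → Prop} {s : Side} {x : ℕ} {i j : NExp} {e : RExp}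
    (h : Q (m.upd s ((m s).setRA x (i.eval m) (j.eval m) (e.eval m)))) :
    Det env (Cmd.setRA s x i j e) m 1 Q :=
  Det.of_step (fun _ => rfl) h

theorem Sim.flip {R : Bool → Mem → Prop} {s : Side} {x : ℕ} {p : RExp}
    (h : ∀ o : Bool, R o (m.upd s ((m s).setNV x (if o then 1 else 0)))) :
    Sim env (Cmd.flip s x p) m 1 (coin (p.eval m)) R := by
  refine ⟨(coin (p.eval m)).map (fun o => (o, m.upd s ((m s).setNV x (if o then 1 else 0)))),
    ?_, ?_, ?_⟩
  · rw [PMF.map_comp]; exact PMF.map_id _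
  · intro q hq
    rw [PMF.mem_support_map_iff] at hq
    obtain ⟨o, -, rfl⟩ := hq
    exact h o
  · intro K n f hf
    unfold Reaches at hf ⊢
    rw [Nat.add_comm, runSteps, step, PMF.bind_map, PMF.bind_map, PMF.map_bind]
    refine PMF.bind_congr_support _ fun o ho => ?_
    refine hf (o, m.upd s ((m s).setNV x (if o then 1 else 0))) ?_
    rw [PMF.mem_support_map_iff]
    exact ⟨o, ho, rfl⟩

/-- Since `Sim` quantifies over the rest of the stack, `b` is simply part of the continuation handed
to `a`, and the couplings are glued along `κ`. The extra step unfolds `seq`. -/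
theorem Sim.seq {ν : PMF α} {R : α → Mem → Prop} {κ : α → PMF β} {R' : β → Mem → Prop}
    (ha : Sim env a m T₁ ν R)
    (hb : ∀ x ∈ ν.support, ∀ m', R x m' → Sim env b m' T₂ (κ x) R') :
    Sim env (Cmd.seq a b) m (T₁ + T₂ + 1) (ν.bind κ) R' := by
  classical
  obtain ⟨μ, h1, h2, h3⟩ := ha
  have hb' : ∀ p : α × Mem, p ∈ μ.support → Sim env b p.2 T₂ (κ p.1) R' := fun p hp => by
    refine hb _ ?_ _ (h2 p hp)
    rw [← h1, PMF.mem_support_map_iff]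
    exact ⟨p, hp, rfl⟩
  -- A coupling for `b` is available only from memories that `a` can reach; elsewhere any law
  -- serves, so that a total kernel can be chosen.
  have hex : ∀ p : α × Mem, ∃ μ' : PMF (β × Mem), p ∈ μ.support →
      μ'.map Prod.fst = κ p.1 ∧ (∀ q ∈ μ'.support, R' q.1 q.2) ∧
      ∀ (K : List Cmd) (n : ℕ) (f : β × Mem → PMF Mem),
      (∀ q ∈ μ'.support, Reaches env (K, q.2) n (f q)) →
        Reaches env (b :: K, p.2) (T₂ + n) (μ'.bind f) := fun p => by
    by_cases hp : p ∈ μ.support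
    · obtain ⟨μ', h⟩ := hb' p hp
      exact ⟨μ', fun _ => h⟩
    · obtain ⟨x, -⟩ := (κ p.1).support_nonempty
      exact ⟨PMF.pure (x, m), fun h => absurd h hp⟩
  choose μ' hμ' using hex
  refine ⟨μ.bind μ', ?_, ?_, ?_⟩
  · rw [PMF.map_bind, ← h1, PMF.bind_map]
    exact PMF.bind_congr_support _ fun p hp => (hμ' p hp).1
  · intro q hq
    rw [PMF.mem_support_bind_iff] at hq
    obtain ⟨p, hp, hq⟩ := hq
    exact (hμ' p hp).2.1 q hq
  · intro K n f hf
    rw [PMF.bind_bind, show T₁ + T₂ + 1 + n = (T₁ + (T₂ + n)) + 1 by ring]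
    refine Reaches.of_step (cfg' := (a :: b :: K, m)) rfl ?_
    refine h3 (b :: K) (T₂ + n) _ fun p hp => (hμ' p hp).2.2 K n f fun q hq => hf q ?_
    rw [PMF.mem_support_bind_iff]
    exact ⟨p, hp, hq⟩

theorem Sim.det_seq {Q : Mem → Prop} {ν : PMF β} {R : β → Mem → Prop}
    (ha : Det env a m T₁ Q) (hb : ∀ m', Q m' → Sim env b m' T₂ ν R) :
    Sim env (Cmd.seq a b) m (T₁ + T₂ + 1) ν R := by
  have := Sim.seq (κ := fun _ => ν) ha fun _ _ => hb
  rwa [PMF.pure_bind] at this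

theorem Sim.seq_det {ν : PMF α} {R R' : α → Mem → Prop}
    (ha : Sim env a m T₁ ν R) (hb : ∀ x ∈ ν.support, ∀ m', R x m' → Det env b m' T₂ (R' x)) :
    Sim env (Cmd.seq a b) m (T₁ + T₂ + 1) ν R' := by
  have := Sim.seq (κ := PMF.pure) ha fun x hx m' h => (hb x hx m' h).sim
  rwa [PMF.bind_pure] at this

theorem Det.seq {Q Q' : Mem → Prop} (ha : Det env a m T₁ Q)
    (hb : ∀ m', Q m' → Det env b m' T₂ Q') : Det env (Cmd.seq a b) m (T₁ + T₂ + 1) Q' :=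
  Sim.det_seq ha hb

theorem Sim.cons {c' : Cmd} {ν : PMF α} {R : α → Mem → Prop} {m' : Mem}
    (hs : ∀ K, step env (c :: K, m) = PMF.pure (c' :: K, m'))
    (h : Sim env c' m' T ν R) : Sim env c m (T + 1) ν R := by
  obtain ⟨μ, h1, h2, h3⟩ := h
  refine ⟨μ, h1, h2, fun K n f hf => ?_⟩
  rw [Nat.add_right_comm]
  exact Reaches.of_step (hs K) (h3 K n f hf)

theorem Sim.ite {t : Test} {ν : PMF α} {R : α → Mem → Prop}
    (ha : t.Holds m → Sim env a m T₁ ν R) (hb : ¬ t.Holds m → Sim env b m T₂ ν R) :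
    Sim env (Cmd.ite t a b) m (max T₁ T₂ + 1) ν R := by
  by_cases h : t.Holds m
  · exact Sim.cons (m' := m) (c' := a) (fun K => by simp [step, h]) ((ha h).le (le_max_left _ _))
  · exact Sim.cons (m' := m) (c' := b) (fun K => by simp [step, h]) ((hb h).le (le_max_right _ _))

theorem Det.ite {t : Test} {Q : Mem → Prop}
    (ha : t.Holds m → Det env a m T₁ Q) (hb : ¬ t.Holds m → Det env b m T₂ Q) :
    Det env (Cmd.ite t a b) m (max T₁ T₂ + 1) Q :=
  Sim.ite ha hb

theorem Sim.call {q : SQOp} {ν : PMF α} {R : α → Mem → Prop} (h : Sim env (env q) m T ν R) :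
    Sim env (Cmd.call q) m (T + 1) ν R :=
  Sim.cons (m' := m) (c' := env q) (fun _ => rfl) h

theorem Det.call {q : SQOp} {Q : Mem → Prop} (h : Det env (env q) m T Q) :
    Det env (Cmd.call q) m (T + 1) Q :=
  Sim.call h

theorem Det.loop_exit {t : Test} {Q : Mem → Prop} (ht : ¬ t.Holds m) (hQ : Q m) :
    Det env (Cmd.loop t c) m 1 Q :=
  Det.of_step (fun K => by simp [step, ht]) hQ

/-- When the test holds, one step turns both `loop t c` and `seq c (loop t c)` into the same stack,
hence the same budget `T`. -/
theorem Sim.loop_enter {t : Test} {ν : PMF α} {R : α → Mem → Prop} (ht : t.Holds m)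
    (h : Sim env (Cmd.seq c (Cmd.loop t c)) m T ν R) : Sim env (Cmd.loop t c) m T ν R := by
  obtain ⟨μ, h1, h2, h3⟩ := h
  refine ⟨μ, h1, h2, fun K n f hf => ?_⟩
  have := h3 K n f hf
  unfold Reaches at this ⊢
  rw [← this]
  cases hn : T + n with
  -- With no step to make, a nonempty stack would already count as halted.
  | zero =>
    rw [hn] at this
    have h0 := congrArg PMF.support this
    simp only [runSteps, PMF.support_pure, PMF.support_map] at h0
    have : ((Cmd.seq c (Cmd.loop t c) :: K, m) : Config) ∈
      (fun m => (([], m) : Config)) '' (μ.bind f).support := h0 ▸ Set.mem_singleton _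
    obtain ⟨_, _, h⟩ := this
    simp at h
  | succ n => simp [runSteps, step, ht]

/-- At most `n` transitions of a Markov chain that stops when `g` fails. -/
def chain (g : α → Prop) [DecidablePred g] (κ : α → PMF α) : ℕ → α → PMF α
  | 0, x => PMF.pure x
  | n + 1, x => if g x then (κ x).bind (chain g κ n) else PMF.pure x

/-- `V n x` is a variant: at most `n` passes remain. It has to drop along every outcome in the
support, so the time bound holds whatever the coins show and the truncated chain is the exact law.
-/
theorem Sim.loop {g : α → Prop} [DecidablePred g] {κ : α → PMF α} {R : α → Mem → Prop}
    {t : Test} (V : ℕ → α → Prop)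
    (hg : ∀ x m, R x m → (t.Holds m ↔ g x))
    (h0 : ∀ x, V 0 x → ¬ g x)
    (hV : ∀ n x, V (n + 1) x → g x → ∀ y ∈ (κ x).support, V n y)
    (hc : ∀ n x m, V (n + 1) x → g x → R x m → Sim env c m T (κ x) R)
    (n : ℕ) (x : α) (m : Mem) (hx : V n x) (hm : R x m) :
    Sim env (Cmd.loop t c) m (n * (T + 2) + 1) (chain g κ n x) R := by
  induction n generalizing x m with
  | zero =>
    have : ¬ t.Holds m := fun h => h0 x hx ((hg x m hm).1 h)
    rw [Nat.zero_mul, zero_add, chain]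
    exact Det.sim (Det.loop_exit this hm)
  | succ n ih =>
    rw [chain]
    split_ifs with h
    · refine Sim.loop_enter ((hg x m hm).2 h) ?_
      refine Sim.le (Sim.seq (hc n x m hx h hm) fun y hy m' hm' =>
        ih y m' (hV n x hx h y hy) hm') ?_
      ring_nf; omega
    · have : ¬ t.Holds m := fun h' => h ((hg x m hm).1 h')
      exact (Det.sim (Det.loop_exit this hm)).le (by omega)

/-- The rule for counting loops. -/
theorem Det.loop {t : Test} (I : ℕ → Mem → Prop) (n : ℕ)
    (ht : ∀ i m, i ≤ n → I i m → (t.Holds m ↔ i < n))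
    (hc : ∀ i m, i < n → I i m → Det env c m T (I (i + 1)))
    (i : ℕ) (hi : i ≤ n) (hm : I i m) :
    Det env (Cmd.loop t c) m ((n - i) * (T + 2) + 1) (I n) := by
  obtain ⟨j, rfl⟩ := Nat.exists_eq_add_of_le hi
  rw [Nat.add_sub_cancel_left]
  clear hi
  induction j generalizing i m with
  | zero =>
    refine (Det.loop_exit (Q := I i) ?_ hm).le (by omega)
    rw [ht i m le_rfl hm]; simp
  | succ j ih =>
    refine Sim.loop_enter ((ht i m (by omega) hm).2 (by omega)) ?_
    refine Sim.le (Sim.det_seq (hc i m (by omega) hm) fun m' hm' => ?_) (T₁ := T + (j * (T + 2) + 1) + 1) ?_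
    · have := ih (i + 1) hm' (by rwa [show i + 1 + j = i + (j + 1) by ring])
        (by rwa [show i + 1 + j = i + (j + 1) by ring])
      rwa [show i + 1 + j = i + (j + 1) by ring] at this
    · ring_nf; omega

theorem Sim.halts {ν : PMF α} {R : α → Mem → Prop} (h : Sim env c m T ν R) :
    HaltsWithin env c m T := by
  obtain ⟨μ, -, -, h3⟩ := h
  have := h3 [] 0 (fun p => PMF.pure p.2) fun p _ => by
    simp [Reaches, runSteps, PMF.pure_map]
  intro cfg hcfg
  unfold Reaches at this
  rw [Nat.add_zero] at this
  rw [this, PMF.mem_support_map_iff] at hcfg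
  obtain ⟨_, _, rfl⟩ := hcfg
  rfl

/-- The empty stack with no further steps, taken as continuation, exposes the coupling as the actual
law of the final memory. -/
theorem Sim.memLaw {ν : PMF α} {R : α → Mem → Prop} (h : Sim env c m T ν R) :
    ∃ μ : PMF (α × Mem), μ.map Prod.fst = ν ∧ (∀ p ∈ μ.support, R p.1 p.2) ∧
      memLaw env c m T = μ.map Prod.snd := by
  obtain ⟨μ, h1, h2, h3⟩ := h
  refine ⟨μ, h1, h2, ?_⟩
  have := h3 [] 0 (fun p => PMF.pure p.2) fun p _ => by
    simp [Reaches, runSteps, PMF.pure_map]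
  unfold Reaches at this
  rw [Nat.add_zero] at this
  rw [_root_.memLaw, this, PMF.map_comp]
  show PMF.map id _ = _
  rw [PMF.map_id]
  exact PMF.bind_pure_comp _ _

theorem Sim.memLaw_support {ν : PMF α} {R : α → Mem → Prop} (h : Sim env c m T ν R)
    {m' : Mem} (hm : m' ∈ (_root_.memLaw env c m T).support) : ∃ x ∈ ν.support, R x m' := by
  obtain ⟨μ, h1, h2, h3⟩ := h.memLaw
  rw [h3, PMF.mem_support_map_iff] at hm
  obtain ⟨p, hp, rfl⟩ := hm
  refine ⟨p.1, ?_, h2 p hp⟩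
  rw [← h1, PMF.mem_support_map_iff]
  exact ⟨p, hp, rfl⟩

theorem PMF.map_congr_support {α β : Type*} (p : PMF α) {f g : α → β}
    (h : ∀ a ∈ p.support, f a = g a) : p.map f = p.map g := by
  rw [← PMF.bind_pure_comp, ← PMF.bind_pure_comp]
  exact PMF.bind_congr_support _ fun a ha => by simp [h a ha]

/-- An output that the abstract state determines has the law computed abstractly; from there on
probabilities concern `ν` only. -/
theorem Sim.map_memLaw {ν : PMF α} {R : α → Mem → Prop} (h : Sim env c m T ν R)
    (out : Mem → β) (g : α → β) (hR : ∀ x m', R x m' → out m' = g x) :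
    (_root_.memLaw env c m T).map out = ν.map g := by
  obtain ⟨μ, h1, h2, h3⟩ := h.memLaw
  rw [h3, ← h1, PMF.map_comp, PMF.map_comp]
  exact PMF.map_congr_support _ fun p hp => hR _ _ (h2 p hp)

end

noncomputable section

/-! ### Sampling from prefix sums -/

theorem coin_bind_toReal {β : Type} {q : ℝ} (h0 : 0 ≤ q) (h1 : q ≤ 1) (f : Bool → PMF β) (y : β) :
    (((coin q).bind f) y).toReal = q * (f true y).toReal + (1 - q) * (f false y).toReal := by
  rw [PMF.bind_apply, tsum_fintype, Fintype.sum_bool, ENNReal.toReal_add, ENNReal.toReal_mul,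
    ENNReal.toReal_mul]
  · have e1 : max 0 (min 1 q) = q := by rw [min_eq_right h1, max_eq_right h0]
    simp [coin, e1, ENNReal.toReal_ofReal h0, ENNReal.toReal_ofReal (sub_nonneg.2 h1)]
  · exact ENNReal.mul_ne_top (PMF.apply_ne_top _ _) (PMF.apply_ne_top _ _)
  · exact ENNReal.mul_ne_top (PMF.apply_ne_top _ _) (PMF.apply_ne_top _ _)

theorem bind_toReal {ι β : Type} [Fintype ι] (p : PMF ι) (f : ι → PMF β) (y : β) :
    ((p.bind f) y).toReal = ∑ i, (p i).toReal * (f i y).toReal := by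
  rw [PMF.bind_apply, tsum_fintype, ENNReal.toReal_sum]
  · simp
  · exact fun i _ => ENNReal.mul_ne_top (PMF.apply_ne_top _ _) (PMF.apply_ne_top _ _)

open Classical in
theorem pure_toReal {β : Type} (x y : β) :
    ((PMF.pure x) y).toReal = if y = x then 1 else 0 := by
  rw [PMF.pure_apply]
  split_ifs <;> simp

/-- The law on a finite type with prescribed point masses. -/
def weightedPMF {ι : Type} [Fintype ι] (w : ι → ℝ) (h0 : ∀ i, 0 ≤ w i) (h1 : ∑ i, w i = 1) :
    PMF ι :=
  PMF.ofFintype (fun i => ENNReal.ofReal (w i)) (by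
    rw [← ENNReal.ofReal_sum_of_nonneg fun i _ => h0 i, h1, ENNReal.ofReal_one])

theorem weightedPMF_toReal {ι : Type} [Fintype ι] (w : ι → ℝ) (h0 : ∀ i, 0 ≤ w i)
    (h1 : ∑ i, w i = 1) (i : ι) : (weightedPMF w h0 h1 i).toReal = w i :=
  ENNReal.toReal_ofReal (h0 i)

theorem PMF.ext_toReal {β : Type} {p q : PMF β} (h : ∀ y, (p y).toReal = (q y).toReal) : p = q := by
  ext y
  exact (ENNReal.toReal_eq_toReal_iff' (PMF.apply_ne_top _ _) (PMF.apply_ne_top _ _)).1 (h y)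

/-- `lo + 1 < hi`: the interval `[lo, hi)` can be split. -/
abbrev splittable (x : ℕ × ℕ) : Prop := x.1 + 1 < x.2

/-- Pass to a random half of the interval, with probabilities proportional to the increments
of `p`. -/
def halve (p : ℕ → ℝ) (x : ℕ × ℕ) : PMF (ℕ × ℕ) :=
  (coin ((p ((x.1 + x.2) / 2) - p x.1) / (p x.2 - p x.1))).map fun o =>
    if o then (x.1, (x.1 + x.2) / 2) else ((x.1 + x.2) / 2, x.2)

/-- Along the path to an index the conditional probabilities of the halves telescope to the
increment of `p` over its total increase. The reduction modulo `N` only casts the endpoint to `Fin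
N`; it changes nothing as `hi ≤ N`. -/
theorem bisect_law {p : ℕ → ℝ} (hp : Monotone p) {N : ℕ} (hN : 0 < N) (n lo hi : ℕ)
    (hlt : lo < hi) (hn : hi ≤ lo + 2 ^ n) (hhi : hi ≤ N) (hpos : p lo < p hi) (i : Fin N) :
    (((chain splittable (halve p) n (lo, hi)).map
      fun x => (⟨x.1 % N, Nat.mod_lt _ hN⟩ : Fin N)) i).toReal =
      if lo ≤ i ∧ i < hi then (p (i + 1) - p i) / (p hi - p lo) else 0 := by
  have hbase : ∀ lo hi : ℕ, hi = lo + 1 → hi ≤ N → p lo < p hi →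
      (((PMF.pure (lo, hi)).map
      fun x => (⟨x.1 % N, Nat.mod_lt _ hN⟩ : Fin N)) i).toReal =
      if lo ≤ i ∧ i < hi then (p (i + 1) - p i) / (p hi - p lo) else 0 := by
    intro lo hi h1 h2 h3
    subst h1
    rw [PMF.pure_map, pure_toReal]
    have : (i = (⟨lo % N, Nat.mod_lt _ hN⟩ : Fin N)) ↔ lo ≤ i ∧ (i : ℕ) < lo + 1 := by
      rw [Fin.ext_iff]
      simp only [Nat.mod_eq_of_lt (show lo < N by omega)]
      omega
    simp only [this]
    split_ifs with h
    · have : (i : ℕ) = lo := by omega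
      rw [this, div_self (sub_pos.2 h3).ne']
    · rfl
  induction n generalizing lo hi with
  | zero => exact hbase lo hi (by omega) hhi hpos
  | succ n ih =>
    rw [chain]
    by_cases h : splittable (lo, hi)
    swap
    · rw [if_neg h]
      exact hbase lo hi (by simp at h; omega) hhi hpos
    rw [if_pos h]
    simp only [splittable] at h
    rw [halve, PMF.bind_map, PMF.map_bind]
    simp only
    set mid := (lo + hi) / 2 with hmid
    have hlo : p lo ≤ p mid := hp (by omega)
    have hmi : p mid ≤ p hi := hp (by omega)
    have hD : 0 < p hi - p lo := sub_pos.2 hpos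
    rw [coin_bind_toReal (div_nonneg (sub_nonneg.2 hlo) hD.le)
      ((div_le_one hD).2 (by linarith))]
    have h2 : 2 ^ (n + 1) = 2 * 2 ^ n := by ring
    simp only [Function.comp, if_true, Bool.false_eq_true, if_false]
    have e1 : 1 - (p mid - p lo) / (p hi - p lo) = (p hi - p mid) / (p hi - p lo) := by
      field_simp; ring
    rw [e1]
    have hi1 : p i ≤ p (i + 1) := hp (by omega)
    have A : (p mid - p lo) / (p hi - p lo) * (((chain splittable (halve p) n (lo, mid)).map
      fun x => (⟨x.1 % N, Nat.mod_lt _ hN⟩ : Fin N)) i).toReal =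
      if lo ≤ i ∧ i < mid then (p (i + 1) - p i) / (p hi - p lo) else 0 := by
      -- A half without mass is entered with probability zero. The induction hypothesis is not
      -- available there, but by monotonicity all increments inside vanish.
      rcases hlo.eq_or_lt with h0 | h0
      · rw [← h0, sub_self, zero_div, zero_mul]
        split_ifs with h3
        · have : p lo ≤ p i := hp h3.1
          have : p (i + 1) ≤ p mid := hp (by omega)
          rw [show p (i + 1) - p i = 0 by linarith, zero_div]
        · rfl
      · rw [ih lo mid (by omega) (by omega) (by omega) h0]
        split_ifs
        · have := sub_pos.2 h0
          field_simp
        · simp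
    have B : (p hi - p mid) / (p hi - p lo) * (((chain splittable (halve p) n (mid, hi)).map
      fun x => (⟨x.1 % N, Nat.mod_lt _ hN⟩ : Fin N)) i).toReal =
      if mid ≤ i ∧ i < hi then (p (i + 1) - p i) / (p hi - p lo) else 0 := by
      rcases hmi.eq_or_lt with h0 | h0
      · rw [← h0, sub_self, zero_div, zero_mul]
        split_ifs with h3
        · have : p mid ≤ p i := hp h3.1
          have : p (i + 1) ≤ p hi := hp (by omega)
          rw [show p (i + 1) - p i = 0 by linarith, zero_div]
        · rfl
      · rw [ih mid hi (by omega) (by omega) (by omega) h0]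
        split_ifs
        · have := sub_pos.2 h0
          field_simp
        · simp
    rw [A, B]
    split_ifs <;> first | omega | simp

/-- `m'` is `m` up to the integer scratch variables `7, …, 10` of bank `s`. -/
def ScratchEq (s : Side) (m m' : Mem) : Prop :=
  m' = m.upd s { m s with nv := (m' s).nv } ∧ ∀ x, x < 7 ∨ 10 < x → (m' s).nv x = (m s).nv x

@[simp] theorem Mem.upd_same (m : Mem) (s : Side) (σ : Store) : m.upd s σ s = σ := by
  simp [Mem.upd]

@[simp] theorem Mem.upd_pub_hid (m : Mem) (σ : Store) : m.upd Side.pub σ Side.hid = m Side.hid := by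
  simp [Mem.upd]

@[simp] theorem Mem.upd_hid_pub (m : Mem) (σ : Store) : m.upd Side.hid σ Side.pub = m Side.pub := by
  simp [Mem.upd]

@[simp] theorem Mem.upd_upd (m : Mem) (s : Side) (σ τ : Store) : (m.upd s σ).upd s τ = m.upd s τ := by
  simp [Mem.upd]

@[simp] theorem Mem.upd_self (m : Mem) (s : Side) : m.upd s (m s) = m := by
  simp [Mem.upd]

theorem ScratchEq.refl (s : Side) (m : Mem) : ScratchEq s m m := by
  refine ⟨?_, fun _ _ => rfl⟩
  exact (Mem.upd_self m s).symm

theorem ScratchEq.setNV {s : Side} {m m' : Mem} (h : ScratchEq s m m') {x : ℕ}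
    (hx : 7 ≤ x ∧ x ≤ 10) (v : ℕ) : ScratchEq s m (m'.upd s ((m' s).setNV x v)) := by
  obtain ⟨h1, h2⟩ := h
  refine ⟨?_, fun y hy => ?_⟩
  · have : m' s = { m s with nv := (m' s).nv } := by
      conv_lhs => rw [h1]
      simp
    rw [Mem.upd_same]
    conv_lhs => rw [h1, Mem.upd_upd]
    simp only [Store.setNV, Mem.upd_same]
  · rw [← h2 y hy]
    simp only [Mem.upd_same, Store.setNV]
    exact Function.update_of_ne (by omega) _ _

theorem ScratchEq.other {s s' : Side} {m m' : Mem} (h : ScratchEq s m m') (hs : s' ≠ s) :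
    m' s' = m s' := by
  rw [h.1, Mem.upd, Function.update_of_ne hs]

theorem ScratchEq.ra {s s' : Side} {m m' : Mem} (h : ScratchEq s m m') : (m' s').ra = (m s').ra := by
  by_cases hs : s' = s
  · subst hs; rw [h.1]; simp
  · rw [h.other hs]

theorem ScratchEq.rv {s s' : Side} {m m' : Mem} (h : ScratchEq s m m') : (m' s').rv = (m s').rv := by
  by_cases hs : s' = s
  · subst hs; rw [h.1]; simp
  · rw [h.other hs]

theorem ScratchEq.na {s s' : Side} {m m' : Mem} (h : ScratchEq s m m') : (m' s').na = (m s').na := by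
  by_cases hs : s' = s
  · subst hs; rw [h.1]; simp
  · rw [h.other hs]

theorem ScratchEq.nv {s s' : Side} {m m' : Mem} (h : ScratchEq s m m') {x : ℕ}
    (hx : x < 7 ∨ 10 < x) : (m' s').nv x = (m s').nv x := by
  by_cases hs : s' = s
  · subst hs; exact h.2 x hx
  · rw [h.other hs]

/-- Binary search for a random index: the scratch variables `7` and `8` of bank `s` hold the ends of
an interval, which is halved until it has length one. The two halves are chosen with probabilities
proportional to the increments of `P`. -/
def descend (s : Side) (P : NExp → RExp) : Cmd :=
  Cmd.loop (Test.nlt (NExp.add (NExp.var s 7) (NExp.lit 1)) (NExp.var s 8))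
    (Cmd.seq (Cmd.setNV s 9 (NExp.half (NExp.add (NExp.var s 7) (NExp.var s 8))))
    (Cmd.seq (Cmd.flip s 10
        (RExp.div (RExp.sub (P (NExp.var s 9)) (P (NExp.var s 7)))
          (RExp.sub (P (NExp.var s 8)) (P (NExp.var s 7)))))
      (Cmd.ite (Test.neq (NExp.var s 10) (NExp.lit 1))
        (Cmd.setNV s 8 (NExp.var s 9)) (Cmd.setNV s 7 (NExp.var s 9)))))

/-- `P` is program text for `p`. It has to be right only at arguments up to `N` and in memories that
differ from `m₀` in scratch variables, as the search writes nothing else. -/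
theorem Sim.descend_chain {env : SQOp → Cmd} {s : Side} {P : NExp → RExp} {p : ℕ → ℝ} {N : ℕ}
    (m₀ : Mem) (hP : ∀ m, ScratchEq s m₀ m → ∀ x, (m s).nv x ≤ N →
      (P (NExp.var s x)).eval m = p ((m s).nv x))
    (n lo hi : ℕ) (hlt : lo < hi) (hn : hi ≤ lo + 2 ^ n) (hhi : hi ≤ N) (m : Mem)
    (hm : ScratchEq s m₀ m) (h7 : (m s).nv 7 = lo) (h8 : (m s).nv 8 = hi) :
    Sim env (descend s P) m (n * 8 + 1) (chain splittable (halve p) n (lo, hi))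
      (fun x m' => ScratchEq s m₀ m' ∧ (m' s).nv 7 = x.1 ∧ (m' s).nv 8 = x.2 ∧
        x.1 < x.2 ∧ x.2 ≤ N) := by
  -- The variant: an interval of length at most `2 ^ n` survives at most `n` halvings.
  refine Sim.loop (T := 6) (fun n x => x.1 < x.2 ∧ x.2 ≤ x.1 + 2 ^ n ∧ x.2 ≤ N)
    ?_ ?_ ?_ ?_ n (lo, hi) m ⟨hlt, hn, hhi⟩ ⟨hm, h7, h8, hlt, hhi⟩
  · rintro x m ⟨-, h1, h2, -⟩
    simp [Test.Holds, NExp.eval, h1, h2]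
  · rintro x ⟨h1, h2, h3⟩
    simp at h2 ⊢
    omega
  · rintro n x ⟨h1, h2, h3⟩ hg y hy
    have e : 2 ^ (n + 1) = 2 * 2 ^ n := by ring
    rw [halve, PMF.mem_support_map_iff] at hy
    obtain ⟨o, -, rfl⟩ := hy
    simp only [splittable] at hg
    cases o <;> simp <;> omega
  · rintro n x m ⟨-, -, -⟩ hg ⟨h1, h2, h3, h4, h5⟩
    simp only [splittable] at hg
    refine Sim.le (Sim.det_seq (Q := fun m' => ScratchEq s m₀ m' ∧ (m' s).nv 7 = x.1 ∧
      (m' s).nv 8 = x.2 ∧ (m' s).nv 9 = (x.1 + x.2) / 2) (Det.setNV ?_) ?_)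
      (T₁ := 1 + 4 + 1) (by norm_num)
    · refine ⟨h1.setNV (by norm_num) _, ?_, ?_, ?_⟩ <;>
        simp [Store.setNV, NExp.eval, h2, h3]
    · rintro m' ⟨g1, g2, g3, g4⟩
      have ef : (RExp.div (RExp.sub (P (NExp.var s 9)) (P (NExp.var s 7)))
          (RExp.sub (P (NExp.var s 8)) (P (NExp.var s 7)))).eval m' =
          (p ((x.1 + x.2) / 2) - p x.1) / (p x.2 - p x.1) := by
        simp only [RExp.eval]
        rw [hP m' g1 9 (by omega), hP m' g1 8 (by omega), hP m' g1 7 (by omega), g2, g3, g4]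
      have hf := Sim.flip (env := env) (s := s) (x := 10) (m := m')
        (p := RExp.div (RExp.sub (P (NExp.var s 9)) (P (NExp.var s 7)))
          (RExp.sub (P (NExp.var s 8)) (P (NExp.var s 7))))
        (R := fun o m'' => ScratchEq s m₀ m'' ∧ (m'' s).nv 7 = x.1 ∧
          (m'' s).nv 8 = x.2 ∧ (m'' s).nv 9 = (x.1 + x.2) / 2 ∧
          (m'' s).nv 10 = if o then 1 else 0) (fun o => by
            refine ⟨g1.setNV (by norm_num) _, ?_, ?_, ?_, ?_⟩ <;>
            simp [Store.setNV, g2, g3, g4])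
      rw [ef] at hf
      rw [halve, ← PMF.bind_pure_comp]
      refine Sim.le (Sim.seq (T₂ := 2) hf ?_) (by norm_num)
      rintro o - m'' ⟨k1, k2, k3, k4, k5⟩
      refine Det.sim ?_
      refine Det.le (Det.ite (T₁ := 1) (T₂ := 1) ?_ ?_) (by norm_num)
      · intro ht
        have ho : o = true := by
          by_contra hne
          simp [Test.Holds, NExp.eval, k5, hne] at ht
        subst ho
        refine Det.setNV ⟨k1.setNV (by norm_num) _, ?_⟩
        simp [Store.setNV, NExp.eval, k2, k4]
        omega
      · intro ht
        have ho : o = false := by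
          by_contra hne
          simp [Test.Holds, NExp.eval, k5, hne] at ht
        subst ho
        refine Det.setNV ⟨k1.setNV (by norm_num) _, ?_⟩
        simp [Store.setNV, NExp.eval, k3, k4]
        omega

theorem Sim.descend {env : SQOp → Cmd} {s : Side} {P : NExp → RExp} {p : ℕ → ℝ} {N : ℕ}
    (hp : Monotone p) (hN : 0 < N) (hpos : p 0 < p N) {ν : PMF (Fin N)}
    (hν : ∀ i, (ν i).toReal = (p (i + 1) - p i) / (p N - p 0)) (m : Mem)
    (hP : ∀ m', ScratchEq s m m' → ∀ x, (m' s).nv x ≤ N →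
      (P (NExp.var s x)).eval m' = p ((m' s).nv x))
    (h7 : (m s).nv 7 = 0) (h8 : (m s).nv 8 = N) :
    Sim env (descend s P) m (Nat.clog 2 N * 8 + 1) ν
      (fun i m' => ScratchEq s m m' ∧ (m' s).nv 7 = i) := by
  have hN2 : N ≤ 0 + 2 ^ Nat.clog 2 N := by rw [zero_add]; exact Nat.le_pow_clog (by norm_num) N
  have h := Sim.descend_chain (env := env) m hP (Nat.clog 2 N) 0 N hN hN2 le_rfl m
    (ScratchEq.refl s m) h7 h8
  have h' := h.map (R' := fun (i : Fin N) m' => ScratchEq s m m' ∧ (m' s).nv 7 = i)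
    (fun x => (⟨x.1 % N, Nat.mod_lt _ hN⟩ : Fin N)) (by
      rintro x - m' ⟨h1, h2, -, h3, h4⟩
      exact ⟨h1, by simp only [h2, Nat.mod_eq_of_lt (show x.1 < N by omega)]⟩)
  have e : ν = (chain splittable (halve p) (Nat.clog 2 N) (0, N)).map
      (fun x => (⟨x.1 % N, Nat.mod_lt _ hN⟩ : Fin N)) := by
    refine PMF.ext_toReal fun i => ?_
    rw [hν, bisect_law hp hN _ 0 N hN hN2 le_rfl hpos i, if_pos ⟨Nat.zero_le _, i.2⟩]
  rwa [e]

end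

noncomputable section

/-! ### The sample-query data structure -/

/-- Draw a random index below `e`, with probabilities proportional to the increments of `P`, into the
public variable `5`, with the scratch variables in bank `s`. -/
def drawIndex (s : Side) (P : NExp → RExp) (e : NExp) : Cmd :=
  Cmd.seq (Cmd.setNV s 7 (NExp.lit 0)) (Cmd.seq (Cmd.setNV s 8 e)
    (Cmd.seq (descend s P) (Cmd.setNV Side.pub 5 (NExp.var s 7))))

theorem ScratchEq.trans {s : Side} {m m' m'' : Mem} (h : ScratchEq s m m')
    (h' : ScratchEq s m' m'') : ScratchEq s m m'' := by
  refine ⟨?_, fun x hx => (h'.2 x hx).trans (h.2 x hx)⟩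
  have e : m' s = { m s with nv := (m' s).nv } := by
    conv_lhs => rw [h.1]
    simp
  conv_lhs => rw [h'.1, h.1]
  simp only [Mem.upd_same, Mem.upd_upd]

/-- With scratch variables in the hidden bank the only public trace is variable `5`, as the
interface demands; with public ones the same code serves the seeding for uniform draws. -/
theorem Sim.drawIndex {env : SQOp → Cmd} {s : Side} {P : NExp → RExp} {e : NExp} {p : ℕ → ℝ}
    {N : ℕ} (hp : Monotone p) (hN : 0 < N) (hpos : p 0 < p N) {ν : PMF (Fin N)}
    (hν : ∀ i, (ν i).toReal = (p (i + 1) - p i) / (p N - p 0)) (m : Mem)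
    (hP : ∀ m', ScratchEq s m m' → ∀ x, (m' s).nv x ≤ N →
      (P (NExp.var s x)).eval m' = p ((m' s).nv x))
    (he : ∀ m', ScratchEq s m m' → e.eval m' = N) :
    Sim env (drawIndex s P e) m (Nat.clog 2 N * 8 + 7) ν
      (fun i m' => ∃ m'', ScratchEq s m m'' ∧ m' = m''.upd Side.pub ((m'' Side.pub).setNV 5 i)) := by
  refine Sim.le (Sim.det_seq (Q := fun m' => ScratchEq s m m' ∧ (m' s).nv 7 = 0)
    (Det.setNV ?_) ?_) (T₁ := 1 + (Nat.clog 2 N * 8 + 5) + 1) (by omega)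
  · exact ⟨(ScratchEq.refl s m).setNV (by norm_num) _, by simp [Store.setNV, NExp.eval]⟩
  rintro m₁ ⟨h1, h7⟩
  refine Sim.le (Sim.det_seq (Q := fun m' => ScratchEq s m m' ∧ (m' s).nv 7 = 0 ∧ (m' s).nv 8 = N)
    (Det.setNV ?_) ?_) (T₁ := 1 + (Nat.clog 2 N * 8 + 3) + 1) (by omega)
  · exact ⟨h1.setNV (by norm_num) _, by simp [Store.setNV, h7],
      by simp [Store.setNV, he m₁ h1]⟩
  rintro m₂ ⟨h2, h7, h8⟩
  refine Sim.seq_det (Sim.descend hp hN hpos hν m₂ (fun m' hm' x hx => hP m' (h2.trans hm') x hx)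
    h7 h8) (T₂ := 1) ?_
  rintro i - m₃ ⟨h3, h7⟩
  refine Det.setNV ⟨m₃, h2.trans h3, ?_⟩
  simp [NExp.eval, h7]

/-- The sum of the squares of the first `j` coordinates of row `i` relative to row `0`. -/
def rowPrefix (a : ℕ → ℕ → ℝ) (i j : ℕ) : ℝ := ∑ c ∈ Finset.range j, (a i c - a 0 c) ^ 2

/-- The sum of the squared norms of the first `i` rows relative to row `0`. -/
def matPrefix (a : ℕ → ℕ → ℝ) (d i : ℕ) : ℝ := ∑ r ∈ Finset.range i, rowPrefix a r d

/-- The contents of the hidden bank: the data in array `0`, the prefix sums of the squares in each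
row in array `1`, the prefix sums of the squared row norms in array `2`. -/
def SQInv (a : ℕ → ℕ → ℝ) (N d : ℕ) (σ : Store) : Prop :=
  σ.ra 0 = a ∧ (∀ i < N, ∀ j ≤ d, σ.ra 1 i j = rowPrefix a i j) ∧
    ∀ i ≤ N, σ.ra 2 0 i = matPrefix a d i

/-- The invariant sees only the real arrays, so sampling may overwrite hidden integer scratch
variables without spoiling it. -/
theorem SQInv.congr {a : ℕ → ℕ → ℝ} {N d : ℕ} {σ τ : Store} (h : SQInv a N d σ)
    (hr : τ.ra = σ.ra) : SQInv a N d τ := by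
  unfold SQInv at h ⊢
  rwa [hr]

/-- The operations of sample-query access. -/
def sqEnv : SQOp → Cmd
  | SQOp.entry => Cmd.setRV Side.pub 0
      (RExp.sub (RExp.arr Side.hid 0 (NExp.var Side.pub 3) (NExp.var Side.pub 4))
        (RExp.arr Side.hid 0 (NExp.lit 0) (NExp.var Side.pub 4)))
  | SQOp.rowNorm => Cmd.setRV Side.pub 0
      (RExp.sqrt (RExp.arr Side.hid 1 (NExp.var Side.pub 3) (NExp.var Side.pub 1)))
  | SQOp.frobNorm => Cmd.setRV Side.pub 0
      (RExp.sqrt (RExp.arr Side.hid 2 (NExp.lit 0) (NExp.var Side.pub 0)))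
  | SQOp.sampleRow => drawIndex Side.hid (fun e => RExp.arr Side.hid 2 (NExp.lit 0) e)
      (NExp.var Side.pub 0)
  | SQOp.sampleEntry => drawIndex Side.hid (fun e => RExp.arr Side.hid 1 (NExp.var Side.pub 3) e)
      (NExp.var Side.pub 1)

/-- The data matrix as an infinite array. -/
def dataArr {N d : ℕ} (V : Fin N → EuclideanSpace ℝ (Fin d)) (i j : ℕ) : ℝ :=
  if h : i < N ∧ j < d then V ⟨i, h.1⟩ ⟨j, h.2⟩ else 0

section data

variable {N d : ℕ} (V : Fin N → EuclideanSpace ℝ (Fin d))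

theorem dataArr_sub (i : Fin N) (j : Fin d) :
    dataArr V i j - dataArr V 0 j = centered V i j := by
  simp [dataArr, centered, i.pos]

theorem norm_centered_sq (i : Fin N) : ‖centered V i‖ ^ 2 = rowPrefix (dataArr V) i d := by
  rw [EuclideanSpace.norm_sq_eq, rowPrefix, ← Fin.sum_univ_eq_sum_range]
  refine Finset.sum_congr rfl fun j _ => ?_
  rw [dataArr_sub, Real.norm_eq_abs, sq_abs]

theorem sum_norm_centered_sq : ∑ i, ‖centered V i‖ ^ 2 = matPrefix (dataArr V) d N := by
  rw [matPrefix, ← Fin.sum_univ_eq_sum_range]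
  exact Finset.sum_congr rfl fun i _ => norm_centered_sq V i

end data

theorem rowPrefix_succ (a : ℕ → ℕ → ℝ) (i j : ℕ) :
    rowPrefix a i (j + 1) = rowPrefix a i j + (a i j - a 0 j) ^ 2 :=
  Finset.sum_range_succ _ _

theorem rowPrefix_nonneg (a : ℕ → ℕ → ℝ) (i j : ℕ) : 0 ≤ rowPrefix a i j :=
  Finset.sum_nonneg fun _ _ => sq_nonneg _

theorem matPrefix_succ (a : ℕ → ℕ → ℝ) (d i : ℕ) :
    matPrefix a d (i + 1) = matPrefix a d i + rowPrefix a i d :=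
  Finset.sum_range_succ _ _

theorem rowPrefix_monotone (a : ℕ → ℕ → ℝ) (i : ℕ) : Monotone (rowPrefix a i) :=
  monotone_nat_of_le_succ fun j => by
    rw [rowPrefix_succ]; linarith [sq_nonneg (a i j - a 0 j)]

theorem matPrefix_monotone (a : ℕ → ℕ → ℝ) (d : ℕ) : Monotone (matPrefix a d) :=
  monotone_nat_of_le_succ fun i => by
    rw [matPrefix_succ]; linarith [rowPrefix_nonneg a i d]

/-- As log 2 > 1/2, the binary logarithm is at most 2 log n; the summand 1 pays for rounding up. -/
theorem clog_le {n : ℕ} (hn : 1 ≤ n) : (Nat.clog 2 n : ℝ) ≤ 1 + 2 * Real.log n := by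
  rcases hn.eq_or_lt with rfl | h
  · simp
  have h1 : 2 ^ (Nat.clog 2 n).pred < n := Nat.pow_pred_clog_lt_self (by norm_num) h
  have h2 : ((Nat.clog 2 n).pred : ℝ) * Real.log 2 ≤ Real.log n := by
    rw [← Real.log_pow]
    exact Real.log_le_log (by positivity) (by exact_mod_cast h1.le)
  have h3 : (Nat.clog 2 n : ℝ) ≤ (Nat.clog 2 n).pred + 1 := by
    have : Nat.clog 2 n ≤ (Nat.clog 2 n).pred + 1 := by rw [Nat.pred_eq_sub_one]; omega
    exact_mod_cast this
  have h4 := Real.log_two_gt_d9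
  have h5 : (0 : ℝ) ≤ (Nat.clog 2 n).pred := Nat.cast_nonneg _
  nlinarith

theorem PMF.map_apply_of_injective {α β : Type*} (p : PMF α) {f : α → β}
    (hf : Function.Injective f) (x : α) : (p.map f) (f x) = p x := by
  classical
  rw [PMF.map_apply, tsum_eq_single x]
  · simp
  · intro y hy
    rw [if_neg fun h => hy (hf h).symm]

theorem Answers.of_sim {env : SQOp → Cmd} {Inv : Store → Prop} {q : SQOp} {m : Mem} {τ : ℝ}
    {post : PMF Store → Prop} {α : Type} {T : ℕ} {ν : PMF α} {R : α → Mem → Prop}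
    (h : Sim env (env q) m T ν R) (hT : (T : ℝ) + 1 ≤ τ)
    (hI : ∀ x m', R x m' → Inv (m' Side.hid)) (g : α → Store)
    (hg : ∀ x m', R x m' → m' Side.pub = g x) (hpost : post (ν.map g)) :
    Answers env Inv q m τ post := by
  have hc := Sim.call h
  refine ⟨T + 1, by push_cast; exact hT, hc.halts, fun m' hm' => ?_, ?_⟩
  · obtain ⟨x, -, hx⟩ := hc.memLaw_support hm'
    exact hI x m' hx
  · rwa [hc.map_memLaw _ g hg]

theorem Store.setNV_injective (σ : Store) (x : ℕ) : Function.Injective (σ.setNV x) := by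
  intro v w h
  have := congrArg (fun τ : Store => τ.nv x) h
  simpa [Store.setNV] using this

theorem Sim.sampleRow {N d : ℕ} (V : Fin N → EuclideanSpace ℝ (Fin d)) (hA : centered V ≠ 0)
    {ν : PMF (Fin N)} (hν : ∀ i, (ν i).toReal = ‖centered V i‖ ^ 2 / ∑ l, ‖centered V l‖ ^ 2)
    (m : Mem) (hI : SQInv (dataArr V) N d (m Side.hid)) (h0 : (m Side.pub).nv 0 = N) :
    Sim sqEnv (sqEnv SQOp.sampleRow) m (Nat.clog 2 N * 8 + 7) ν
      (fun i m' => m' Side.pub = (m Side.pub).setNV 5 i ∧ (m' Side.hid).ra = (m Side.hid).ra) := by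
  have hpos : 0 < matPrefix (dataArr V) d N := by
    rw [← sum_norm_centered_sq]
    obtain ⟨i, hi⟩ := Function.ne_iff.1 hA
    exact Finset.sum_pos' (fun _ _ => sq_nonneg _) ⟨i, Finset.mem_univ _, pow_pos (norm_pos_iff.2 hi) 2⟩
  have hN : 0 < N := by
    obtain ⟨i, -⟩ := Function.ne_iff.1 hA
    exact i.pos
  have hz : matPrefix (dataArr V) d 0 = 0 := by simp [matPrefix]
  refine Sim.conseq (Sim.drawIndex (p := matPrefix (dataArr V) d) (matPrefix_monotone _ _) hN
    (by rwa [hz]) (fun i => ?_) m ?_ ?_) ?_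
  · rw [hν, hz, sub_zero, sum_norm_centered_sq, norm_centered_sq, matPrefix_succ]
    ring
  · intro m' hm' x hx
    simp only [RExp.eval, NExp.eval]
    rw [hm'.ra, hI.2.2 _ hx]
  · intro m' hm'
    simp only [NExp.eval]
    rw [hm'.nv (by norm_num), h0]
  · rintro i - m' ⟨m'', h1, rfl⟩
    exact ⟨by simp [h1.other], by simp [h1.ra]⟩

theorem Sim.sampleEntry {N d : ℕ} (V : Fin N → EuclideanSpace ℝ (Fin d)) (i : Fin N)
    (hA : centered V i ≠ 0) {ν : PMF (Fin d)}
    (hν : ∀ j, (ν j).toReal = centered V i j ^ 2 / ‖centered V i‖ ^ 2)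
    (m : Mem) (hI : SQInv (dataArr V) N d (m Side.hid)) (h1 : (m Side.pub).nv 1 = d)
    (h3 : (m Side.pub).nv 3 = i) :
    Sim sqEnv (sqEnv SQOp.sampleEntry) m (Nat.clog 2 d * 8 + 7) ν
      (fun j m' => m' Side.pub = (m Side.pub).setNV 5 j ∧ (m' Side.hid).ra = (m Side.hid).ra) := by
  have hpos : 0 < rowPrefix (dataArr V) i d := by
    rw [← norm_centered_sq]
    exact pow_pos (norm_pos_iff.2 hA) 2
  have hd : 0 < d := by
    rcases Nat.eq_zero_or_pos d with rfl | h
    · simp [rowPrefix] at hpos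
    · exact h
  have hz : rowPrefix (dataArr V) i 0 = 0 := by simp [rowPrefix]
  refine Sim.conseq (Sim.drawIndex (p := rowPrefix (dataArr V) i) (rowPrefix_monotone _ _) hd
    (by rwa [hz]) (fun j => ?_) m ?_ ?_) ?_
  · rw [hν, hz, sub_zero, norm_centered_sq, rowPrefix_succ, dataArr_sub]
    ring
  · intro m' hm' x hx
    simp only [RExp.eval, NExp.eval]
    rw [hm'.ra, hm'.nv (by norm_num), h3, hI.2.1 _ i.2 _ hx]
  · intro m' hm'
    simp only [NExp.eval]
    rw [hm'.nv (by norm_num), h1]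
  · rintro j - m' ⟨m'', h1, rfl⟩
    exact ⟨by simp [h1.other], by simp [h1.ra]⟩

/-- A sample takes 8 `Nat.clog 2 n` + 8 steps including the call, hence at most 16 + 16 log(Nd),
well within the factor 30. -/
theorem providesSQ {N d : ℕ} (V : Fin N → EuclideanSpace ℝ (Fin d)) (hN : 1 ≤ N) (hd : 1 ≤ d)
    {C : ℝ} (hC : 30 ≤ C) (D : Store) (hD : SQInv (dataArr V) N d D) :
    ProvidesSQ sqEnv C (centered V) D := by
  have hN' : (1 : ℝ) ≤ N := by exact_mod_cast hN
  have hd' : (1 : ℝ) ≤ d := by exact_mod_cast hd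
  have hl : 0 ≤ Real.log (N * d) := Real.log_nonneg (by nlinarith)
  have h2 : ((1 : ℕ) : ℝ) + 1 ≤ C * (1 + Real.log (N * d)) := by
    push_cast; nlinarith
  have hT : ∀ n : ℕ, 1 ≤ n → (n : ℝ) ≤ N * d →
      ((Nat.clog 2 n * 8 + 7 : ℕ) : ℝ) + 1 ≤ C * (1 + Real.log (N * d)) := by
    intro n hn hn'
    have h3 := clog_le hn
    have h4 : Real.log n ≤ Real.log (N * d) :=
      Real.log_le_log (by exact_mod_cast hn) hn'
    push_cast
    nlinarith
  refine ⟨SQInv (dataArr V) N d, hD, fun m hI h0 h1 => ⟨?_, ?_, ?_, ?_, ?_⟩⟩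
  · intro i j h3 h4
    refine Answers.of_sim (R := fun (_ : Unit) m' => m' = m.upd Side.pub
      ((m Side.pub).setRV 0 (centered V i j))) (Det.setRV ?_) h2 ?_
      (fun _ => (m Side.pub).setRV 0 (centered V i j)) ?_ (PMF.pure_map _ _)
    · simp [RExp.eval, NExp.eval, h3, h4, hI.1, dataArr_sub]
    · rintro - m' rfl; simpa using hI
    · rintro - m' rfl; simp
  · intro i h3
    refine Answers.of_sim (R := fun (_ : Unit) m' => m' = m.upd Side.pub
      ((m Side.pub).setRV 0 ‖centered V i‖)) (Det.setRV ?_) h2 ?_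
      (fun _ => (m Side.pub).setRV 0 ‖centered V i‖) ?_ (PMF.pure_map _ _)
    · simp [RExp.eval, NExp.eval, h3, h1, hI.2.1 i i.2 d le_rfl, ← norm_centered_sq]
    · rintro - m' rfl; simpa using hI
    · rintro - m' rfl; simp
  · have hf : Det sqEnv (sqEnv SQOp.frobNorm) m 1 (fun m' => m' = m.upd Side.pub
        ((m Side.pub).setRV 0 (Real.sqrt (∑ i, ‖centered V i‖ ^ 2)))) := by
      refine Det.setRV ?_
      simp [RExp.eval, NExp.eval, h0, hI.2.2 N le_rfl, sum_norm_centered_sq]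
    refine Answers.of_sim hf (by push_cast; linarith) ?_
      (fun _ => (m Side.pub).setRV 0 (Real.sqrt (∑ i, ‖centered V i‖ ^ 2))) ?_ (PMF.pure_map _ _)
    · rintro - m' rfl; simpa using hI
    · rintro - m' rfl; simp
  · intro hA
    have hs : 0 < ∑ l, ‖centered V l‖ ^ 2 := by
      obtain ⟨i, hi⟩ := Function.ne_iff.1 hA
      exact Finset.sum_pos' (fun _ _ => sq_nonneg _)
        ⟨i, Finset.mem_univ _, pow_pos (norm_pos_iff.2 hi) 2⟩
    refine Answers.of_sim (Sim.sampleRow V hA (weightedPMF_toReal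
      (fun i => ‖centered V i‖ ^ 2 / ∑ l, ‖centered V l‖ ^ 2) (fun i => by positivity)
      (by rw [← Finset.sum_div, div_self hs.ne'])) m hI h0) (hT N hN (by nlinarith)) ?_
      (fun i => (m Side.pub).setNV 5 i) (fun x m' h => h.1) ?_
    · intro x m' h
      exact hI.congr h.2
    · intro i
      exact PMF.map_apply_of_injective _ (f := fun i : Fin N => (m Side.pub).setNV 5 i)
        ((Store.setNV_injective _ _).comp Fin.val_injective) i
  · intro i h3 hA
    have hs : 0 < ‖centered V i‖ ^ 2 := pow_pos (norm_pos_iff.2 hA) 2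
    refine Answers.of_sim (Sim.sampleEntry V i hA (weightedPMF_toReal
      (fun j => centered V i j ^ 2 / ‖centered V i‖ ^ 2) (fun i => by positivity)
      (by
        rw [← Finset.sum_div, div_eq_one_iff_eq hs.ne', EuclideanSpace.norm_sq_eq]
        simp)) m hI h1 h3) (hT d hd (by nlinarith)) ?_
      (fun j => (m Side.pub).setNV 5 j) (fun x m' h => h.1) ?_
    · intro x m' h
      exact hI.congr h.2
    · intro j
      exact PMF.map_apply_of_injective _ (f := fun j : Fin d => (m Side.pub).setNV 5 j)
        ((Store.setNV_injective _ _).comp Fin.val_injective) j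

/-! ### Setting up the prefix sums -/

/-- Fill the arrays of prefix sums. -/
def setupCmd : Cmd :=
  Cmd.loop (Test.nlt (NExp.var Side.hid 1) (NExp.var Side.pub 0))
    (Cmd.seq (Cmd.setNV Side.hid 2 (NExp.lit 0))
    (Cmd.seq (Cmd.loop (Test.nlt (NExp.var Side.hid 2) (NExp.var Side.pub 1))
      (Cmd.seq
        (Cmd.setRV Side.hid 0
          (RExp.sub (RExp.arr Side.hid 0 (NExp.var Side.hid 1) (NExp.var Side.hid 2))
            (RExp.arr Side.hid 0 (NExp.lit 0) (NExp.var Side.hid 2))))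
      (Cmd.seq
        (Cmd.setRA Side.hid 1 (NExp.var Side.hid 1) (NExp.add (NExp.var Side.hid 2) (NExp.lit 1))
          (RExp.add (RExp.arr Side.hid 1 (NExp.var Side.hid 1) (NExp.var Side.hid 2))
            (RExp.mul (RExp.var Side.hid 0) (RExp.var Side.hid 0))))
        (Cmd.setNV Side.hid 2 (NExp.add (NExp.var Side.hid 2) (NExp.lit 1))))))
    (Cmd.seq
      (Cmd.setRA Side.hid 2 (NExp.lit 0) (NExp.add (NExp.var Side.hid 1) (NExp.lit 1))
        (RExp.add (RExp.arr Side.hid 2 (NExp.lit 0) (NExp.var Side.hid 1))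
          (RExp.arr Side.hid 1 (NExp.var Side.hid 1) (NExp.var Side.pub 1))))
      (Cmd.setNV Side.hid 1 (NExp.add (NExp.var Side.hid 1) (NExp.lit 1))))))

/-- The state of `setupCmd` when the first `i` rows are done. -/
def SetupInv (P : Store) (a : ℕ → ℕ → ℝ) (d i : ℕ) (m : Mem) : Prop :=
  m Side.pub = P ∧ (m Side.hid).nv 1 = i ∧ (m Side.hid).ra 0 = a ∧
    (∀ r < i, ∀ j ≤ d, (m Side.hid).ra 1 r j = rowPrefix a r j) ∧
    (∀ r, i ≤ r → (m Side.hid).ra 1 r 0 = 0) ∧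
    (∀ r ≤ i, (m Side.hid).ra 2 0 r = matPrefix a d r)

/-- The state of the inner loop of `setupCmd` when the first `j` columns of row `i` are done. -/
def SetupRowInv (P : Store) (a : ℕ → ℕ → ℝ) (d i j : ℕ) (m : Mem) : Prop :=
  SetupInv P a d i m ∧ (m Side.hid).nv 2 = j ∧
    ∀ c ≤ j, (m Side.hid).ra 1 i c = rowPrefix a i c

theorem Det.setupCmd {env : SQOp → Cmd} {N d : ℕ} (P : Store) (a : ℕ → ℕ → ℝ) (hN : P.nv 0 = N)
    (hd : P.nv 1 = d) (m : Mem) (hm : SetupInv P a d 0 m) :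
    Det env setupCmd m (N * (d * 7 + 9) + 1) (SetupInv P a d N) := by
  refine Det.le (Det.loop (T := d * 7 + 7) (SetupInv P a d) N ?_ ?_ 0 (Nat.zero_le _) hm)
    (by simp)
  · rintro i m - ⟨h1, h2, -⟩
    simp [Test.Holds, NExp.eval, h1, h2, hN]
  rintro i m hi hm
  refine Det.le (Det.seq (T₁ := 1) (T₂ := d * 7 + 5) (Q := SetupRowInv P a d i 0)
    (Det.setNV ?_) ?_) (by omega)
  · obtain ⟨h1, h2, h3, h4, h5, h6⟩ := hm
    refine ⟨⟨?_, ?_, ?_, ?_, ?_, ?_⟩, ?_, ?_⟩ <;> simp [Store.setNV, NExp.eval, h1, h2, h3]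
    · exact h4
    · exact h5
    · exact h6
    -- The empty prefix sum of a row is never written: it is an initial zero, which the invariant
    -- records for the rows not yet treated.
    · simpa [rowPrefix] using h5 i le_rfl
  intro m hm
  refine Det.le (Det.seq (T₁ := d * 7 + 1) (T₂ := 3) (Q := SetupRowInv P a d i d) ?_ ?_) (by omega)
  · refine Det.le (Det.loop (T := 5) (SetupRowInv P a d i) d ?_ ?_ 0 (Nat.zero_le _) hm)
      (by simp)
    · rintro j m - ⟨⟨h1, -⟩, h2, -⟩
      simp [Test.Holds, NExp.eval, h1, h2, hd]
    rintro j m hj hm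
    refine Det.seq (T₁ := 1) (T₂ := 3) (Q := fun m' => SetupRowInv P a d i j m' ∧
      (m' Side.hid).rv 0 = a i j - a 0 j) (Det.setRV ?_) ?_
    · refine ⟨by simpa [SetupRowInv, SetupInv, Store.setRV] using hm, ?_⟩
      obtain ⟨⟨h1, h2, h3, h4, h5, h6⟩, h7, h8⟩ := hm
      simp [Store.setRV, RExp.eval, NExp.eval, h2, h7, h3]
    rintro m ⟨⟨⟨h1, h2, h3, h4, h5, h6⟩, h7, h8⟩, h9⟩
    refine Det.seq (T₁ := 1) (T₂ := 1) (Q := fun m' => SetupInv P a d i m' ∧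
      (m' Side.hid).nv 2 = j ∧ ∀ c ≤ j + 1, (m' Side.hid).ra 1 i c = rowPrefix a i c)
      (Det.setRA ?_) ?_
    · refine ⟨⟨?_, ?_, ?_, ?_, ?_, ?_⟩, ?_, ?_⟩ <;>
        simp [Store.setRA, RExp.eval, NExp.eval, h1, h2, h3, h7, h9]
      · intro r hr c hc
        simp [hr.ne, h4 r hr c hc]
      · intro r hr
        rcases eq_or_ne r i with rfl | hne
        · simp [h5 r hr]
        · simp [hne, h5 r hr]
      · exact h6
      · intro c hc
        rcases eq_or_ne c (j + 1) with rfl | hne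
        · rw [Function.update_self, h8 j le_rfl, rowPrefix_succ]; ring
        · rw [Function.update_of_ne hne, h8 c (by omega)]
    rintro m ⟨⟨h1, h2, h3, h4, h5, h6⟩, h7, h8⟩
    refine Det.setNV ⟨⟨?_, ?_, ?_, ?_, ?_, ?_⟩, ?_, ?_⟩ <;>
      simp [Store.setNV, NExp.eval, h1, h2, h3, h7]
    · exact h4
    · exact h5
    · exact h6
    · exact h8
  rintro m ⟨⟨h1, h2, h3, h4, h5, h6⟩, h7, h8⟩
  refine Det.seq (T₁ := 1) (T₂ := 1) (Q := fun m' => m' Side.pub = P ∧ (m' Side.hid).nv 1 = i ∧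
    (m' Side.hid).ra 0 = a ∧ (m' Side.hid).ra 1 = (m Side.hid).ra 1 ∧
    ∀ r ≤ i + 1, (m' Side.hid).ra 2 0 r = matPrefix a d r) (Det.setRA ?_) ?_
  · refine ⟨?_, ?_, ?_, ?_, ?_⟩ <;>
        simp [Store.setRA, RExp.eval, NExp.eval, h1, h2, h3, hd]
    intro r hr
    rcases eq_or_ne r (i + 1) with rfl | hne
    · rw [Function.update_self, h6 i le_rfl, h8 d le_rfl, matPrefix_succ]
    · rw [Function.update_of_ne hne, h6 r (by omega)]
  rintro m' ⟨g1, g2, g3, g4, g5⟩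
  refine Det.setNV ⟨?_, ?_, ?_, ?_, ?_, ?_⟩ <;>
    simp [Store.setNV, NExp.eval, g1, g2, g3, g4]
  · intro r hr c hc
    rcases eq_or_ne r i with rfl | hne
    · exact h8 c hc
    · exact h4 r (by omega) c hc
  · exact fun r hr => h5 r (by omega)
  · exact g5

theorem Det.setup_input {env : SQOp → Cmd} {N d : ℕ} (V : Fin N → EuclideanSpace ℝ (Fin d)) (k : ℕ) :
    Det env _root_.setupCmd (inputMem V k) (N * (d * 7 + 9) + 1)
      (fun m' => m' Side.pub = inputMem V k Side.pub ∧ SQInv (dataArr V) N d (m' Side.hid)) := by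
  refine Det.conseq (Det.setupCmd (inputMem V k Side.pub) (dataArr V) rfl rfl _
    ⟨rfl, rfl, ?_, ?_, ?_, ?_⟩) ?_
  · funext i j
    simp [inputMem, dataArr]
  · intro r hr; omega
  · intro r _; simp [inputMem]
  · intro r hr
    obtain rfl : r = 0 := by omega
    simp [inputMem, matPrefix]
  · rintro m' ⟨h1, -, h3, h4, -, h6⟩
    exact ⟨h1, h3, h4, h6⟩

end

noncomputable section

/-! ### The approximation guarantee of the exact seeding -/

section kmeanspp

variable {N d k : ℕ} (V : Fin N → EuclideanSpace ℝ (Fin d))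

/-- The squared distance of a data point from the nearest chosen data point. -/
def dsq (S : Finset (Fin N)) (i : Fin N) : ℝ :=
  Metric.infDist (V i) (V '' (S : Set (Fin N))) ^ 2

/-- The cost of a set of chosen data points. -/
def potential (S : Finset (Fin N)) : ℝ := ∑ i, dsq V S i

theorem dsq_nonneg (S : Finset (Fin N)) (i : Fin N) : 0 ≤ dsq V S i := sq_nonneg _

theorem potential_nonneg (S : Finset (Fin N)) : 0 ≤ potential V S :=
  Finset.sum_nonneg fun i _ => dsq_nonneg V S i

theorem exists_dsq_eq {S : Finset (Fin N)} (hS : S.Nonempty) (i : Fin N) :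
    ∃ j ∈ S, dsq V S i = dist (V i) (V j) ^ 2 := by
  have hf : (V '' (S : Set (Fin N))).Finite := S.finite_toSet.image V
  obtain ⟨y, ⟨j, hj, rfl⟩, h⟩ := hf.isCompact.exists_infDist_eq_dist
    ((Finset.coe_nonempty.2 hS).image V) (V i)
  exact ⟨j, hj, by rw [dsq, h]⟩

theorem dsq_le_dist {S : Finset (Fin N)} {j : Fin N} (hj : j ∈ S) (i : Fin N) :
    dsq V S i ≤ dist (V i) (V j) ^ 2 :=
  pow_le_pow_left₀ Metric.infDist_nonneg
    (Metric.infDist_le_dist_of_mem (Set.mem_image_of_mem V (Finset.mem_coe.2 hj))) 2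

theorem dsq_of_mem {S : Finset (Fin N)} {i : Fin N} (hi : i ∈ S) : dsq V S i = 0 := by
  have := dsq_le_dist V hi i
  rw [dist_self] at this
  exact le_antisymm (by simpa using this) (dsq_nonneg V S i)

/-- `S` must be nonempty because `infDist` to the empty set is `0` by convention. -/
theorem dsq_anti {S S' : Finset (Fin N)} (hS : S.Nonempty) (h : S ⊆ S') (i : Fin N) :
    dsq V S' i ≤ dsq V S i := by
  obtain ⟨j, hj, e⟩ := exists_dsq_eq V hS i
  rw [e]
  exact dsq_le_dist V (h hj) i

theorem dsq_insert {S : Finset (Fin N)} (hS : S.Nonempty) (j i : Fin N) :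
    dsq V (insert j S) i = min (dist (V i) (V j) ^ 2) (dsq V S i) := by
  refine le_antisymm (le_min (dsq_le_dist V (Finset.mem_insert_self j S) i)
    (dsq_anti V hS (Finset.subset_insert j S) i)) ?_
  obtain ⟨x, hx, e⟩ := exists_dsq_eq V (Finset.insert_nonempty j S) i
  rw [e]
  rcases Finset.mem_insert.1 hx with rfl | hx
  · exact min_le_left _ _
  · exact (min_le_right _ _).trans (dsq_le_dist V hx i)

theorem dsq_singleton (j i : Fin N) : dsq V {j} i = dist (V i) (V j) ^ 2 := by
  obtain ⟨x, hx, e⟩ := exists_dsq_eq V (Finset.singleton_nonempty j) i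
  rw [e, Finset.mem_singleton.1 hx]

theorem dsq_pos {V : Fin N → EuclideanSpace ℝ (Fin d)} (hV : Function.Injective V)
    {S : Finset (Fin N)} (hS : S.Nonempty) {i : Fin N} (hi : i ∉ S) :
    0 < dsq V S i := by
  obtain ⟨j, hj, e⟩ := exists_dsq_eq V hS i
  rw [e]
  have : V i ≠ V j := fun h => hi (hV h ▸ hj)
  have := dist_pos.2 this
  positivity

theorem dist_sq_le {E : Type*} [PseudoMetricSpace E] (x y z : E) :
    dist x z ^ 2 ≤ 2 * dist x y ^ 2 + 2 * dist y z ^ 2 := by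
  have h := dist_triangle x y z
  have h0 : 0 ≤ dist x z := dist_nonneg
  nlinarith [sq_nonneg (dist x y - dist y z), pow_le_pow_left₀ h0 h 2]

theorem dsq_le_add (S : Finset (Fin N)) (i x : Fin N) :
    dsq V S i ≤ 2 * dsq V S x + 2 * dist (V i) (V x) ^ 2 := by
  have h := Metric.infDist_le_infDist_add_dist (s := V '' (S : Set (Fin N))) (x := V i) (y := V x)
  have h0 : 0 ≤ Metric.infDist (V i) (V '' (S : Set (Fin N))) := Metric.infDist_nonneg
  unfold dsq
  nlinarith [sq_nonneg (Metric.infDist (V x) (V '' (S : Set (Fin N))) - dist (V i) (V x)),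
    pow_le_pow_left₀ h0 h 2]

theorem dsqProb_of_nonempty {S : Finset (Fin N)} (hS : S.Nonempty) (i : Fin N) :
    dsqProb V S i = dsq V S i / potential V S := by
  rw [dsqProb, if_neg hS.ne_empty]
  rfl

theorem dsqProb_nonneg (S : Finset (Fin N)) (i : Fin N) : 0 ≤ dsqProb V S i := by
  rcases S.eq_empty_or_nonempty with rfl | h
  · rw [dsqProb, if_pos rfl]; positivity
  · rw [dsqProb_of_nonempty V h]
    exact div_nonneg (dsq_nonneg V S i) (potential_nonneg V S)

theorem potential_pos {V : Fin N → EuclideanSpace ℝ (Fin d)} (hV : Function.Injective V)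
    {S : Finset (Fin N)} (hS : S.Nonempty) (hc : S.card < N) : 0 < potential V S := by
  obtain ⟨i, hi⟩ : ∃ i, i ∉ S := by
    by_contra! h
    have : S = Finset.univ := Finset.eq_univ_iff_forall.2 h
    rw [this, Finset.card_univ, Fintype.card_fin] at hc
    exact lt_irrefl _ hc
  exact Finset.sum_pos' (fun j _ => dsq_nonneg V S j) ⟨i, Finset.mem_univ i, dsq_pos hV hS hi⟩

theorem sum_dsqProb {V : Fin N → EuclideanSpace ℝ (Fin d)} (hV : Function.Injective V)
    {S : Finset (Fin N)} (hc : S.card < N) : ∑ i, dsqProb V S i = 1 := by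
  rcases S.eq_empty_or_nonempty with rfl | h
  · have : (N : ℝ) ≠ 0 := by
      rw [Finset.card_empty] at hc
      exact_mod_cast hc.ne'
    simp [dsqProb, this]
  · simp_rw [dsqProb_of_nonempty V h]
    rw [← Finset.sum_div]
    exact div_self (potential_pos hV h hc).ne'

/-- The probability that `D²`-sampling, started with the centers `S`, picks the points of a list one
after the other. -/
def seqProb : Finset (Fin N) → List (Fin N) → ℝ
  | _, [] => 1
  | S, i :: w => dsqProb V S i * seqProb (insert i S) w

theorem seqProb_nonneg (S : Finset (Fin N)) (w : List (Fin N)) : 0 ≤ seqProb V S w := by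
  induction w generalizing S with
  | nil => exact zero_le_one
  | cons i w ih => exact mul_nonneg (dsqProb_nonneg V S i) (ih _)

/-- Peeling off the first pick moves it into the set of given centers, so the induction needs an
arbitrary `S` although only `∅` is wanted. -/
theorem prod_dsqProb (S : Finset (Fin N)) (s : Fin k → Fin N) :
    ∏ t : Fin k, dsqProb V (S ∪ (Finset.univ.filter (fun r => r < t)).image s) (s t) =
      seqProb V S (List.ofFn s) := by
  induction k generalizing S with
  | zero => simp [seqProb]
  | succ k ih =>
    rw [List.ofFn_succ, seqProb, Fin.prod_univ_succ, ← ih (insert (s 0) S) (fun i => s i.succ)]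
    congr 1
    · simp
    · refine Finset.prod_congr rfl fun t _ => ?_
      congr 1
      ext x
      simp only [Finset.mem_union, Finset.mem_image, Finset.mem_filter, Finset.mem_univ, true_and,
        Finset.mem_insert]
      constructor
      · rintro (h | ⟨r, hr, rfl⟩)
        · exact Or.inl (Or.inr h)
        · induction r using Fin.cases with
          | zero => exact Or.inl (Or.inl rfl)
          | succ r => exact Or.inr ⟨r, Fin.succ_lt_succ_iff.1 hr, rfl⟩
      · rintro ((rfl | h) | ⟨r, hr, rfl⟩)
        · exact Or.inr ⟨0, Fin.succ_pos t, rfl⟩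
        · exact Or.inl h
        · exact Or.inr ⟨r.succ, Fin.succ_lt_succ_iff.2 hr, rfl⟩

theorem seedingProb_eq (s : Fin k → Fin N) : seedingProb V s = seqProb V ∅ (List.ofFn s) := by
  rw [← prod_dsqProb, seedingProb]
  simp

/-- The expected cost after `r` more rounds of `D²`-sampling. -/
def expCost : ℕ → Finset (Fin N) → ℝ
  | 0, S => potential V S
  | r + 1, S => ∑ i, dsqProb V S i * expCost r (insert i S)

theorem sum_fin_succ_fun {A : Type*} [Fintype A] (r : ℕ) (F : (Fin (r + 1) → A) → ℝ) :
    ∑ s, F s = ∑ i, ∑ s : Fin r → A, F (Fin.cons i s) := by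
  rw [← Fintype.sum_prod_type' (f := fun i s => F (Fin.cons i s))]
  exact (Fintype.sum_equiv (Fin.consEquiv fun _ => A) _ _ fun _ => rfl).symm

theorem sum_seqProb_mul_potential (r : ℕ) (S : Finset (Fin N)) :
    ∑ s : Fin r → Fin N, seqProb V S (List.ofFn s) * potential V (S ∪ Finset.univ.image s) =
      expCost V r S := by
  induction r generalizing S with
  | zero => simp [seqProb, expCost]
  | succ r ih =>
    rw [sum_fin_succ_fun, expCost]
    refine Finset.sum_congr rfl fun i _ => ?_
    rw [← ih, Finset.mul_sum]
    refine Finset.sum_congr rfl fun s _ => ?_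
    have e : S ∪ Finset.univ.image (Fin.cons i s : Fin (r + 1) → Fin N) =
        insert i S ∪ Finset.univ.image s := by
      ext x
      simp [Fin.exists_fin_succ]
      tauto
    rw [e, List.ofFn_succ]
    simp only [Fin.cons_zero, Fin.cons_succ, seqProb]
    ring

theorem sum_seqProb {V : Fin N → EuclideanSpace ℝ (Fin d)} (hV : Function.Injective V) (r : ℕ)
    (S : Finset (Fin N)) (h : S.card + r ≤ N) :
    ∑ s : Fin r → Fin N, seqProb V S (List.ofFn s) = 1 := by
  induction r generalizing S with
  | zero => simp [seqProb]
  | succ r ih =>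
    rw [sum_fin_succ_fun, ← sum_dsqProb hV (S := S) (by omega)]
    refine Finset.sum_congr rfl fun i _ => ?_
    rw [← mul_one (dsqProb V S i), ← ih (insert i S) (by have := Finset.card_insert_le i S; omega),
      Finset.mul_sum]
    refine Finset.sum_congr rfl fun s _ => ?_
    rw [List.ofFn_succ]
    simp only [Fin.cons_zero, Fin.cons_succ, seqProb]

/-- `D²`-sampling restricted to a cluster is competitive with any center of the cluster. -/
theorem sum_dsq_mul_le {S : Finset (Fin N)} (hS : S.Nonempty) (A : Finset (Fin N))
    (c : EuclideanSpace ℝ (Fin d)) :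
    ∑ i ∈ A, dsq V S i * ∑ y ∈ A, dsq V (insert i S) y ≤
      16 * (∑ y ∈ A, dist (V y) c ^ 2) * ∑ i ∈ A, dsq V S i := by
  rcases A.eq_empty_or_nonempty with rfl | hA
  · simp
  set n : ℝ := (A.card : ℝ) with hn
  have hn0 : 0 < n := by rw [hn]; exact_mod_cast hA.card_pos
  set O := ∑ y ∈ A, dist (V y) c ^ 2 with hO
  set D := ∑ i ∈ A, dsq V S i with hD
  have hD0 : 0 ≤ D := Finset.sum_nonneg fun i _ => dsq_nonneg V S i
  set P : Fin N → ℝ := fun i => ∑ y ∈ A, dist (V i) (V y) ^ 2 with hP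
  -- The doubled triangle inequality `dsq_le_add`, summed over `x ∈ A`.
  have h1 : ∀ i, n * dsq V S i ≤ 2 * D + 2 * P i := by
    intro i
    have : ∑ x ∈ A, dsq V S i ≤ ∑ x ∈ A, (2 * dsq V S x + 2 * dist (V i) (V x) ^ 2) :=
      Finset.sum_le_sum fun x _ => dsq_le_add V S i x
    rwa [Finset.sum_const, nsmul_eq_mul, Finset.sum_add_distrib, ← Finset.mul_sum,
      ← Finset.mul_sum] at this
  have h2 : ∀ i, ∑ y ∈ A, dsq V (insert i S) y ≤ D := fun i =>
    Finset.sum_le_sum fun y _ => dsq_anti V hS (Finset.subset_insert i S) y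
  have h3 : ∀ i, ∑ y ∈ A, dsq V (insert i S) y ≤ P i := fun i =>
    Finset.sum_le_sum fun y _ => by
      rw [dist_comm]; exact dsq_le_dist V (Finset.mem_insert_self i S) y
  have h4 : ∀ i, 0 ≤ ∑ y ∈ A, dsq V (insert i S) y := fun i =>
    Finset.sum_nonneg fun y _ => dsq_nonneg V _ y
  -- Detouring through `c` replaces the centroid identity. This doubles the constant, 16 instead of
  -- 8, but `c` may then be any point.
  have h5 : ∑ i ∈ A, P i ≤ 4 * n * O := by
    have : ∀ i ∈ A, P i ≤ 2 * n * dist (V i) c ^ 2 + 2 * O := by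
      intro i _
      have : P i ≤ ∑ y ∈ A, (2 * dist (V i) c ^ 2 + 2 * dist (V y) c ^ 2) :=
        Finset.sum_le_sum fun y _ => by
          have := dist_sq_le (V i) c (V y)
          rwa [dist_comm c (V y)] at this
      refine this.trans (le_of_eq ?_)
      rw [Finset.sum_add_distrib, Finset.sum_const, nsmul_eq_mul, ← Finset.mul_sum]
      ring
    refine (Finset.sum_le_sum this).trans (le_of_eq ?_)
    rw [Finset.sum_add_distrib, ← Finset.mul_sum, Finset.sum_const, nsmul_eq_mul]
    ring
  -- Of the two terms from `h1`, the one with `D` is multiplied by the bound `P i` for the new cost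
  -- and the one with `P i` by the bound `D`: twice 2 D P i.
  have h6 : ∀ i ∈ A, n * (dsq V S i * ∑ y ∈ A, dsq V (insert i S) y) ≤ 4 * D * P i := by
    intro i _
    have a1 := mul_le_mul_of_nonneg_right (h1 i) (h4 i)
    have a2 := mul_le_mul_of_nonneg_left (h3 i) hD0
    have hPi : 0 ≤ P i := (h4 i).trans (h3 i)
    have a3 := mul_le_mul_of_nonneg_left (h2 i) hPi
    nlinarith
  have h7 : n * ∑ i ∈ A, dsq V S i * ∑ y ∈ A, dsq V (insert i S) y ≤ n * (16 * O * D) := by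
    rw [Finset.mul_sum]
    refine (Finset.sum_le_sum h6).trans ?_
    rw [← Finset.mul_sum]
    nlinarith [mul_le_mul_of_nonneg_left h5 hD0]
  exact le_of_mul_le_mul_left h7 hn0

/-! ### Covered and uncovered clusters -/

section clusters

variable (a : Fin N → Fin k) (c : Fin k → EuclideanSpace ℝ (Fin d))

/-- The clusters without a chosen point. -/
def uncovered (S : Finset (Fin N)) : Finset (Fin k) := Finset.univ.filter fun j => j ∉ S.image a

/-- The points of a cluster. -/
def cluster (j : Fin k) : Finset (Fin N) := Finset.univ.filter fun i => a i = j

/-- The cost of a cluster with respect to the chosen points. -/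
def clusterCost (S : Finset (Fin N)) (j : Fin k) : ℝ := ∑ i ∈ cluster a j, dsq V S i

/-- The cost of a cluster with respect to its own center. -/
def centerCost (j : Fin k) : ℝ := ∑ i ∈ cluster a j, dist (V i) (c j) ^ 2

theorem sum_cluster (F : Fin N → ℝ) (J : Finset (Fin k)) :
    ∑ j ∈ J, ∑ i ∈ cluster a j, F i = ∑ i, if a i ∈ J then F i else 0 := by
  rw [← Finset.sum_filter, ← Finset.sum_fiberwise_of_maps_to (s := Finset.univ.filter (a · ∈ J))
    (t := J) (g := a) (fun i hi => by simpa using hi)]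
  refine Finset.sum_congr rfl fun j hj => ?_
  refine Finset.sum_congr ?_ fun _ _ => rfl
  ext i
  simp only [cluster, Finset.mem_filter, Finset.mem_univ, true_and]
  exact ⟨fun h => ⟨h ▸ hj, h⟩, fun h => h.2⟩

theorem sum_clusters (F : Fin N → ℝ) : ∑ j, ∑ i ∈ cluster a j, F i = ∑ i, F i := by
  rw [sum_cluster]; simp

theorem clusterCost_nonneg (S : Finset (Fin N)) (j : Fin k) : 0 ≤ clusterCost V a S j :=
  Finset.sum_nonneg fun i _ => dsq_nonneg V S i

theorem centerCost_nonneg (j : Fin k) : 0 ≤ centerCost V a c j :=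
  Finset.sum_nonneg fun _ _ => sq_nonneg _

/-- The cost of the covered clusters plus a multiple of the own cost of the uncovered ones. -/
def settledCost (S : Finset (Fin N)) : ℝ :=
  (∑ j ∈ (uncovered a S)ᶜ, clusterCost V a S j) + 16 * ∑ j ∈ uncovered a S, centerCost V a c j

/-- The cost of the uncovered clusters. -/
def uncoveredCost (S : Finset (Fin N)) : ℝ := ∑ j ∈ uncovered a S, clusterCost V a S j

theorem settledCost_nonneg (S : Finset (Fin N)) : 0 ≤ settledCost V a c S :=
  add_nonneg (Finset.sum_nonneg fun j _ => clusterCost_nonneg V a S j)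
    (mul_nonneg (by norm_num) (Finset.sum_nonneg fun j _ => centerCost_nonneg V a c j))

theorem uncoveredCost_nonneg (S : Finset (Fin N)) : 0 ≤ uncoveredCost V a S :=
  Finset.sum_nonneg fun j _ => clusterCost_nonneg V a S j

theorem clusterCost_insert_le {S : Finset (Fin N)} (hS : S.Nonempty) (i : Fin N) (j : Fin k) :
    clusterCost V a (insert i S) j ≤ clusterCost V a S j :=
  Finset.sum_le_sum fun y _ => dsq_anti V hS (Finset.subset_insert i S) y

theorem uncovered_insert (S : Finset (Fin N)) (i : Fin N) :
    uncovered a (insert i S) = (uncovered a S).erase (a i) := by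
  ext j
  simp only [uncovered, Finset.mem_filter, Finset.mem_univ, true_and, Finset.image_insert,
    Finset.mem_insert, Finset.mem_erase]
  tauto

theorem potential_eq (S : Finset (Fin N)) :
    potential V S = (∑ j ∈ (uncovered a S)ᶜ, clusterCost V a S j) + uncoveredCost V a S := by
  rw [uncoveredCost, Finset.sum_compl_add_sum, potential]
  exact (sum_clusters a _).symm

/-- The arithmetic of one round: `H` and `U` are the costs of the covered and the `u` uncovered
clusters, `Q` is the sum of the squared costs of the latter. A pick in a covered cluster wastes a
round and raises the uncovered fraction by at most 1/u ≤ 1/(r + 1), which the new harmonic term pays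
for. A pick in an uncovered cluster removes its cost from `U`, on average enough by Cauchy–Schwarz,
which enters as `hQ`. -/
theorem card_fraction_le (u r : ℕ) {H U G Q : ℝ} (hH : 0 ≤ H) (hU : 0 ≤ U) (hG : H ≤ G)
    (hu : u = 0 → U = 0) (hQ : U ^ 2 ≤ u * Q) :
    H * ((((u - r : ℕ) : ℝ) / u) * U) + ((u - 1 - r : ℕ) : ℝ) / ((u - 1 : ℕ) : ℝ) * (U ^ 2 - Q) ≤
      (H + U) * (G / (r + 1) + ((u - (r + 1) : ℕ) : ℝ) / u * U) := by
  have hG0 : 0 ≤ G := hH.trans hG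
  have hr : (0 : ℝ) < (r : ℝ) + 1 := by positivity
  rcases Nat.eq_zero_or_pos u with rfl | hupos
  · have := hu rfl
    subst this
    simp at hQ ⊢
    positivity
  have hu0 : (0 : ℝ) < u := by exact_mod_cast hupos
  set w : ℝ := ((u - (r + 1) : ℕ) : ℝ) with hw
  have hw0 : 0 ≤ w := Nat.cast_nonneg _
  have e1 : ((u - 1 - r : ℕ) : ℝ) = w := by rw [hw]; congr 1; omega
  rw [e1]
  -- Cauchy–Schwarz as (U² - Q)/(u - 1) ≤ U²/u. For u = 1 the left side is a division by zero, hence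
  -- 0.
  have h2 : w / ((u - 1 : ℕ) : ℝ) * (U ^ 2 - Q) ≤ w / u * U ^ 2 := by
    rcases Nat.lt_or_ge 1 u with h | h
    · have hc : ((u - 1 : ℕ) : ℝ) = u - 1 := by push_cast [hupos]; ring
      have h1 : (0 : ℝ) < (u : ℝ) - 1 := by
        have : (1 : ℝ) < u := by exact_mod_cast h
        linarith
      rw [hc, div_mul_eq_mul_div, div_mul_eq_mul_div, div_le_div_iff₀ h1 hu0]
      nlinarith [mul_le_mul_of_nonneg_left hQ hw0]
    · have : u - 1 = 0 := by omega
      rw [this]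
      simp
      positivity
  -- The wasted round, paid by G/(r + 1). If u ≤ r the truncated difference makes the left side
  -- vanish.
  have h3 : H * ((((u - r : ℕ) : ℝ) / u) * U) ≤ H * (w / u * U) + (H + U) * (G / (r + 1)) := by
    rcases Nat.lt_or_ge r u with h | h
    · have : ((u - r : ℕ) : ℝ) = w + 1 := by
        rw [hw]
        have : u - r = (u - (r + 1)) + 1 := by omega
        rw [this]; push_cast; ring
      rw [this, add_div, add_mul, mul_add]
      have hru : (r : ℝ) + 1 ≤ u := by exact_mod_cast h
      have h4 : 1 / (u : ℝ) ≤ 1 / (r + 1) := one_div_le_one_div_of_le hr hru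
      have h5 : H * (1 / (u : ℝ) * U) ≤ (H + U) * (G / (r + 1)) := by
        calc H * (1 / (u : ℝ) * U) ≤ H * (1 / (r + 1) * U) := by gcongr
          _ ≤ G * (1 / (r + 1) * (H + U)) := by
            gcongr
            linarith
          _ = _ := by ring
      linarith
    · have : u - r = 0 := by omega
      rw [this]
      simp
      positivity
  nlinarith

/-- After r more picks at least u - r of the u uncovered clusters are still uncovered, whence the
fraction. An uncovered cluster enters `settledCost` with 16 times its center cost in advance; when
it is hit, its actual cost is no larger on average, so the settled part grows only by the harmonic
factor paying for wasted rounds. -/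
theorem expCost_le (r : ℕ) {S : Finset (Fin N)} (hS : S.Nonempty) :
    expCost V r S ≤ settledCost V a c S * (1 + ∑ i ∈ Finset.range r, 1 / ((i : ℝ) + 1)) +
      (((uncovered a S).card - r : ℕ) : ℝ) / ((uncovered a S).card : ℝ) * uncoveredCost V a S := by
  induction r generalizing S with
  | zero =>
    rw [expCost, potential_eq V a]
    have h1 : (∑ j ∈ (uncovered a S)ᶜ, clusterCost V a S j) ≤ settledCost V a c S :=
      le_add_of_nonneg_right (mul_nonneg (by norm_num)
        (Finset.sum_nonneg fun j _ => centerCost_nonneg V a c j))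
    rcases Nat.eq_zero_or_pos (uncovered a S).card with h | h
    · have : uncoveredCost V a S = 0 := by
        rw [uncoveredCost, Finset.card_eq_zero.1 h, Finset.sum_empty]
      rw [this]; simp; exact h1
    · have : ((uncovered a S).card : ℝ) ≠ 0 := by exact_mod_cast h.ne'
      simp [this]; exact h1
  | succ r ih =>
    set u := (uncovered a S).card with hu
    set U := uncoveredCost V a S with hU
    set G := settledCost V a c S with hG
    set h := ∑ i ∈ Finset.range r, 1 / ((i : ℝ) + 1) with hh
    set H := ∑ j ∈ (uncovered a S)ᶜ, clusterCost V a S j with hH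
    have hh0 : 0 ≤ h := Finset.sum_nonneg fun i _ => by positivity
    have hU0 : 0 ≤ U := uncoveredCost_nonneg V a S
    have hG0 : 0 ≤ G := settledCost_nonneg V a c S
    have hH0 : 0 ≤ H := Finset.sum_nonneg fun j _ => clusterCost_nonneg V a S j
    have hHG : H ≤ G := le_add_of_nonneg_right (mul_nonneg (by norm_num)
        (Finset.sum_nonneg fun j _ => centerCost_nonneg V a c j))
    have hpot : potential V S = H + U := potential_eq V a S
    rw [expCost, Finset.sum_range_succ, ← hh]
    -- At zero potential all sampling probabilities are 0/0 = 0, and so is the recursively defined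
    -- expected cost.
    rcases (potential_nonneg V S).eq_or_lt with h0 | hpos
    · have : ∀ i, dsqProb V S i = 0 := fun i => by
        rw [dsqProb_of_nonempty V hS, ← h0, div_zero]
      simp only [this, zero_mul, Finset.sum_const_zero]
      positivity
    have hdiv : ∑ i, dsqProb V S i * expCost V r (insert i S) =
        (∑ i, dsq V S i * expCost V r (insert i S)) / potential V S := by
      rw [Finset.sum_div]
      refine Finset.sum_congr rfl fun i _ => ?_
      rw [dsqProb_of_nonempty V hS, div_mul_eq_mul_div]
    rw [hdiv, div_le_iff₀ hpos, ← sum_clusters a,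
      ← Finset.sum_compl_add_sum (uncovered a S)]
    -- Picks in covered clusters: the uncovered set stays the same and no cost increases.
    have hcov : ∑ j ∈ (uncovered a S)ᶜ, ∑ i ∈ cluster a j, dsq V S i * expCost V r (insert i S) ≤
        H * (G * (1 + h) + (((u - r : ℕ) : ℝ) / u) * U) := by
      rw [hH, Finset.sum_mul]
      refine Finset.sum_le_sum fun j hj => ?_
      rw [clusterCost, Finset.sum_mul]
      refine Finset.sum_le_sum fun i hi => mul_le_mul_of_nonneg_left ?_ (dsq_nonneg V S i)
      have hij : a i = j := by simpa [cluster] using hi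
      have hun : uncovered a (insert i S) = uncovered a S := by
        rw [uncovered_insert, hij, Finset.erase_eq_of_notMem (by simpa using hj)]
      refine (ih (Finset.insert_nonempty i S)).trans ?_
      rw [hun]
      have g1 : settledCost V a c (insert i S) ≤ G := by
        rw [settledCost, hun]
        exact add_le_add_left (Finset.sum_le_sum fun j _ => clusterCost_insert_le V a hS i j) _
      have g2 : uncoveredCost V a (insert i S) ≤ U := by
        rw [uncoveredCost, hun]
        exact Finset.sum_le_sum fun j _ => clusterCost_insert_le V a hS i j
      gcongr
    have hunc : ∑ j ∈ uncovered a S, ∑ i ∈ cluster a j, dsq V S i * expCost V r (insert i S) ≤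
        U * (G * (1 + h)) + ((u - 1 - r : ℕ) : ℝ) / ((u - 1 : ℕ) : ℝ) *
          (U ^ 2 - ∑ j ∈ uncovered a S, clusterCost V a S j ^ 2) := by
      have key : ∀ j ∈ uncovered a S,
          ∑ i ∈ cluster a j, dsq V S i * expCost V r (insert i S) ≤
          clusterCost V a S j * (G * (1 + h)) + ((u - 1 - r : ℕ) : ℝ) / ((u - 1 : ℕ) : ℝ) *
          (clusterCost V a S j * U - clusterCost V a S j ^ 2) := by
        intro j hj
        -- A pick in the uncovered cluster `j` exchanges its advance 16 · `centerCost` for its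
        -- actual cost and takes its old cost out of `U`.
        have hi : ∀ i ∈ cluster a j, dsq V S i * expCost V r (insert i S) ≤
            dsq V S i * ((G - 16 * centerCost V a c j) * (1 + h) +
              ((u - 1 - r : ℕ) : ℝ) / ((u - 1 : ℕ) : ℝ) * (U - clusterCost V a S j)) +
            (dsq V S i * ∑ y ∈ cluster a j, dsq V (insert i S) y) * (1 + h) := by
          intro i hi
          have hij : a i = j := by simpa [cluster] using hi
          have hun : uncovered a (insert i S) = (uncovered a S).erase j := by
            rw [uncovered_insert, hij]
          have hcard : (uncovered a (insert i S)).card = u - 1 := by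
            rw [hun, Finset.card_erase_of_mem hj]
          have g1 : settledCost V a c (insert i S) ≤ (G - 16 * centerCost V a c j) +
              ∑ y ∈ cluster a j, dsq V (insert i S) y := by
            rw [settledCost, hun, Finset.compl_erase, Finset.sum_insert (by simpa using hj), hG,
              settledCost, ← Finset.sum_erase_add _ _ hj]
            have : ∑ j ∈ (uncovered a S)ᶜ, clusterCost V a (insert i S) j ≤
                ∑ j ∈ (uncovered a S)ᶜ, clusterCost V a S j :=
              Finset.sum_le_sum fun j _ => clusterCost_insert_le V a hS i j
            have e : clusterCost V a (insert i S) j = ∑ y ∈ cluster a j, dsq V (insert i S) y := rfl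
            linarith
          have g2 : uncoveredCost V a (insert i S) ≤ U - clusterCost V a S j := by
            rw [uncoveredCost, hun, hU, uncoveredCost, ← Finset.sum_erase_add _ _ hj]
            have : ∑ j ∈ (uncovered a S).erase j, clusterCost V a (insert i S) j ≤
                ∑ j ∈ (uncovered a S).erase j, clusterCost V a S j :=
              Finset.sum_le_sum fun j _ => clusterCost_insert_le V a hS i j
            linarith
          have g3 := ih (Finset.insert_nonempty i S)
          rw [hcard] at g3
          have g4 : expCost V r (insert i S) ≤ ((G - 16 * centerCost V a c j) +
              ∑ y ∈ cluster a j, dsq V (insert i S) y) * (1 + h) +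
              ((u - 1 - r : ℕ) : ℝ) / ((u - 1 : ℕ) : ℝ) * (U - clusterCost V a S j) := by
            refine g3.trans ?_
            gcongr
          have := mul_le_mul_of_nonneg_left g4 (dsq_nonneg V S i)
          linarith
        refine (Finset.sum_le_sum hi).trans ?_
        rw [Finset.sum_add_distrib, ← Finset.sum_mul, ← Finset.sum_mul]
        -- Weighted by `dsq`, the actual costs are covered by the released advance; the two terms
        -- with 16 cancel.
        have h16 := sum_dsq_mul_le V hS (cluster a j) (c j)
        have e1 : ∑ i ∈ cluster a j, dsq V S i = clusterCost V a S j := rfl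
        have e2 : ∑ y ∈ cluster a j, dist (V y) (c j) ^ 2 = centerCost V a c j := rfl
        rw [e1, e2] at h16
        rw [e1]
        have := mul_le_mul_of_nonneg_right h16 (by linarith : 0 ≤ 1 + h)
        linarith
      refine (Finset.sum_le_sum key).trans (le_of_eq ?_)
      rw [Finset.sum_add_distrib, ← Finset.sum_mul, ← Finset.mul_sum, Finset.sum_sub_distrib,
        ← Finset.sum_mul]
      have e : ∑ j ∈ uncovered a S, clusterCost V a S j = U := rfl
      rw [e]
      ring
    have hcs : U ^ 2 ≤ u * ∑ j ∈ uncovered a S, clusterCost V a S j ^ 2 :=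
      sq_sum_le_card_mul_sum_sq
    have hu0 : u = 0 → U = 0 := fun h => by
      rw [hU, uncoveredCost, Finset.card_eq_zero.1 h, Finset.sum_empty]
    have hfin := card_fraction_le u r hH0 hU0 hHG hu0 hcs
    refine (add_le_add hcov hunc).trans ?_
    rw [hpot]
    have e : (H + U) * (G / ((r : ℝ) + 1)) = G * (1 / ((r : ℝ) + 1)) * (H + U) := by ring
    nlinarith

/-- The crude bound `N` for the cluster size is harmless: averaging over the uniform first point
turns the last term into twice the total cost. -/
theorem settledCost_singleton_le (i : Fin N) :
    settledCost V a c {i} ≤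
      16 * (∑ y, dist (V y) (c (a y)) ^ 2) + 2 * N * dist (V i) (c (a i)) ^ 2 := by
  have hun : (uncovered a {i})ᶜ = {a i} := by
    ext j
    simp [uncovered]
  have htot : ∑ y, dist (V y) (c (a y)) ^ 2 = ∑ j, centerCost V a c j := by
    rw [← sum_clusters a]
    refine Finset.sum_congr rfl fun j _ => Finset.sum_congr rfl fun y hy => ?_
    have : a y = j := by simpa [cluster] using hy
    rw [this]
  rw [settledCost, htot, ← Finset.sum_compl_add_sum (uncovered a {i}), hun,
    Finset.sum_singleton, Finset.sum_singleton]
  have : clusterCost V a {i} (a i) ≤ 2 * centerCost V a c (a i) +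
      2 * N * dist (V i) (c (a i)) ^ 2 := by
    have h1 : clusterCost V a {i} (a i) ≤
        ∑ y ∈ cluster a (a i), (2 * dist (V y) (c (a i)) ^ 2 + 2 * dist (V i) (c (a i)) ^ 2) :=
      Finset.sum_le_sum fun y _ => by
        rw [dsq_singleton, dist_comm (V i) (c (a i))]
        exact dist_sq_le _ _ _
    refine h1.trans ?_
    rw [Finset.sum_add_distrib, ← Finset.mul_sum, Finset.sum_const, nsmul_eq_mul]
    have h2 : ((cluster a (a i)).card : ℝ) ≤ N := by
      have := Finset.card_le_univ (cluster a (a i))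
      rw [Fintype.card_fin] at this
      exact_mod_cast this
    have h3 : 0 ≤ 2 * dist (V i) (c (a i)) ^ 2 := by positivity
    have := mul_le_mul_of_nonneg_right h2 h3
    have e : ∑ y ∈ cluster a (a i), dist (V y) (c (a i)) ^ 2 = centerCost V a c (a i) := rfl
    rw [e]
    linarith
  have := centerCost_nonneg V a c (a i)
  linarith

/-- After the first pick there are k - 1 uncovered clusters and k - 1 rounds left, so the uncovered
term of `expCost_le` vanishes. The constant is 18 = 16 + 2. -/
theorem expCost_empty_le (hk : 1 ≤ k) :
    expCost V k ∅ ≤ 18 * (1 + ∑ i ∈ Finset.range (k - 1), 1 / ((i : ℝ) + 1)) *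
      ∑ y, dist (V y) (c (a y)) ^ 2 := by
  obtain ⟨r, rfl⟩ := Nat.exists_eq_add_of_le' hk
  rw [expCost, Nat.add_sub_cancel]
  set O := ∑ y, dist (V y) (c (a y)) ^ 2 with hO
  set h := ∑ i ∈ Finset.range r, 1 / ((i : ℝ) + 1) with hh
  have hh0 : 0 ≤ h := Finset.sum_nonneg fun i _ => by positivity
  have h1 : ∀ i : Fin N, dsqProb V ∅ i * expCost V r (insert i ∅) ≤
      (1 + h) * (16 * O / N + 2 * dist (V i) (c (a i)) ^ 2) := by
    intro i
    have hN : (0 : ℝ) < N := by exact_mod_cast i.pos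
    have g := expCost_le V a c r (Finset.singleton_nonempty i)
    have hcard : (uncovered a {i}).card - r = 0 := by
      have : uncovered a {i} = Finset.univ.erase (a i) := by
        ext j; simp [uncovered]
      rw [this, Finset.card_erase_of_mem (Finset.mem_univ _), Finset.card_univ, Fintype.card_fin]
      omega
    rw [hcard, Nat.cast_zero, zero_div, zero_mul, add_zero] at g
    have g2 := settledCost_singleton_le V a c i
    have g3 := mul_le_mul_of_nonneg_right g2 (by linarith : 0 ≤ 1 + h)
    rw [dsqProb, if_pos rfl, insert_empty_eq]
    calc 1 / (N : ℝ) * expCost V r {i} ≤ 1 / (N : ℝ) *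
          ((16 * O + 2 * N * dist (V i) (c (a i)) ^ 2) * (1 + h)) := by
          gcongr
          exact g.trans g3
      _ = _ := by field_simp
  refine (Finset.sum_le_sum fun i _ => h1 i).trans ?_
  rw [← Finset.mul_sum, Finset.sum_add_distrib, Finset.sum_const, Finset.card_univ,
    Fintype.card_fin, nsmul_eq_mul, ← Finset.mul_sum, ← hO]
  have hO0 : 0 ≤ O := Finset.sum_nonneg fun _ _ => sq_nonneg _
  have h2 : (N : ℝ) * (16 * O / N) ≤ 16 * O := by
    rcases Nat.eq_zero_or_pos N with h | h
    · rw [h]; simp; exact hO0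
    · have : (N : ℝ) ≠ 0 := by exact_mod_cast h.ne'
      rw [mul_div_cancel₀ _ this]
  nlinarith

end clusters

theorem sum_one_div_le_log (r : ℕ) :
    ∑ i ∈ Finset.range r, 1 / ((i : ℝ) + 1) ≤ 1 + Real.log r := by
  have := harmonic_le_one_add_log r
  simpa [harmonic, one_div] using this

theorem sum_one_div_pred_le_log (hk : 1 ≤ k) :
    ∑ i ∈ Finset.range (k - 1), 1 / ((i : ℝ) + 1) ≤ 1 + Real.log k := by
  have h0 : 0 ≤ Real.log k := Real.log_nonneg (by exact_mod_cast hk)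
  rcases Nat.eq_zero_or_pos (k - 1) with h | h
  · rw [h]; simp; linarith
  · refine (sum_one_div_le_log _).trans ?_
    have : Real.log ((k - 1 : ℕ) : ℝ) ≤ Real.log k :=
      Real.log_le_log (by exact_mod_cast h) (by exact_mod_cast Nat.sub_le k 1)
    linarith

/-- Each point is assigned to a nearest one of k arbitrary centers, and the infimum over these is
taken last. The harmonic sum is at most 1 + log k, and 18 (2 + log k) ≤ 36 (1 + log k). -/
theorem seeding_cost_le (hk : 1 ≤ k) :
    ∑ s : Fin k → Fin N, seedingProb V s * kmeansCost V (Set.range fun t => V (s t)) ≤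
      36 * (1 + Real.log k) * kmeansOpt V k := by
  have h0 : ∑ s : Fin k → Fin N, seedingProb V s * kmeansCost V (Set.range fun t => V (s t)) =
      expCost V k ∅ := by
    rw [← sum_seqProb_mul_potential]
    refine Finset.sum_congr rfl fun s _ => ?_
    rw [seedingProb_eq]
    congr 1
    rw [kmeansCost, potential]
    refine Finset.sum_congr rfl fun i _ => ?_
    rw [dsq]
    congr 3
    ext x
    simp
  have hl : 0 ≤ Real.log k := Real.log_nonneg (by exact_mod_cast hk)
  rw [h0, kmeansOpt, Real.mul_iInf_of_nonneg (by positivity)]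
  refine le_ciInf fun c => ?_
  have : Nonempty (Fin k) := ⟨⟨0, hk⟩⟩
  have hex : ∀ i : Fin N, ∃ j : Fin k, Metric.infDist (V i) (Set.range c) = dist (V i) (c j) := by
    intro i
    obtain ⟨y, ⟨j, rfl⟩, h⟩ := (Set.finite_range c).isCompact.exists_infDist_eq_dist
      (Set.range_nonempty c) (V i)
    exact ⟨j, h⟩
  choose a ha using hex
  refine (expCost_empty_le V a c hk).trans ?_
  rw [kmeansCost]
  simp_rw [ha]
  refine mul_le_mul_of_nonneg_right ?_ (Finset.sum_nonneg fun _ _ => sq_nonneg _)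
  have := sum_one_div_pred_le_log hk
  linarith

end kmeanspp

end

noncomputable section

/-! ### The rejection sampling chain -/

/-- The state of the seeding: the centers chosen so far, the charge for a proposal (zero if the
charge for the next center has not been fixed yet), and the remaining fuel. -/
structure SeedState (N : ℕ) where
  centers : List (Fin N)
  charge : ℝ
  fuel : ℝ

section seeding

variable {N d : ℕ} (V : Fin N → EuclideanSpace ℝ (Fin d))

/-- The acceptance probability of a proposed center. -/
def acceptProb (z : ℝ) (l : List (Fin N)) (i : Fin N) : ℝ :=
  dsq V l.toFinset i / (2 * (‖centered V i‖ ^ 2 + z))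

/-- What becomes of the state when the index `i` has been drawn. -/
def seedUpdate (z M : ℝ) (x : SeedState N) (i : Fin N) : PMF (SeedState N) :=
  if 0 < x.charge then
    (coin (acceptProb V z x.centers i)).map fun o =>
      if o then ⟨x.centers ++ [i], 0, x.fuel - x.charge⟩
      else ⟨x.centers, x.charge, x.fuel - x.charge⟩
  else PMF.pure ⟨x.centers, dsq V x.centers.toFinset i, x.fuel - M⟩

/-- One round: an index is drawn from `Q` or from `U`, depending on whether the charge is fixed. -/
def seedStep (U Q : PMF (Fin N)) (z M : ℝ) (x : SeedState N) : PMF (SeedState N) :=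
  (if 0 < x.charge then Q else U).bind (seedUpdate V z M x)

/-- The seeding goes on until there are `k` centers or the fuel is used up. -/
abbrev unfinished (k : ℕ) (x : SeedState N) : Prop := x.centers.length < k ∧ 0 < x.fuel

/-- The probability that the final list of centers is `L`. -/
def endProb (k : ℕ) (U Q : PMF (Fin N)) (z M : ℝ) (n : ℕ) (x : SeedState N)
    (L : List (Fin N)) : ℝ :=
  (((chain (unfinished k) (seedStep V U Q z M) n x).map SeedState.centers) L).toReal

/-- The expected total charge from a state with `t` centers, in which the charge is not yet fixed. -/
def expCharge (N k : ℕ) (Z : ℝ) (t : ℕ) : ℝ := ∑ r ∈ Finset.Ico t k, 3 * Z / ((N : ℝ) - r)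

variable {V} {k : ℕ} {U Q : PMF (Fin N)} {z M : ℝ}

/-! ### The law of the final list, one round at a time -/

theorem endProb_nonneg (n : ℕ) (x : SeedState N) (L : List (Fin N)) :
    0 ≤ endProb V k U Q z M n x L := ENNReal.toReal_nonneg

theorem endProb_le_one (n : ℕ) (x : SeedState N) (L : List (Fin N)) :
    endProb V k U Q z M n x L ≤ 1 := by
  refine ENNReal.toReal_le_of_le_ofReal zero_le_one ?_
  rw [ENNReal.ofReal_one]
  exact PMF.coe_le_one _ _

theorem endProb_of_not {n : ℕ} {x : SeedState N} (h : n = 0 ∨ ¬ unfinished k x)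
    (L : List (Fin N)) :
    endProb V k U Q z M n x L = if L = x.centers then 1 else 0 := by
  have : chain (unfinished k) (seedStep V U Q z M) n x = PMF.pure x := by
    cases n with
    | zero => rfl
    | succ n =>
      rw [chain, if_neg (h.resolve_left (Nat.succ_ne_zero n))]
  rw [endProb, this, PMF.pure_map, pure_toReal]
  split_ifs <;> rfl

theorem endProb_succ_propose {n : ℕ} {x : SeedState N} (h : unfinished k x) (hx : 0 < x.charge)
    (hacc : ∀ i, 0 ≤ acceptProb V z x.centers i ∧ acceptProb V z x.centers i ≤ 1)
    (L : List (Fin N)) :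
    endProb V k U Q z M (n + 1) x L = ∑ i, (Q i).toReal *
      (acceptProb V z x.centers i *
        endProb V k U Q z M n ⟨x.centers ++ [i], 0, x.fuel - x.charge⟩ L +
      (1 - acceptProb V z x.centers i) *
        endProb V k U Q z M n ⟨x.centers, x.charge, x.fuel - x.charge⟩ L) := by
  rw [endProb, chain, if_pos h, seedStep, if_pos hx, PMF.bind_bind, PMF.map_bind, bind_toReal]
  refine Finset.sum_congr rfl fun i _ => ?_
  rw [seedUpdate, if_pos hx, PMF.bind_map, PMF.map_bind, coin_bind_toReal (hacc i).1 (hacc i).2]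
  simp [endProb]

theorem endProb_succ_fix {n : ℕ} {x : SeedState N} (h : unfinished k x) (hx : ¬ 0 < x.charge)
    (L : List (Fin N)) :
    endProb V k U Q z M (n + 1) x L = ∑ i, (U i).toReal *
      endProb V k U Q z M n ⟨x.centers, dsq V x.centers.toFinset i, x.fuel - M⟩ L := by
  rw [endProb, chain, if_pos h, seedStep, if_neg hx, PMF.bind_bind, PMF.map_bind, bind_toReal]
  refine Finset.sum_congr rfl fun i _ => ?_
  rw [seedUpdate, if_neg hx, PMF.pure_bind, endProb]

/-- Row sampling knows only distances to the first data point. This domination makes it, mixed with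
the uniform law, a proposal for D²-sampling. -/
theorem dist_sq_le_norm_centered (i j : Fin N) :
    dist (V i) (V j) ^ 2 ≤ 2 * (‖centered V i‖ ^ 2 + ‖centered V j‖ ^ 2) := by
  have h := dist_sq_le (V i) (V ⟨0, i.pos⟩) (V j)
  rw [dist_comm (V ⟨0, i.pos⟩) (V j), dist_eq_norm (V i) (V ⟨0, i.pos⟩),
    dist_eq_norm (V j) (V ⟨0, i.pos⟩)] at h
  simp only [centered]
  linarith

theorem acceptProb_nonneg (hz : 0 ≤ z) (l : List (Fin N)) (i : Fin N) :
    0 ≤ acceptProb V z l i :=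
  div_nonneg (dsq_nonneg V _ _) (by positivity)

theorem acceptProb_le_one {i₀ : Fin N} {l : List (Fin N)} (h : i₀ ∈ l) (i : Fin N) :
    acceptProb V (‖centered V i₀‖ ^ 2) l i ≤ 1 :=
  div_le_one_of_le₀ ((dsq_le_dist V (List.mem_toFinset.2 h) i).trans
    (dist_sq_le_norm_centered i i₀)) (by positivity)

/-- The proposal weight cancels against the denominator of the acceptance probability, leaving a
multiple of the D² weight that does not depend on `i` otherwise. -/
theorem proposal_mul_acceptProb {i₀ : Fin N} {Z : ℝ}
    (hQ : ∀ i, (Q i).toReal = (‖centered V i‖ ^ 2 + ‖centered V i₀‖ ^ 2) / Z)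
    {l : List (Fin N)} (h : i₀ ∈ l) (i : Fin N) :
    (Q i).toReal * acceptProb V (‖centered V i₀‖ ^ 2) l i = dsq V l.toFinset i / (2 * Z) := by
  rw [hQ, acceptProb]
  have h0 : 0 ≤ ‖centered V i‖ ^ 2 + ‖centered V i₀‖ ^ 2 := by positivity
  -- If the denominator of `acceptProb` vanishes, so does the squared distance, and both sides are
  -- zero.
  rcases h0.eq_or_lt with h1 | h1
  · have h2 := (dsq_le_dist V (List.mem_toFinset.2 h) i).trans (dist_sq_le_norm_centered i i₀)
    rw [← h1, mul_zero] at h2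
    rw [le_antisymm h2 (dsq_nonneg V _ i)]
    simp
  · field_simp

/-- Centers are only ever appended, so the final list extends the current one. -/
theorem endProb_eq_zero {i₀ : Fin N} {x : SeedState N} (hi : i₀ ∈ x.centers) {L : List (Fin N)}
    (hL : ¬ x.centers <+: L) (n : ℕ) :
    endProb V k U Q (‖centered V i₀‖ ^ 2) M n x L = 0 := by
  have hne : ∀ y : SeedState N, ¬ y.centers <+: L → L ≠ y.centers := fun y h e => h (by rw [e])
  induction n generalizing x with
  | zero => rw [endProb_of_not (Or.inl rfl), if_neg (hne x hL)]
  | succ n ih =>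
    by_cases h : unfinished k x
    swap
    · rw [endProb_of_not (Or.inr h), if_neg (hne x hL)]
    by_cases hx : 0 < x.charge
    · rw [endProb_succ_propose h hx fun i =>
        ⟨acceptProb_nonneg (by positivity) _ _, acceptProb_le_one hi _⟩]
      refine Finset.sum_eq_zero fun i _ => ?_
      rw [ih (x := ⟨x.centers ++ [i], 0, x.fuel - x.charge⟩) (List.mem_append_left _ hi)
        (fun h => hL ((List.prefix_append _ _).trans h)),
        ih (x := ⟨x.centers, x.charge, x.fuel - x.charge⟩) hi hL]
      ring
    · rw [endProb_succ_fix h hx]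
      refine Finset.sum_eq_zero fun i _ => ?_
      rw [ih (x := ⟨x.centers, dsq V x.centers.toFinset i, x.fuel - M⟩) hi hL, mul_zero]

theorem sum_pmf_toReal (p : PMF (Fin N)) : ∑ i, (p i).toReal = 1 := by
  have h := p.tsum_coe
  rw [tsum_fintype] at h
  rw [← ENNReal.toReal_sum fun i _ => PMF.apply_ne_top _ _, h, ENNReal.toReal_one]

/-- A proposal is accepted, and then has the law of `D²`-sampling, with probability
proportional to the cost. -/
theorem endProb_succ_cons {i₀ : Fin N} {Z : ℝ}
    (hQ : ∀ i, (Q i).toReal = (‖centered V i‖ ^ 2 + ‖centered V i₀‖ ^ 2) / Z)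
    {n : ℕ} {x : SeedState N} (h : unfinished k x) (hx : 0 < x.charge) (hi : i₀ ∈ x.centers)
    (i : Fin N) (w : List (Fin N)) :
    endProb V k U Q (‖centered V i₀‖ ^ 2) M (n + 1) x (x.centers ++ i :: w) =
      dsq V x.centers.toFinset i / (2 * Z) *
        endProb V k U Q (‖centered V i₀‖ ^ 2) M n ⟨x.centers ++ [i], 0, x.fuel - x.charge⟩
          ((x.centers ++ [i]) ++ w) +
      (1 - potential V x.centers.toFinset / (2 * Z)) *
        endProb V k U Q (‖centered V i₀‖ ^ 2) M n ⟨x.centers, x.charge, x.fuel - x.charge⟩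
          (x.centers ++ i :: w) := by
  rw [endProb_succ_propose h hx fun i =>
        ⟨acceptProb_nonneg (by positivity) _ _, acceptProb_le_one hi _⟩]
  set L := x.centers ++ i :: w with hL
  have hL' : (x.centers ++ [i]) ++ w = L := by simp [hL]
  rw [hL']
  have h1 : ∀ j, (Q j).toReal * (acceptProb V (‖centered V i₀‖ ^ 2) x.centers j *
        endProb V k U Q (‖centered V i₀‖ ^ 2) M n ⟨x.centers ++ [j], 0, x.fuel - x.charge⟩ L +
      (1 - acceptProb V (‖centered V i₀‖ ^ 2) x.centers j) *
        endProb V k U Q (‖centered V i₀‖ ^ 2) M n ⟨x.centers, x.charge, x.fuel - x.charge⟩ L) =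
      dsq V x.centers.toFinset j / (2 * Z) *
        endProb V k U Q (‖centered V i₀‖ ^ 2) M n ⟨x.centers ++ [j], 0, x.fuel - x.charge⟩ L +
      ((Q j).toReal - dsq V x.centers.toFinset j / (2 * Z)) *
        endProb V k U Q (‖centered V i₀‖ ^ 2) M n ⟨x.centers, x.charge, x.fuel - x.charge⟩ L := by
    intro j
    rw [← proposal_mul_acceptProb hQ hi j]
    ring
  rw [Finset.sum_congr rfl fun j _ => h1 j, Finset.sum_add_distrib, ← Finset.sum_mul,
    Finset.sum_sub_distrib, sum_pmf_toReal, ← Finset.sum_div]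
  congr 1
  rw [Finset.sum_eq_single i]
  · intro j _ hj
    rw [endProb_eq_zero (x := ⟨x.centers ++ [j], 0, x.fuel - x.charge⟩) (L := L)
      (List.mem_append_left _ hi) ?_ n, mul_zero]
    rw [hL]
    intro hp
    rw [List.prefix_append_right_inj] at hp
    simp [hj] at hp
  · intro hi; exact absurd (Finset.mem_univ i) hi

/-- The left side is the total probability that a proposal is accepted. -/
theorem potential_le {i₀ : Fin N} {Z : ℝ}
    (hQ : ∀ i, (Q i).toReal = (‖centered V i‖ ^ 2 + ‖centered V i₀‖ ^ 2) / Z)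
    {l : List (Fin N)} (hi : i₀ ∈ l) : potential V l.toFinset / (2 * Z) ≤ 1 := by
  rw [potential, Finset.sum_div, ← sum_pmf_toReal Q]
  refine Finset.sum_le_sum fun i _ => ?_
  rw [← proposal_mul_acceptProb hQ hi i]
  exact mul_le_of_le_one_right ENNReal.toReal_nonneg (acceptProb_le_one hi i)

theorem toFinset_concat (l : List (Fin N)) (i : Fin N) :
    (l ++ [i]).toFinset = insert i l.toFinset := by
  ext j; simp

/-- With unlimited fuel the list would be D²-sampled; exhaustion only discards runs. In the
recursion the acceptance probability q = Φ/(2Z) drops out, as q p + (1 - q) p = p. -/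
theorem endProb_le {i₀ : Fin N} {Z : ℝ} (hZ : 0 ≤ Z)
    (hQ : ∀ i, (Q i).toReal = (‖centered V i‖ ^ 2 + ‖centered V i₀‖ ^ 2) / Z)
    (n : ℕ) (x : SeedState N) (hi : i₀ ∈ x.centers) (w : List (Fin N)) :
    endProb V k U Q (‖centered V i₀‖ ^ 2) M n x (x.centers ++ w) ≤
      seqProb V x.centers.toFinset w := by
  induction n generalizing x w with
  | zero =>
    cases w with
    | nil => exact endProb_le_one _ _ _
    | cons i w =>
      rw [endProb_of_not (Or.inl rfl), if_neg (by simp)]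
      exact seqProb_nonneg V _ _
  | succ n ih =>
    cases w with
    | nil => exact endProb_le_one _ _ _
    | cons i w =>
      by_cases h : unfinished k x
      swap
      · rw [endProb_of_not (Or.inr h), if_neg (by simp)]
        exact seqProb_nonneg V _ _
      by_cases hx : 0 < x.charge
      · rw [endProb_succ_cons hQ h hx hi]
        have hne : x.centers.toFinset.Nonempty := ⟨i₀, List.mem_toFinset.2 hi⟩
        have h1 := ih ⟨x.centers ++ [i], 0, x.fuel - x.charge⟩ (List.mem_append_left _ hi) w
        have h2 := ih ⟨x.centers, x.charge, x.fuel - x.charge⟩ hi (i :: w)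
        simp only [toFinset_concat] at h1
        simp only [seqProb, dsqProb_of_nonempty V hne] at h2 ⊢
        set D := dsq V x.centers.toFinset i with hD
        set Φ := potential V x.centers.toFinset with hΦ
        set P := seqProb V (insert i x.centers.toFinset) w with hP
        have hp := potential_le hQ hi
        have hD0 : 0 ≤ D := dsq_nonneg V _ _
        have e : D / (2 * Z) = Φ / (2 * Z) * (D / Φ) := by
          rcases (potential_nonneg V x.centers.toFinset).eq_or_lt with h0 | h0
          · have : D ≤ Φ := Finset.single_le_sum (f := fun i => dsq V x.centers.toFinset i)
              (fun j _ => dsq_nonneg V _ j) (Finset.mem_univ i)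
            have hD' : D = 0 := le_antisymm (this.trans h0.ge) hD0
            rw [hD']; simp
          · have : Φ ≠ 0 := h0.ne'
            field_simp
        calc _ ≤ D / (2 * Z) * P + (1 - Φ / (2 * Z)) * (D / Φ * P) := by
              refine add_le_add (mul_le_mul_of_nonneg_left h1 (by positivity))
                (mul_le_mul_of_nonneg_left h2 (by linarith))
          _ = D / Φ * P := by rw [e]; ring
      · rw [endProb_succ_fix h hx]
        calc _ ≤ ∑ j, (U j).toReal * seqProb V x.centers.toFinset (i :: w) :=
              Finset.sum_le_sum fun j _ => mul_le_mul_of_nonneg_left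
                (ih ⟨x.centers, dsq V x.centers.toFinset j, x.fuel - M⟩ hi (i :: w))
                ENNReal.toReal_nonneg
          _ = _ := by rw [← Finset.sum_mul, sum_pmf_toReal, one_mul]

/-! ### Expected charges and the loss through exhausted fuel -/

theorem expCharge_nonneg (hk : k ≤ N) {Z : ℝ} (hZ : 0 ≤ Z) (t : ℕ) : 0 ≤ expCharge N k Z t :=
  Finset.sum_nonneg fun r hr => by
    have : (r : ℝ) < N := by exact_mod_cast (Finset.mem_Ico.1 hr).2.trans_le hk
    have := sub_pos.2 this
    positivity

/-- The expected total charge from a given state. -/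
def stateCharge (V : Fin N → EuclideanSpace ℝ (Fin d)) (k : ℕ) (Z : ℝ) (l : List (Fin N))
    (X : ℝ) : ℝ :=
  if 0 < X then X * (2 * Z / potential V l.toFinset) + expCharge N k Z (l.length + 1)
  else expCharge N k Z l.length

theorem stateCharge_nonneg (hk : k ≤ N) {Z : ℝ} (hZ : 0 ≤ Z) (l : List (Fin N)) (X : ℝ) :
    0 ≤ stateCharge V k Z l X := by
  rw [stateCharge]
  split_ifs with h
  · exact add_nonneg (mul_nonneg h.le (div_nonneg (by positivity) (potential_nonneg V _)))
      (expCharge_nonneg hk hZ _)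
  · exact expCharge_nonneg hk hZ _

/-- The recursion behind `expCharge`. The charges D²(j) sum to Φ and cancel the denominator of 2Z/Φ,
while the t indices already chosen leave the state as it is. With E_t the expected charge from t
centers this reads Z + 2Z + (N - t) E_{t+1} + t E_t = N E_t, which forces E_t - E_{t+1} = 3Z/(N -
t). -/
theorem sum_stateCharge (hV : Function.Injective V) (hk : k ≤ N) {Z : ℝ} {l : List (Fin N)}
    (hl : l ≠ []) (hnd : l.Nodup) (hlk : l.length < k) :
    ∑ j, stateCharge V k Z l (dsq V l.toFinset j) + Z = N * expCharge N k Z l.length := by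
  have hne : l.toFinset.Nonempty := by simpa using hl
  have hcard : l.toFinset.card = l.length := List.toFinset_card_of_nodup hnd
  have hpos : 0 < potential V l.toFinset := potential_pos hV hne (by omega)
  have h1 : ∀ j, stateCharge V k Z l (dsq V l.toFinset j) =
      dsq V l.toFinset j * (2 * Z / potential V l.toFinset) +
        (if j ∈ l.toFinset then 3 * Z / ((N : ℝ) - l.length) else 0) +
          expCharge N k Z (l.length + 1) := by
    intro j
    have h2 : expCharge N k Z l.length =
        3 * Z / ((N : ℝ) - l.length) + expCharge N k Z (l.length + 1) := by
      rw [expCharge, Finset.sum_eq_sum_Ico_succ_bot hlk, expCharge]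
    by_cases hj : j ∈ l.toFinset
    · rw [dsq_of_mem V hj, stateCharge, if_neg (lt_irrefl _), if_pos hj, h2]
      ring
    · rw [stateCharge, if_pos (dsq_pos hV hne hj), if_neg hj, add_zero]
  rw [Finset.sum_congr rfl fun j _ => h1 j, Finset.sum_add_distrib, Finset.sum_add_distrib,
    ← Finset.sum_mul, ← Finset.sum_filter, Finset.sum_const, Finset.sum_const, Finset.card_univ,
    Fintype.card_fin]
  have e1 : (Finset.univ.filter (· ∈ l.toFinset)).card = l.length := by
    rw [← hcard]; congr 1; ext; simp
  have e2 : ∑ i, dsq V l.toFinset i = potential V l.toFinset := rfl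
  have h2 : expCharge N k Z l.length =
        3 * Z / ((N : ℝ) - l.length) + expCharge N k Z (l.length + 1) := by
      rw [expCharge, Finset.sum_eq_sum_Ico_succ_bot hlk, expCharge]
  have hNl : (0 : ℝ) < (N : ℝ) - l.length := by
    have : (l.length : ℝ) < N := by exact_mod_cast hlk.trans_le hk
    linarith
  rw [e1, e2, h2, nsmul_eq_mul, nsmul_eq_mul]
  field_simp
  ring

/-- Markov's inequality in inductive form. Fuel minus expected charge is reproduced exactly by a
round, is nonpositive once the fuel is gone, and is at most `F` at success. The factor `seqProb` can
be carried along because the expected charge does not depend on the future centers. As every charge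
is at least `c`, `hn` ensures that the fuel is gone when the `n` rounds are. -/
theorem le_endProb {i₀ : Fin N} {Z F c : ℝ} (hV : Function.Injective V) (hk : k ≤ N)
    (hZ : 0 < Z) (hF : 0 ≤ F) (hM : M = Z / N) (hcM : c ≤ M)
    (hc : ∀ i j, i ≠ j → c ≤ dist (V i) (V j) ^ 2)
    (hU : ∀ i, (U i).toReal = 1 / N)
    (hQ : ∀ i, (Q i).toReal = (‖centered V i‖ ^ 2 + ‖centered V i₀‖ ^ 2) / Z)
    (n : ℕ) (x : SeedState N) (hi : i₀ ∈ x.centers) (hnd : x.centers.Nodup) (w : List (Fin N))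
    (hlen : x.centers.length + w.length = k) (hX : x.charge = 0 ∨ 0 < x.charge ∧ c ≤ x.charge)
    (hn : x.fuel ≤ n * c) (hxF : x.fuel ≤ F) :
    seqProb V x.centers.toFinset w * (x.fuel - stateCharge V k Z x.centers x.charge) ≤
      F * endProb V k U Q (‖centered V i₀‖ ^ 2) M n x (x.centers ++ w) := by
  have hN : (0 : ℝ) < N := by exact_mod_cast i₀.pos
  induction n generalizing x w with
  | zero =>
    have h1 := stateCharge_nonneg (V := V) hk hZ.le x.centers x.charge
    rw [Nat.cast_zero, zero_mul] at hn
    calc _ ≤ 0 := mul_nonpos_of_nonneg_of_nonpos (seqProb_nonneg V _ _) (by linarith)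
      _ ≤ _ := mul_nonneg hF (endProb_nonneg _ _ _)
  | succ n ih =>
    have hsc := stateCharge_nonneg (V := V) hk hZ.le x.centers x.charge
    cases w with
    | nil =>
      -- Success depends on the number of centers alone, even if the last charge has made the fuel
      -- negative.
      rw [endProb_of_not (Or.inr fun h => by simp at hlen; omega), if_pos (by simp), seqProb]
      linarith
    | cons i w =>
      rcases le_or_gt x.fuel 0 with hf | hf
      · calc _ ≤ 0 := mul_nonpos_of_nonneg_of_nonpos (seqProb_nonneg V _ _) (by linarith)
          _ ≤ _ := mul_nonneg hF (endProb_nonneg _ _ _)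
      have hlk : x.centers.length < k := by simp at hlen; omega
      have h : unfinished k x := ⟨hlk, hf⟩
      have hne : x.centers.toFinset.Nonempty := ⟨i₀, List.mem_toFinset.2 hi⟩
      have hcard : x.centers.toFinset.card = x.centers.length := List.toFinset_card_of_nodup hnd
      have hpot : 0 < potential V x.centers.toFinset := potential_pos hV hne (by omega)
      rw [Nat.cast_succ] at hn
      rcases hX with hX | ⟨hX, hXc⟩
      · have hX' : ¬ 0 < x.charge := by rw [hX]; exact lt_irrefl _
        rw [endProb_succ_fix h hX']
        set P := seqProb V x.centers.toFinset (i :: w) with hP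
        have hj : ∀ j, (1 / (N : ℝ)) * (P * (x.fuel - M -
            stateCharge V k Z x.centers (dsq V x.centers.toFinset j))) ≤
            F * ((U j).toReal * endProb V k U Q (‖centered V i₀‖ ^ 2) M n
              ⟨x.centers, dsq V x.centers.toFinset j, x.fuel - M⟩ (x.centers ++ i :: w)) := by
          intro j
          have := ih ⟨x.centers, dsq V x.centers.toFinset j, x.fuel - M⟩ hi hnd (i :: w) hlen (by
            by_cases hj : j ∈ x.centers.toFinset
            · exact Or.inl (dsq_of_mem V hj)
            · refine Or.inr ⟨dsq_pos hV hne hj, ?_⟩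
              obtain ⟨y, hy, e⟩ := exists_dsq_eq V hne j
              simp only [e]
              exact hc j y fun h => hj (h ▸ hy)) (by simp only; linarith)
              (by
                have hM0 : 0 ≤ M := by rw [hM]; positivity
                simp only; linarith)
          have h2 := mul_le_mul_of_nonneg_left this (by positivity : (0 : ℝ) ≤ 1 / N)
          rw [hU]
          linarith
        rw [Finset.mul_sum]
        refine le_trans (le_of_eq ?_) (Finset.sum_le_sum fun j _ => hj j)
        rw [← Finset.mul_sum, ← Finset.mul_sum, Finset.sum_sub_distrib, Finset.sum_const,
          Finset.card_univ, Fintype.card_fin, nsmul_eq_mul]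
        have hs := sum_stateCharge hV hk (Z := Z) (List.ne_nil_of_mem hi) hnd hlk
        have hs' : ∑ j, stateCharge V k Z x.centers (dsq V x.centers.toFinset j) =
            N * expCharge N k Z x.centers.length - Z := by linarith
        rw [hs', stateCharge, if_neg hX', hM]
        field_simp
        ring
      · rw [endProb_succ_cons hQ h hX hi]
        have hp := potential_le hQ hi
        have h2 := ih ⟨x.centers, x.charge, x.fuel - x.charge⟩ hi hnd (i :: w) hlen
          (Or.inr ⟨hX, hXc⟩) (by simp only; linarith) (by simp only; linarith)
        have h1 : dsq V x.centers.toFinset i * (seqProb V (insert i x.centers.toFinset) w *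
            (x.fuel - x.charge - expCharge N k Z (x.centers.length + 1))) ≤
            dsq V x.centers.toFinset i * (F * endProb V k U Q (‖centered V i₀‖ ^ 2) M n
              ⟨x.centers ++ [i], 0, x.fuel - x.charge⟩ (x.centers ++ [i] ++ w)) := by
          -- An index already chosen has weight zero, so the induction meets only lists without
          -- repetition.
          by_cases hix : i ∈ x.centers.toFinset
          · rw [dsq_of_mem V hix, zero_mul, zero_mul]
          · refine mul_le_mul_of_nonneg_left ?_ (dsq_nonneg V _ _)
            have := ih ⟨x.centers ++ [i], 0, x.fuel - x.charge⟩ (List.mem_append_left _ hi)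
              (by
                rw [List.nodup_append]
                refine ⟨hnd, List.nodup_singleton i, ?_⟩
                intro a ha b hb
                rw [List.mem_singleton.1 hb]
                exact fun e => hix (List.mem_toFinset.2 (e ▸ ha))) w
              (by simp at hlen ⊢; omega) (Or.inl rfl) (by simp only; linarith)
              (by simp only; linarith)
            simp only [toFinset_concat, stateCharge, lt_irrefl, if_false, List.length_append,
              List.length_singleton] at this
            exact this
        simp only [stateCharge, if_pos hX, seqProb, dsqProb_of_nonempty V hne] at h2 ⊢
        set D := dsq V x.centers.toFinset i with hD
        set Φ := potential V x.centers.toFinset with hΦ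
        set P := seqProb V (insert i x.centers.toFinset) w with hP
        set E := expCharge N k Z (x.centers.length + 1) with hE
        have h3 := mul_le_mul_of_nonneg_left h1 (by positivity : (0 : ℝ) ≤ 1 / (2 * Z))
        have h4 := mul_le_mul_of_nonneg_left h2 (sub_nonneg.2 hp)
        -- With q = Φ/(2Z), the expected charge E' = X/q + E before acceptance solves E' = X + (1 -
        -- q) E' + q E.
        have e : D / Φ * P * (x.fuel - (x.charge * (2 * Z / Φ) + E)) =
            1 / (2 * Z) * (D * (P * (x.fuel - x.charge - E))) + (1 - Φ / (2 * Z)) *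
              (D / Φ * P * (x.fuel - x.charge - (x.charge * (2 * Z / Φ) + E))) := by
          have := hpot.ne'
          field_simp
          ring
        rw [e]
        refine (add_le_add h3 h4).trans (le_of_eq ?_)
        ring

end seeding

end

noncomputable section

/-! ### The seeding program -/

section rules

variable {env : SQOp → Cmd} {b : Cmd} {m : Mem} {T : ℕ} {α : Type} {ν : PMF α}
  {R : α → Mem → Prop}

theorem Sim.setNV_seq {s : Side} {x : ℕ} {e : NExp}
    (h : Sim env b (m.upd s ((m s).setNV x (e.eval m))) T ν R) :
    Sim env (Cmd.seq (Cmd.setNV s x e) b) m (T + 2) ν R :=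
  Sim.le (Sim.det_seq (Q := (· = m.upd s ((m s).setNV x (e.eval m)))) (Det.setNV rfl)
    (by rintro _ rfl; exact h)) (by omega)

theorem Sim.setRV_seq {s : Side} {x : ℕ} {e : RExp}
    (h : Sim env b (m.upd s ((m s).setRV x (e.eval m))) T ν R) :
    Sim env (Cmd.seq (Cmd.setRV s x e) b) m (T + 2) ν R :=
  Sim.le (Sim.det_seq (Q := (· = m.upd s ((m s).setRV x (e.eval m)))) (Det.setRV rfl)
    (by rintro _ rfl; exact h)) (by omega)

theorem Sim.setNA_seq {s : Side} {x : ℕ} {i j e : NExp}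
    (h : Sim env b (m.upd s ((m s).setNA x (i.eval m) (j.eval m) (e.eval m))) T ν R) :
    Sim env (Cmd.seq (Cmd.setNA s x i j e) b) m (T + 2) ν R :=
  Sim.le (Sim.det_seq (Q := (· = m.upd s ((m s).setNA x (i.eval m) (j.eval m) (e.eval m))))
    (Det.setNA rfl) (by rintro _ rfl; exact h)) (by omega)

theorem Sim.entry_seq
    (h : Sim sqEnv b (m.upd Side.pub ((m Side.pub).setRV 0
      ((m Side.hid).ra 0 ((m Side.pub).nv 3) ((m Side.pub).nv 4) -
        (m Side.hid).ra 0 0 ((m Side.pub).nv 4)))) T ν R) :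
    Sim sqEnv (Cmd.seq (Cmd.call SQOp.entry) b) m (T + 3) ν R :=
  Sim.le (Sim.det_seq (Q := (· = m.upd Side.pub ((m Side.pub).setRV 0
      ((m Side.hid).ra 0 ((m Side.pub).nv 3) ((m Side.pub).nv 4) -
        (m Side.hid).ra 0 0 ((m Side.pub).nv 4))))) (Det.call (T := 1) (Det.setRV rfl))
    (by rintro _ rfl; exact h)) (by omega)

theorem Sim.rowNorm_seq
    (h : Sim sqEnv b (m.upd Side.pub ((m Side.pub).setRV 0
      (Real.sqrt ((m Side.hid).ra 1 ((m Side.pub).nv 3) ((m Side.pub).nv 1))))) T ν R) :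
    Sim sqEnv (Cmd.seq (Cmd.call SQOp.rowNorm) b) m (T + 3) ν R :=
  Sim.le (Sim.det_seq (Q := (· = m.upd Side.pub ((m Side.pub).setRV 0
      (Real.sqrt ((m Side.hid).ra 1 ((m Side.pub).nv 3) ((m Side.pub).nv 1))))))
    (Det.call (T := 1) (Det.setRV rfl)) (by rintro _ rfl; exact h)) (by omega)

end rules

/-! ### Memory layout and the pieces of a round -/

/-- The two memories agree except for the public scratch scalars and the hidden scalars. -/
def Keeps (m m' : Mem) : Prop :=
  (∀ x, x < 3 ∨ 20 ≤ x → (m' Side.pub).nv x = (m Side.pub).nv x) ∧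
  (∀ x, 20 ≤ x → (m' Side.pub).rv x = (m Side.pub).rv x) ∧
  (m' Side.pub).na = (m Side.pub).na ∧ (m' Side.hid).ra = (m Side.hid).ra

theorem Keeps.refl (m : Mem) : Keeps m m := ⟨fun _ _ => rfl, fun _ _ => rfl, rfl, rfl⟩

theorem Keeps.trans {m m' m'' : Mem} (h : Keeps m m') (h' : Keeps m' m'') : Keeps m m'' :=
  ⟨fun x hx => (h'.1 x hx).trans (h.1 x hx), fun x hx => (h'.2.1 x hx).trans (h.2.1 x hx),
    h'.2.2.1.trans h.2.2.1, h'.2.2.2.trans h.2.2.2⟩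

theorem Keeps.setNV {m m' : Mem} {x v : ℕ} (h : Keeps m m') (hx : 3 ≤ x ∧ x < 20) :
    Keeps m (m'.upd Side.pub ((m' Side.pub).setNV x v)) := by
  refine ⟨fun y hy => ?_, fun y hy => ?_, ?_, ?_⟩
  · rw [← h.1 y hy]
    simp only [Mem.upd_same, Store.setNV]
    exact Function.update_of_ne (by omega) _ _
  · simpa [Store.setNV] using h.2.1 y hy
  · simpa [Store.setNV] using h.2.2.1
  · simpa [Store.setNV] using h.2.2.2

theorem Keeps.setRV {m m' : Mem} {x : ℕ} {v : ℝ} (h : Keeps m m') (hx : x < 20) :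
    Keeps m (m'.upd Side.pub ((m' Side.pub).setRV x v)) := by
  refine ⟨fun y hy => ?_, fun y hy => ?_, ?_, ?_⟩
  · simpa [Store.setRV] using h.1 y hy
  · rw [← h.2.1 y hy]
    simp only [Mem.upd_same, Store.setRV]
    exact Function.update_of_ne (by omega) _ _
  · simpa [Store.setRV] using h.2.2.1
  · simpa [Store.setRV] using h.2.2.2

theorem ScratchEq.keeps {m m' : Mem} (h : ScratchEq Side.pub m m') : Keeps m m' :=
  ⟨fun _ _ => h.nv (by omega), fun _ _ => by rw [h.rv], h.na, h.ra⟩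

/-- The squared distance of the points `12` and `na 0 0 r`, `r` being the variable `13`, is
accumulated in the real variable `2`. -/
def pairDistCmd : Cmd :=
  Cmd.loop (Test.nlt (NExp.var Side.pub 4) (NExp.var Side.pub 1))
    (Cmd.seq (Cmd.setNV Side.pub 3 (NExp.var Side.pub 12))
    (Cmd.seq (Cmd.call SQOp.entry)
    (Cmd.seq (Cmd.setRV Side.pub 3 (RExp.var Side.pub 0))
    (Cmd.seq (Cmd.setNV Side.pub 3 (NExp.arr Side.pub 0 (NExp.lit 0) (NExp.var Side.pub 13)))
    (Cmd.seq (Cmd.call SQOp.entry)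
    (Cmd.seq (Cmd.setRV Side.pub 3 (RExp.sub (RExp.var Side.pub 3) (RExp.var Side.pub 0)))
    (Cmd.seq (Cmd.setRV Side.pub 2 (RExp.add (RExp.var Side.pub 2)
      (RExp.mul (RExp.var Side.pub 3) (RExp.var Side.pub 3))))
    (Cmd.setNV Side.pub 4 (NExp.add (NExp.var Side.pub 4) (NExp.lit 1))))))))))

/-- Entries are delivered relative to row `0`; the shift cancels in the difference. The running
minimum `best` is only carried along. -/
theorem Det.pairDistCmd {a : ℕ → ℕ → ℝ} {d i r s : ℕ} {best : ℝ} {m₀ : Mem}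
    (ha : (m₀ Side.hid).ra 0 = a) (hd : (m₀ Side.pub).nv 1 = d) (hs : (m₀ Side.pub).na 0 0 r = s)
    {m : Mem} (hm : Keeps m₀ m) (h12 : (m Side.pub).nv 12 = i) (h13 : (m Side.pub).nv 13 = r)
    (h4 : (m Side.pub).nv 4 = 0) (h1 : (m Side.pub).rv 1 = best) (h2 : (m Side.pub).rv 2 = 0) :
    Det sqEnv pairDistCmd m (d * 19 + 1) (fun m' => Keeps m₀ m' ∧ (m' Side.pub).nv 12 = i ∧
      (m' Side.pub).nv 13 = r ∧ (m' Side.pub).rv 1 = best ∧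
      (m' Side.pub).rv 2 = ∑ c ∈ Finset.range d, (a i c - a s c) ^ 2) := by
  refine Det.conseq (Det.loop (T := 17) (fun j m' => (Keeps m₀ m' ∧ (m' Side.pub).nv 12 = i ∧
      (m' Side.pub).nv 13 = r ∧ (m' Side.pub).rv 1 = best ∧
      (m' Side.pub).rv 2 = ∑ c ∈ Finset.range j, (a i c - a s c) ^ 2) ∧ (m' Side.pub).nv 4 = j)
      d ?_ ?_ 0 (Nat.zero_le _) ⟨⟨hm, h12, h13, h1, by simpa using h2⟩, h4⟩) fun _ h => h.1
  · rintro j m - ⟨⟨h, -⟩, h4⟩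
    simp [Test.Holds, NExp.eval, h4, h.1 1 (by norm_num), hd]
  rintro j m - ⟨⟨hk, h12, h13, h1, h2⟩, h4⟩
  have ha' : (m Side.hid).ra 0 = a := by rw [hk.2.2.2, ha]
  have hs' : (m Side.pub).na 0 0 r = s := by rw [hk.2.2.1, hs]
  refine Sim.setNV_seq (T := 15) <| Sim.entry_seq (T := 12) <| Sim.setRV_seq (T := 10) <|
    Sim.setNV_seq (T := 8) <| Sim.entry_seq (T := 5) <| Sim.setRV_seq (T := 3) <|
    Sim.setRV_seq (T := 1) <| Det.setNV ⟨⟨?_, ?_⟩, ?_⟩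
  · exact ((((((((hk.setNV (by norm_num)).setRV (by norm_num)).setRV (by norm_num)).setNV
      (by norm_num)).setRV (by norm_num)).setRV (by norm_num)).setRV (by norm_num)).setNV
      (by norm_num))
  · simp [Store.setNV, Store.setRV, NExp.eval, RExp.eval, h12, h13, h1, h2, h4, ha', hs',
      Finset.sum_range_succ]
    ring
  · simp [Store.setNV, Store.setRV, NExp.eval, h4]

/-- The squared distance of the point `12` from the nearest chosen center is computed in the real
variable `1`. -/
def nearestCmd : Cmd :=
  Cmd.seq (Cmd.setNV Side.pub 13 (NExp.lit 0))
    (Cmd.loop (Test.nlt (NExp.var Side.pub 13) (NExp.var Side.pub 20))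
      (Cmd.seq (Cmd.setRV Side.pub 2 (RExp.ofNat (NExp.lit 0)))
      (Cmd.seq (Cmd.setNV Side.pub 4 (NExp.lit 0))
      (Cmd.seq pairDistCmd
      (Cmd.seq (Cmd.ite (Test.neq (NExp.var Side.pub 13) (NExp.lit 0))
          (Cmd.setRV Side.pub 1 (RExp.var Side.pub 2))
          (Cmd.ite (Test.rlt (RExp.var Side.pub 2) (RExp.var Side.pub 1))
            (Cmd.setRV Side.pub 1 (RExp.var Side.pub 2)) Cmd.skip))
        (Cmd.setNV Side.pub 13 (NExp.add (NExp.var Side.pub 13) (NExp.lit 1))))))))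

section data

variable {N d : ℕ} (V : Fin N → EuclideanSpace ℝ (Fin d))

theorem sum_dataArr_sub_sq (i s : Fin N) :
    ∑ c ∈ Finset.range d, (dataArr V i c - dataArr V s c) ^ 2 = dist (V i) (V s) ^ 2 := by
  rw [dist_eq_norm, EuclideanSpace.norm_sq_eq, ← Fin.sum_univ_eq_sum_range
    (fun c => (dataArr V i c - dataArr V s c) ^ 2)]
  refine Finset.sum_congr rfl fun j _ => ?_
  simp [dataArr, Real.norm_eq_abs, sq_abs]

/-- The memory represents a state of the seeding. -/
def Represents (k : ℕ) (z Z M : ℝ) (x : SeedState N) (m : Mem) : Prop :=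
  SQInv (dataArr V) N d (m Side.hid) ∧
  ((m Side.pub).nv 0 = N ∧ (m Side.pub).nv 1 = d ∧ (m Side.pub).nv 2 = k ∧
    (m Side.pub).nv 20 = x.centers.length) ∧
  (∀ (r : ℕ) (h : r < x.centers.length), (m Side.pub).na 0 0 r = x.centers[r]) ∧
  (m Side.pub).rv 20 = x.fuel ∧ (m Side.pub).rv 21 = x.charge ∧ (m Side.pub).rv 22 = z ∧
  (m Side.pub).rv 23 = Z ∧ (m Side.pub).rv 24 = M

variable {V}

/-- The state lives in scalars numbered from 20 on, the inputs, and arrays, all of which `Keeps`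
protects. -/
theorem Represents.keeps {k : ℕ} {z Z M : ℝ} {x : SeedState N} {m m' : Mem}
    (h : Represents V k z Z M x m) (hk : Keeps m m') : Represents V k z Z M x m' := by
  obtain ⟨h1, ⟨h2, h3, h4, h5⟩, h6, h7, h8, h9, h10, h11⟩ := h
  refine ⟨h1.congr hk.2.2.2, ⟨?_, ?_, ?_, ?_⟩, ?_, ?_, ?_, ?_, ?_, ?_⟩
  · rw [hk.1 _ (by norm_num), h2]
  · rw [hk.1 _ (by norm_num), h3]
  · rw [hk.1 _ (by norm_num), h4]
  · rw [hk.1 _ (by norm_num), h5]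
  · rw [hk.2.2.1]; exact h6
  · rw [hk.2.1 _ (by norm_num), h7]
  · rw [hk.2.1 _ (by norm_num), h8]
  · rw [hk.2.1 _ (by norm_num), h9]
  · rw [hk.2.1 _ (by norm_num), h10]
  · rw [hk.2.1 _ (by norm_num), h11]

theorem Det.nearestCmd {k : ℕ} {z Z M : ℝ} {x : SeedState N} {m₀ m : Mem} {i : Fin N}
    (h₀ : Represents V k z Z M x m₀) (hx : x.centers ≠ []) (hm : Keeps m₀ m)
    (h12 : (m Side.pub).nv 12 = i) :
    Det sqEnv nearestCmd m (x.centers.length * (d * 19 + 14) + 3) (fun m' => Keeps m₀ m' ∧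
      (m' Side.pub).nv 12 = i ∧ (m' Side.pub).rv 1 = dsq V x.centers.toFinset i) := by
  set l := x.centers with hl
  obtain ⟨hI, ⟨-, hd, -, h20⟩, hna, -⟩ := h₀
  refine Sim.setNV_seq (T := x.centers.length * (d * 19 + 14) + 1) ?_
  -- The minimum is meaningful only from one center on: the conventional distance 0 to no center
  -- would spoil it, so the first pass overwrites instead of comparing.
  refine Det.le (Det.conseq (Det.loop (T := d * 19 + 12) (fun r m' => Keeps m₀ m' ∧
    (m' Side.pub).nv 12 = i ∧ (m' Side.pub).nv 13 = r ∧
    (0 < r → (m' Side.pub).rv 1 = dsq V (l.take r).toFinset i)) l.length ?_ ?_ 0 (Nat.zero_le _)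
    ⟨hm.setNV (by norm_num), ?_, ?_, ?_⟩) ?_) ?_
  · rintro r m - ⟨h1, -, h3, -⟩
    simp [Test.Holds, NExp.eval, h3, h1.1 20 (by norm_num), h20, hl]
  · rintro r m hr ⟨h1, h2, h3, h4⟩
    refine Sim.setRV_seq (T := d * 19 + 10) <| Sim.setNV_seq (T := d * 19 + 8) <|
      Det.le (Det.seq (T₁ := d * 19 + 1) (T₂ := 5)
        (Det.pairDistCmd (i := i) (r := r) (best := (m Side.pub).rv 1) hI.1 hd (hna r hr)
        ((h1.setRV (by norm_num)).setNV (by norm_num)) ?_ ?_ ?_ ?_ ?_) ?_) (by omega)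
    · simp [Store.setNV, Store.setRV, h2]
    · simp [Store.setNV, Store.setRV, h3]
    · simp [Store.setNV, NExp.eval]
    · simp [Store.setNV, Store.setRV]
    · simp [Store.setNV, Store.setRV, RExp.eval, NExp.eval]
    · rintro m' ⟨g1, g2, g3, g4, g5⟩
      rw [sum_dataArr_sub_sq] at g5
      change _ = dist (V i) (V l[r]) ^ 2 at g5
      have hins : (l.take (r + 1)).toFinset = insert l[r] (l.take r).toFinset := by
        rw [← toFinset_concat, List.take_append_getElem]
      refine Det.le (Det.seq (T₁ := 3) (T₂ := 1) (Q := fun m'' => Keeps m₀ m'' ∧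
        (m'' Side.pub).nv 12 = i ∧ (m'' Side.pub).nv 13 = r ∧
        (m'' Side.pub).rv 1 = dsq V (l.take (r + 1)).toFinset i) ?_ ?_) (by norm_num)
      · refine Det.le (Det.ite (T₁ := 1) (T₂ := 2) ?_ ?_) (by norm_num)
        · intro ht
          have hr0 : r = 0 := by simpa [Test.Holds, NExp.eval, g3] using ht
          refine Det.setRV ⟨g1.setRV (by norm_num), ?_, ?_, ?_⟩
          · simp [Store.setRV, g2]
          · simp [Store.setRV, g3]
          · rw [hins]
            simp [Store.setRV, RExp.eval, g5, hr0, dsq_singleton]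
        · intro ht
          have hr0 : r ≠ 0 := by simpa [Test.Holds, NExp.eval, g3] using ht
          have hne : (l.take r).toFinset.Nonempty := by
            simp [hr0]; exact hx
          rw [h4 (by omega)] at g4
          rw [hins, dsq_insert V hne]
          refine Det.le (Det.ite (T₁ := 1) (T₂ := 1) ?_ ?_) (by norm_num)
          · intro ht
            have hlt : dist (V i) (V l[r]) ^ 2 < dsq V (l.take r).toFinset i := by
              simpa [Test.Holds, RExp.eval, g4, g5] using ht
            refine Det.setRV ⟨g1.setRV (by norm_num), ?_, ?_, ?_⟩
            · simp [Store.setRV, g2]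
            · simp [Store.setRV, g3]
            · simp [Store.setRV, RExp.eval, g5, hlt.le]
          · intro ht
            have hlt : dsq V (l.take r).toFinset i ≤ dist (V i) (V l[r]) ^ 2 := by
              simpa [Test.Holds, RExp.eval, g4, g5] using ht
            exact Det.skip ⟨g1, g2, g3, by rw [g4, min_eq_right hlt]⟩
      · rintro m'' ⟨k1, k2, k3, k4⟩
        refine Det.setNV ⟨k1.setNV (by norm_num), ?_, ?_, fun _ => ?_⟩
        · simp [Store.setNV, k2]
        · simp [Store.setNV, NExp.eval, k3]
        · simp [Store.setNV, k4]
  · simp [Store.setNV, h12]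
  · simp [Store.setNV, NExp.eval]
  · simp
  · rintro m' ⟨g1, g2, -, g4⟩
    refine ⟨g1, g2, ?_⟩
    rw [g4 (List.length_pos_iff.2 hx), List.take_length]
  · simp [hl]

/-- Draw a uniformly distributed index. -/
def uniformCmd : Cmd := drawIndex Side.pub (fun e => RExp.ofNat e) (NExp.var Side.pub 0)

theorem Sim.uniformCmd {env : SQOp → Cmd} (hN : 0 < N) {U : PMF (Fin N)}
    (hU : ∀ i, (U i).toReal = 1 / N) {m : Mem} (h0 : (m Side.pub).nv 0 = N) :
    Sim env uniformCmd m (Nat.clog 2 N * 8 + 7) U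
      (fun i m' => Keeps m m' ∧ (m' Side.pub).nv 5 = i) := by
  refine Sim.conseq (Sim.drawIndex (p := fun n => (n : ℝ)) Nat.mono_cast hN
    (by exact_mod_cast hN) (fun i => ?_) m ?_ ?_) ?_
  · rw [hU]; simp
  · intro m' _ x _
    simp [RExp.eval, NExp.eval]
  · intro m' hm'
    simp only [NExp.eval]
    rw [hm'.nv (by norm_num), h0]
  · rintro i - m' ⟨m'', h1, rfl⟩
    exact ⟨h1.keeps.setNV (by norm_num), by simp [Store.setNV]⟩

/-- Draw an index from the mixture of the uniform law and the law of the row sampling. -/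
def proposeCmd : Cmd :=
  Cmd.seq (Cmd.flip Side.pub 11 (RExp.sub (RExp.ofNat (NExp.lit 1))
      (RExp.div (RExp.mul (RExp.ofNat (NExp.var Side.pub 0)) (RExp.var Side.pub 22))
        (RExp.var Side.pub 23))))
    (Cmd.ite (Test.neq (NExp.var Side.pub 11) (NExp.lit 1)) (Cmd.call SQOp.sampleRow) uniformCmd)

theorem Sim.proposeCmd {k : ℕ} {z Z M : ℝ} {x : SeedState N} {m : Mem}
    (h : Represents V k z Z M x m) (hA : centered V ≠ 0) (hz : 0 ≤ z)
    (hZ : Z = ∑ i, ‖centered V i‖ ^ 2 + N * z) {U Q : PMF (Fin N)}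
    (hU : ∀ i, (U i).toReal = 1 / N) (hQ : ∀ i, (Q i).toReal = (‖centered V i‖ ^ 2 + z) / Z) :
    Sim sqEnv proposeCmd m (Nat.clog 2 N * 8 + 11) Q
      (fun i m' => Keeps m m' ∧ (m' Side.pub).nv 5 = i) := by
  obtain ⟨i₁, hi₁⟩ := Function.ne_iff.1 hA
  have hN : 0 < N := i₁.pos
  have hN' : (0 : ℝ) < N := by exact_mod_cast hN
  have hs : 0 < ∑ l, ‖centered V l‖ ^ 2 :=
    Finset.sum_pos' (fun _ _ => sq_nonneg _) ⟨i₁, Finset.mem_univ _, pow_pos (norm_pos_iff.2 hi₁) 2⟩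
  have hZ0 : 0 < Z := by rw [hZ]; positivity
  obtain ⟨hI, ⟨h0, -⟩, -, -, -, h22, h23, -⟩ := h
  set A : PMF (Fin N) := weightedPMF (fun i => ‖centered V i‖ ^ 2 / ∑ l, ‖centered V l‖ ^ 2)
    (fun i => by positivity) (by rw [← Finset.sum_div, div_self hs.ne']) with hAdef
  have hq : 1 - N * z / Z = (∑ l, ‖centered V l‖ ^ 2) / Z := by
    rw [eq_div_iff hZ0.ne', sub_mul, div_mul_cancel₀ _ hZ0.ne']; linarith
  -- Row sampling with weight (∑ ‖a_l‖²)/Z and the uniform law with weight N z/Z together give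
  -- (‖a_i‖² + z)/Z.
  have hmix : Q = (coin (1 - N * z / Z)).bind (fun o => if o then A else U) := by
    refine PMF.ext_toReal fun i => ?_
    have h1 : (0 : ℝ) ≤ N * z / Z := by positivity
    have h2 : 0 ≤ (∑ l, ‖centered V l‖ ^ 2) / Z := by positivity
    rw [coin_bind_toReal (by rw [hq]; exact h2) (by linarith), hQ]
    simp only [if_true, Bool.false_eq_true, if_false, hU, sub_sub_cancel]
    rw [hq, hAdef, weightedPMF_toReal]
    field_simp
  rw [hmix]
  refine Sim.le (Sim.seq (T₁ := 1) (T₂ := Nat.clog 2 N * 8 + 9)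
    (R := fun o m' => Keeps m m' ∧ (m' Side.pub).nv 11 = if o then 1 else 0) ?_ ?_) (by omega)
  · have hf := Sim.flip (env := sqEnv) (s := Side.pub) (x := 11) (m := m)
        (p := RExp.sub (RExp.ofNat (NExp.lit 1))
          (RExp.div (RExp.mul (RExp.ofNat (NExp.var Side.pub 0)) (RExp.var Side.pub 22))
          (RExp.var Side.pub 23)))
        (R := fun o m' => Keeps m m' ∧ (m' Side.pub).nv 11 = if o then 1 else 0) (fun o =>
          ⟨(Keeps.refl m).setNV (by norm_num), by simp [Store.setNV]⟩)
    simpa [RExp.eval, NExp.eval, h0, h22, h23] using hf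
  · rintro o - m' ⟨h1, h2⟩
    have h0' : (m' Side.pub).nv 0 = N := by rw [h1.1 0 (by norm_num), h0]
    refine Sim.le (Sim.ite (T₁ := Nat.clog 2 N * 8 + 8) (T₂ := Nat.clog 2 N * 8 + 7) ?_ ?_)
      (by rw [max_eq_left (by omega)])
    · intro ht
      have ho : o = true := by
        by_contra hne
        simp [Test.Holds, NExp.eval, h2, hne] at ht
      subst ho
      rw [if_pos rfl]
      refine Sim.conseq (Sim.call (Sim.sampleRow V hA (fun i => weightedPMF_toReal _ _ _ i) m'
        (hI.congr h1.2.2.2) h0')) ?_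
      rintro i - m'' ⟨k1, k2⟩
      refine ⟨h1.trans ⟨fun x hx => ?_, fun x hx => ?_, ?_, k2⟩, ?_⟩
      · rw [k1]
        simp only [Store.setNV]
        exact Function.update_of_ne (by omega) _ _
      · rw [k1]; rfl
      · rw [k1]; rfl
      · rw [k1]; simp [Store.setNV]
    · intro ht
      have ho : o = false := by
        by_contra hne
        simp [Test.Holds, NExp.eval, h2, hne] at ht
      subst ho
      rw [if_neg (by simp)]
      refine Sim.conseq (Sim.uniformCmd hN hU h0') ?_
      rintro i - m'' ⟨k1, k2⟩
      exact ⟨h1.trans k1, k2⟩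

/-- Accept or reject the proposal. -/
def acceptCmd : Cmd :=
  Cmd.seq (Cmd.setNV Side.pub 3 (NExp.var Side.pub 12))
  (Cmd.seq (Cmd.call SQOp.rowNorm)
  (Cmd.seq (Cmd.setRV Side.pub 20 (RExp.sub (RExp.var Side.pub 20) (RExp.var Side.pub 21)))
  (Cmd.seq (Cmd.flip Side.pub 11 (RExp.div (RExp.var Side.pub 1)
      (RExp.mul (RExp.ofNat (NExp.lit 2)) (RExp.add
        (RExp.mul (RExp.var Side.pub 0) (RExp.var Side.pub 0)) (RExp.var Side.pub 22)))))
    (Cmd.ite (Test.neq (NExp.var Side.pub 11) (NExp.lit 1))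
      (Cmd.seq (Cmd.setNA Side.pub 0 (NExp.lit 0) (NExp.var Side.pub 20) (NExp.var Side.pub 12))
      (Cmd.seq (Cmd.setNV Side.pub 20 (NExp.add (NExp.var Side.pub 20) (NExp.lit 1)))
        (Cmd.setRV Side.pub 21 (RExp.ofNat (NExp.lit 0)))))
      Cmd.skip))))

theorem Sim.acceptCmd {k : ℕ} {z Z M : ℝ} {x : SeedState N} {m : Mem} {i : Fin N}
    (h : Represents V k z Z M x m) (h12 : (m Side.pub).nv 12 = i)
    (h1 : (m Side.pub).rv 1 = dsq V x.centers.toFinset i) :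
    Sim sqEnv acceptCmd m 15 ((coin (acceptProb V z x.centers i)).map fun o =>
      if o then ⟨x.centers ++ [i], 0, x.fuel - x.charge⟩
      else ⟨x.centers, x.charge, x.fuel - x.charge⟩) (Represents V k z Z M) := by
  obtain ⟨hI, ⟨h0, hd, hk, h20⟩, hna, g20, g21, g22, g23, g24⟩ := h
  refine Sim.setNV_seq (T := 13) <| Sim.rowNorm_seq (T := 10) <| Sim.setRV_seq (T := 8) ?_
  set m₁ := ((m.upd Side.pub ((m Side.pub).setNV 3 (NExp.eval m (NExp.var Side.pub 12))))) with hm₁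
  set v := Real.sqrt ((m₁ Side.hid).ra 1 ((m₁ Side.pub).nv 3) ((m₁ Side.pub).nv 1)) with hv
  have hv' : v = ‖centered V i‖ := by
    simp [hv, hm₁, Store.setNV, NExp.eval, h12, hd, hI.2.1 i i.2 d le_rfl, ← norm_centered_sq]
  clear_value v
  clear hv
  set m₂ := m₁.upd Side.pub ((m₁ Side.pub).setRV 0 v) with hm₂
  set m₃ := m₂.upd Side.pub ((m₂ Side.pub).setRV 20
    (RExp.eval m₂ (RExp.sub (RExp.var Side.pub 20) (RExp.var Side.pub 21)))) with hm₃
  have hR : Represents V k z Z M ⟨x.centers, x.charge, x.fuel - x.charge⟩ m₃ ∧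
      (m₃ Side.pub).nv 12 = i ∧ (m₃ Side.pub).rv 1 = dsq V x.centers.toFinset i ∧
      (m₃ Side.pub).rv 0 = ‖centered V i‖ := by
    refine ⟨⟨?_, ⟨?_, ?_, ?_, ?_⟩, ?_, ?_, ?_, ?_, ?_, ?_⟩, ?_, ?_, ?_⟩ <;>
      simp [Store.setNV, Store.setRV, RExp.eval, *]
    exact hna
  clear_value m₃
  clear hm₃ m₂ hm₂ m₁ hm₁ hI h0 hd hk h20 hna g20 g21 g22 g23 g24 h12 h1 hv' v
  obtain ⟨hR, h12, h1, h0⟩ := hR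
  have hf := Sim.flip (env := sqEnv) (s := Side.pub) (x := 11) (m := m₃)
    (p := RExp.div (RExp.var Side.pub 1)
      (RExp.mul (RExp.ofNat (NExp.lit 2)) (RExp.add
        (RExp.mul (RExp.var Side.pub 0) (RExp.var Side.pub 0)) (RExp.var Side.pub 22))))
    (R := fun o m' => (Represents V k z Z M ⟨x.centers, x.charge, x.fuel - x.charge⟩ m' ∧
      (m' Side.pub).nv 12 = i) ∧ (m' Side.pub).nv 11 = if o then 1 else 0)
    (fun o => ⟨⟨hR.keeps ((Keeps.refl m₃).setNV (by norm_num)), by simp [Store.setNV, h12]⟩,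
      by simp [Store.setNV]⟩)
  have he : RExp.eval m₃ (RExp.div (RExp.var Side.pub 1)
      (RExp.mul (RExp.ofNat (NExp.lit 2)) (RExp.add
        (RExp.mul (RExp.var Side.pub 0) (RExp.var Side.pub 0)) (RExp.var Side.pub 22)))) =
      acceptProb V z x.centers i := by
    simp only [RExp.eval, NExp.eval, h1, h0, hR.2.2.2.2.2.1, acceptProb]
    norm_num [sq]
  rw [he] at hf
  rw [← PMF.bind_pure_comp]
  refine Sim.le (Sim.seq (T₂ := 6) hf ?_) (by norm_num)
  rintro o - m' ⟨⟨hR, h12⟩, h11⟩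
  obtain ⟨hI, ⟨h0, hd, hk, h20⟩, hna, g20, g21, g22, g23, g24⟩ := hR
  refine Det.sim (Det.le (Det.ite (T₁ := 5) (T₂ := 1) ?_ ?_) (by norm_num))
  · intro ht
    have ho : o = true := by
      by_contra hne
      simp [Test.Holds, NExp.eval, h11, hne] at ht
    subst ho
    refine Sim.setNA_seq (T := 3) <| Sim.setNV_seq (T := 1) <| Det.setRV ?_
    refine ⟨?_, ⟨?_, ?_, ?_, ?_⟩, ?_, ?_, ?_, ?_, ?_, ?_⟩ <;>
      simp [Store.setNV, Store.setRV, Store.setNA, RExp.eval, NExp.eval, *]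
    intro r hr
    rcases hr.lt_or_eq with h | h
    · rw [Function.update_of_ne h.ne, List.getElem_append_left h, hna r h]
    · subst h
      simp
  · intro ht
    have ho : o = false := by
      by_contra hne
      simp [Test.Holds, NExp.eval, h11, hne] at ht
    subst ho
    exact Det.skip ⟨hI, ⟨h0, hd, hk, h20⟩, hna, g20, g21, g22, g23, g24⟩

/-- One round of the seeding. -/
def roundCmd : Cmd :=
  Cmd.seq (Cmd.ite (Test.rlt (RExp.ofNat (NExp.lit 0)) (RExp.var Side.pub 21))
    proposeCmd uniformCmd)
  (Cmd.seq (Cmd.setNV Side.pub 12 (NExp.var Side.pub 5))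
  (Cmd.seq nearestCmd
  (Cmd.ite (Test.rlt (RExp.ofNat (NExp.lit 0)) (RExp.var Side.pub 21))
    acceptCmd
    (Cmd.seq (Cmd.setRV Side.pub 21 (RExp.var Side.pub 1))
      (Cmd.setRV Side.pub 20 (RExp.sub (RExp.var Side.pub 20) (RExp.var Side.pub 24)))))))

/-- A bound for the running time of `roundCmd`. -/
def roundTime (N d k : ℕ) : ℕ := Nat.clog 2 N * 8 + k * (d * 19 + 14) + 36

/-- Whether the charge is fixed or not, a round consists of one draw by binary search and one D²
computation against at most `k` centers with O(d) entries each. -/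
theorem Sim.roundCmd {k : ℕ} {z Z M : ℝ} {x : SeedState N} {m : Mem}
    (h : Represents V k z Z M x m) (hx : x.centers ≠ []) (hxk : x.centers.length ≤ k)
    (hA : centered V ≠ 0) (hz : 0 ≤ z)
    (hZ : Z = ∑ i, ‖centered V i‖ ^ 2 + N * z) {U Q : PMF (Fin N)}
    (hU : ∀ i, (U i).toReal = 1 / N) (hQ : ∀ i, (Q i).toReal = (‖centered V i‖ ^ 2 + z) / Z) :
    Sim sqEnv roundCmd m (roundTime N d k) (seedStep V U Q z M x) (Represents V k z Z M) := by
  have hN : 0 < N := by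
    obtain ⟨i, -⟩ := Function.ne_iff.1 hA
    exact i.pos
  have htest : ∀ m', Represents V k z Z M x m' →
      ((Test.rlt (RExp.ofNat (NExp.lit 0)) (RExp.var Side.pub 21)).Holds m' ↔ 0 < x.charge) := by
    intro m' hm'
    simp [Test.Holds, RExp.eval, NExp.eval, hm'.2.2.2.2.1]
  rw [seedStep]
  refine Sim.le (Sim.seq (T₁ := Nat.clog 2 N * 8 + 12) (T₂ := k * (d * 19 + 14) + 22)
    (R := fun (i : Fin N) m' => Keeps m m' ∧ (m' Side.pub).nv 5 = i) ?_ ?_) (by rw [roundTime]; omega)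
  · refine Sim.le (Sim.ite (T₁ := Nat.clog 2 N * 8 + 11) (T₂ := Nat.clog 2 N * 8 + 7)
      (fun ht => ?_) (fun ht => ?_)) (by rw [max_eq_left (by omega)])
    · rw [if_pos ((htest m h).1 ht)]
      exact Sim.proposeCmd h hA hz hZ hU hQ
    · rw [if_neg fun h' => ht ((htest m h).2 h')]
      exact Sim.uniformCmd hN hU h.2.1.1
  rintro i - m₁ ⟨h1, h5⟩
  refine Sim.setNV_seq (T := k * (d * 19 + 14) + 20) ?_
  have hlen : x.centers.length * (d * 19 + 14) ≤ k * (d * 19 + 14) := Nat.mul_le_mul_right _ hxk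
  refine Sim.le (Sim.det_seq (T₂ := 16) (Det.nearestCmd (i := i) h hx
    (h1.setNV (by norm_num)) (by simp [Store.setNV, NExp.eval, h5])) ?_) (by omega)
  rintro m₂ ⟨h2, h12, hr1⟩
  have hR := h.keeps h2
  refine Sim.le (Sim.ite (T₁ := 15) (T₂ := 3) (fun ht => ?_) (fun ht => ?_)) (by norm_num)
  · rw [seedUpdate, if_pos ((htest m₂ hR).1 ht)]
    exact Sim.acceptCmd hR h12 hr1
  · rw [seedUpdate, if_neg fun h' => ht ((htest m₂ hR).2 h')]
    refine Det.sim (Sim.setRV_seq (T := 1) (Det.setRV ?_))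
    obtain ⟨hI, ⟨h0, hd, hk, h20⟩, hna, g20, g21, g22, g23, g24⟩ := hR
    refine ⟨?_, ⟨?_, ?_, ?_, ?_⟩, ?_, ?_, ?_, ?_, ?_, ?_⟩ <;>
      simp [Store.setRV, RExp.eval, *]
    exact hna

end data

end

/-! ### The whole seeding program and its output law -/

noncomputable section

/-- Compute the parameters of the rejection sampling from the first center. -/
def prepareCmd : Cmd :=
  Cmd.seq (Cmd.setNA Side.pub 0 (NExp.lit 0) (NExp.lit 0) (NExp.var Side.pub 5))
  (Cmd.seq (Cmd.setNV Side.pub 3 (NExp.var Side.pub 5))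
  (Cmd.seq (Cmd.call SQOp.rowNorm)
  (Cmd.seq (Cmd.setRV Side.pub 22 (RExp.mul (RExp.var Side.pub 0) (RExp.var Side.pub 0)))
  (Cmd.seq (Cmd.call SQOp.frobNorm)
  (Cmd.seq (Cmd.setRV Side.pub 23 (RExp.add (RExp.mul (RExp.var Side.pub 0) (RExp.var Side.pub 0))
    (RExp.mul (RExp.ofNat (NExp.var Side.pub 0)) (RExp.var Side.pub 22))))
  (Cmd.seq (Cmd.setRV Side.pub 24 (RExp.div (RExp.var Side.pub 23)
    (RExp.ofNat (NExp.var Side.pub 0))))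
  (Cmd.seq (Cmd.setRV Side.pub 20 (RExp.ofNat (NExp.lit 0)))
  (Cmd.seq (Cmd.setNV Side.pub 20 (NExp.lit 1))
  (Cmd.seq (Cmd.loop (Test.nlt (NExp.var Side.pub 20) (NExp.var Side.pub 2))
    (Cmd.seq (Cmd.setRV Side.pub 20 (RExp.add (RExp.var Side.pub 20)
        (RExp.div (RExp.ofNat (NExp.lit 1)) (RExp.sub (RExp.ofNat (NExp.var Side.pub 0))
          (RExp.ofNat (NExp.var Side.pub 20))))))
      (Cmd.setNV Side.pub 20 (NExp.add (NExp.var Side.pub 20) (NExp.lit 1)))))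
  (Cmd.seq (Cmd.setRV Side.pub 20 (RExp.mul (RExp.mul (RExp.ofNat (NExp.lit 300))
    (RExp.var Side.pub 23)) (RExp.var Side.pub 20)))
  (Cmd.seq (Cmd.setRV Side.pub 21 (RExp.ofNat (NExp.lit 0)))
    (Cmd.setNV Side.pub 20 (NExp.lit 1)))))))))))))

/-- The seeding algorithm. -/
def seedCmd : Cmd :=
  Cmd.seq uniformCmd
  (Cmd.seq prepareCmd
  (Cmd.seq (Cmd.loop (Test.rlt (RExp.ofNat (NExp.lit 0)) (RExp.mul (RExp.var Side.pub 20)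
      (RExp.ofNat (NExp.sub (NExp.var Side.pub 2) (NExp.var Side.pub 20))))) roundCmd)
    (Cmd.ite (Test.neq (NExp.var Side.pub 20) (NExp.var Side.pub 2))
      (Cmd.setNV Side.pub 6 (NExp.lit 1)) (Cmd.setNV Side.pub 6 (NExp.lit 0)))))

theorem seedCmd_isPublic : seedCmd.IsPublic := by
  simp [seedCmd, prepareCmd, roundCmd, uniformCmd, proposeCmd, nearestCmd, pairDistCmd, acceptCmd,
    drawIndex, descend, Cmd.IsPublic, RExp.IsPublic, NExp.IsPublic, Test.IsPublic]

section data

variable {N d : ℕ} (V : Fin N → EuclideanSpace ℝ (Fin d))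

/-- The normalization of the proposal law, given the first center. -/
def proposalMass (i : Fin N) : ℝ := ∑ l, ‖centered V l‖ ^ 2 + N * ‖centered V i‖ ^ 2

/-- The fuel, given the first center. -/
def initialFuel (k : ℕ) (i : Fin N) : ℝ :=
  300 * proposalMass V i * ∑ r ∈ Finset.Ico 1 k, 1 / ((N : ℝ) - r)

variable {V}

theorem Det.prepareCmd {k : ℕ} {i : Fin N} {m : Mem} (hk : 1 ≤ k)
    (hI : SQInv (dataArr V) N d (m Side.hid)) (h0 : (m Side.pub).nv 0 = N)
    (h1 : (m Side.pub).nv 1 = d) (h2 : (m Side.pub).nv 2 = k) (h5 : (m Side.pub).nv 5 = i) :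
    Det sqEnv prepareCmd m (5 * k + 22) (Represents V k (‖centered V i‖ ^ 2) (proposalMass V i)
      (proposalMass V i / N) ⟨[i], 0, initialFuel V k i⟩) := by
  have hrow : (m Side.hid).ra 1 i d = ‖centered V i‖ ^ 2 := by
    rw [hI.2.1 i i.2 d le_rfl, ← norm_centered_sq]
  have hfrob : (m Side.hid).ra 2 0 N = ∑ l, ‖centered V l‖ ^ 2 := by
    rw [hI.2.2 N le_rfl, ← sum_norm_centered_sq]
  have hs : Real.sqrt (∑ l, ‖centered V l‖ ^ 2) * Real.sqrt (∑ l, ‖centered V l‖ ^ 2) =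
      ∑ l, ‖centered V l‖ ^ 2 := Real.mul_self_sqrt (Finset.sum_nonneg fun _ _ => sq_nonneg _)
  have hI' := hI
  obtain ⟨g0, g1, g2⟩ := hI'
  refine Sim.le (Sim.setNA_seq <| Sim.setNV_seq <| Sim.rowNorm_seq <| Sim.setRV_seq <|
    Sim.det_seq (T₁ := 2) (T₂ := 5 * (k - 1) + 15) (Q := fun m' =>
      SQInv (dataArr V) N d (m' Side.hid) ∧ ((m' Side.pub).nv 0 = N ∧ (m' Side.pub).nv 1 = d ∧
      (m' Side.pub).nv 2 = k) ∧ (m' Side.pub).na 0 0 0 = i ∧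
      (m' Side.pub).rv 22 = ‖centered V i‖ ^ 2 ∧
      (m' Side.pub).rv 0 = Real.sqrt (∑ l, ‖centered V l‖ ^ 2))
    (Det.call (T := 1) (Det.setRV ?_)) ?_) (by omega)
  · refine ⟨?_, ⟨?_, ?_, ?_⟩, ?_, ?_, ?_⟩ <;>
      simp [Store.setNV, Store.setRV, Store.setNA, RExp.eval, NExp.eval, h0, h1, h2, h5, hrow,
        hfrob, hI]
    ring
  clear hrow hfrob h0 h1 h2 h5 hI g0 g1 g2 m
  rintro m ⟨hI, ⟨h0, h1, h2⟩, ha, h22, hr0⟩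
  -- The variables `20` serve twice: here the integer one counts r and the real one accumulates ∑
  -- 1/(N - r); afterwards they hold the number of centers and the fuel.
  refine Sim.le (Sim.setRV_seq <| Sim.setRV_seq <| Sim.setRV_seq <| Sim.setNV_seq <|
    Sim.det_seq (T₁ := (k - 1) * 5 + 1) (T₂ := 5) (Q := fun m' => ((SQInv (dataArr V) N d (m' Side.hid) ∧
      ((m' Side.pub).nv 0 = N ∧ (m' Side.pub).nv 1 = d ∧
      (m' Side.pub).nv 2 = k) ∧ (m' Side.pub).na 0 0 0 = i ∧
      (m' Side.pub).rv 22 = ‖centered V i‖ ^ 2 ∧ (m' Side.pub).rv 23 = proposalMass V i ∧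
      (m' Side.pub).rv 24 = proposalMass V i / N) ∧ (m' Side.pub).nv 20 = k ∧
      (m' Side.pub).rv 20 = ∑ r ∈ Finset.Ico 1 k, 1 / ((N : ℝ) - r) ∧ 1 ≤ k))
    (Det.loop (T := 3) (fun q m' => (SQInv (dataArr V) N d (m' Side.hid) ∧
      ((m' Side.pub).nv 0 = N ∧ (m' Side.pub).nv 1 = d ∧
      (m' Side.pub).nv 2 = k) ∧ (m' Side.pub).na 0 0 0 = i ∧
      (m' Side.pub).rv 22 = ‖centered V i‖ ^ 2 ∧ (m' Side.pub).rv 23 = proposalMass V i ∧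
      (m' Side.pub).rv 24 = proposalMass V i / N) ∧ (m' Side.pub).nv 20 = q ∧
      (m' Side.pub).rv 20 = ∑ r ∈ Finset.Ico 1 q, 1 / ((N : ℝ) - r) ∧ 1 ≤ q) k ?_ ?_ 1 hk ?_) ?_) ?_
  · rintro q m - ⟨⟨-, ⟨-, -, h2⟩, -⟩, h20, -⟩
    simp [Test.Holds, NExp.eval, h2, h20]
  · rintro q m hq ⟨⟨hI, ⟨h0, h1, h2⟩, ha, h22, h23, h24⟩, h20, hr, hq1⟩
    refine Sim.setRV_seq (T := 1) <| Det.setNV ?_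
    refine ⟨⟨?_, ⟨?_, ?_, ?_⟩, ?_, ?_, ?_, ?_⟩, ?_, ?_, ?_⟩ <;>
      simp [Store.setNV, Store.setRV, RExp.eval, NExp.eval, Finset.sum_Ico_succ_top hq1, *]
  · refine ⟨⟨?_, ⟨?_, ?_, ?_⟩, ?_, ?_, ?_, ?_⟩, ?_, ?_, ?_⟩ <;>
      simp [Store.setNV, Store.setRV, RExp.eval, NExp.eval, h0, h1, h2, ha, h22, hr0, hs, hI,
        proposalMass]
  · rintro m ⟨⟨hI, ⟨h0, h1, h2⟩, ha, h22, h23, h24⟩, h20, hr, -⟩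
    refine Sim.setRV_seq (T := 3) <| Sim.setRV_seq (T := 1) <| Det.setNV ?_
    refine ⟨?_, ⟨?_, ?_, ?_, ?_⟩, ?_, ?_, ?_, ?_, ?_, ?_⟩ <;>
      simp [Store.setNV, Store.setRV, RExp.eval, NExp.eval, h0, h1, h2, ha, h22, hI, h23, h24, hr,
        initialFuel]
  · omega

variable (V)

/-- The proposal law, given the first center. -/
def proposalPMF (U : PMF (Fin N)) (i₀ : Fin N) : PMF (Fin N) :=
  if h : 0 < proposalMass V i₀ then
    weightedPMF (fun i => (‖centered V i‖ ^ 2 + ‖centered V i₀‖ ^ 2) / proposalMass V i₀)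
      (fun i => by positivity) (by
        rw [← Finset.sum_div, Finset.sum_add_distrib, Finset.sum_const, Finset.card_univ,
          Fintype.card_fin, nsmul_eq_mul]
        exact div_self h.ne')
  else U

/-- The law of the final state of the seeding. -/
def seedLaw (k n : ℕ) (U : PMF (Fin N)) : PMF (SeedState N) :=
  U.bind fun i => chain (unfinished k) (seedStep V U (proposalPMF V U i) (‖centered V i‖ ^ 2)
    (proposalMass V i / N)) n ⟨[i], 0, initialFuel V k i⟩

variable {V}

theorem proposalPMF_toReal {U : PMF (Fin N)} {i₀ : Fin N} (h : 0 < proposalMass V i₀) (i : Fin N) :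
    (proposalPMF V U i₀ i).toReal =
      (‖centered V i‖ ^ 2 + ‖centered V i₀‖ ^ 2) / proposalMass V i₀ := by
  rw [proposalPMF, dif_pos h, weightedPMF_toReal]

/-- The output that belongs to a final list of centers. -/
def listOutput (k : ℕ) (l : List (Fin N)) : Option (Fin k → Fin N) :=
  if h : l.length = k then some fun t => l[(t : ℕ)]'(h ▸ t.2) else none

theorem listOutput_eq_some {k : ℕ} (l : List (Fin N)) (s : Fin k → Fin N) :
    listOutput k l = some s ↔ l = List.ofFn s := by
  unfold listOutput
  constructor
  · intro h
    split_ifs at h with hl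
    refine List.ext_getElem (by simp [hl]) fun t h1 h2 => ?_
    have := congrFun (Option.some.inj h) ⟨t, hl ▸ h1⟩
    simpa using this
  · rintro rfl
    simp

theorem centered_ne_zero (hV : Function.Injective V) (hN : 2 ≤ N) : centered V ≠ 0 := by
  intro h
  have h1 := congrFun h ⟨1, hN⟩
  simp only [centered, Pi.zero_apply, sub_eq_zero] at h1
  have := hV h1
  simp at this

theorem proposalMass_pos (hV : Function.Injective V) (hN : 2 ≤ N) (i : Fin N) :
    0 < proposalMass V i := by
  obtain ⟨j, hj⟩ := Function.ne_iff.1 (centered_ne_zero hV hN)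
  have : 0 < ∑ l, ‖centered V l‖ ^ 2 := Finset.sum_pos' (fun _ _ => sq_nonneg _)
    ⟨j, Finset.mem_univ _, pow_pos (norm_pos_iff.2 hj) 2⟩
  unfold proposalMass
  positivity

/-- A bound for the running time of `seedCmd` with at most `n` rounds. -/
def seedTime (N d k n : ℕ) : ℕ := Nat.clog 2 N * 8 + 5 * k + n * (roundTime N d k + 2) + 37

/-- The variant of the main loop is fuel ≤ n c: a round spends either M or a positive charge, and a
positive charge is the squared distance of two different points. -/
theorem Sim.seedCmd {k n : ℕ} {c : ℝ} (hV : Function.Injective V) (hk : 1 ≤ k) (hkN : k ≤ N)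
    (hcM : 2 ≤ k → ∀ i, c ≤ proposalMass V i / N)
    (hcd : 2 ≤ k → ∀ i j, i ≠ j → c ≤ dist (V i) (V j) ^ 2)
    (hn : ∀ i, initialFuel V k i ≤ n * c) {U : PMF (Fin N)} (hU : ∀ i, (U i).toReal = 1 / N)
    {m : Mem} (hI : SQInv (dataArr V) N d (m Side.hid)) (h0 : (m Side.pub).nv 0 = N)
    (h1 : (m Side.pub).nv 1 = d) (h2 : (m Side.pub).nv 2 = k) :
    Sim sqEnv seedCmd m (seedTime N d k n) (seedLaw V k n U)
      (fun x m' => readOutput N k m' = listOutput k x.centers) := by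
  refine Sim.le (Sim.seq (T₂ := 5 * k + n * (roundTime N d k + 2) + 29)
    (R := fun (i : Fin N) m' => Keeps m m' ∧ (m' Side.pub).nv 5 = i)
    (Sim.uniformCmd (by omega) hU h0) ?_) (by rw [seedTime]; omega)
  rintro i₀ - m₁ ⟨hK, h5⟩
  refine Sim.le (Sim.det_seq (T₂ := n * (roundTime N d k + 2) + 4) (Det.prepareCmd hk
    (hI.congr hK.2.2.2) (by rw [hK.1 _ (by norm_num), h0]) (by rw [hK.1 _ (by norm_num), h1])
    (by rw [hK.1 _ (by norm_num), h2]) h5) ?_) (by omega)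
  intro m₂ hm₂
  refine Sim.le (Sim.seq_det (T₂ := 2) (Sim.loop (T := roundTime N d k)
    (fun n x => x.fuel ≤ n * c ∧ i₀ ∈ x.centers ∧ (0 < x.charge → 2 ≤ k → c ≤ x.charge))
    (R := Represents V k (‖centered V i₀‖ ^ 2) (proposalMass V i₀) (proposalMass V i₀ / N))
    ?_ ?_ ?_ ?_ n _ m₂ ⟨hn i₀, List.mem_singleton.2 rfl, fun h => absurd h (lt_irrefl _)⟩ hm₂)
    ?_) (by omega)
  · rintro x m ⟨-, ⟨-, -, h2, h20⟩, -, hf, -⟩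
    -- The test language has no conjunction. The product of the fuel and the truncated, hence
    -- nonnegative, number of missing centers is positive exactly if both factors are.
    simp only [Test.Holds, RExp.eval, NExp.eval, h2, h20, hf, unfinished, Nat.cast_zero]
    constructor
    · intro h
      have hk0 : (0 : ℝ) ≤ ((k - x.centers.length : ℕ) : ℝ) := Nat.cast_nonneg _
      have hf0 : 0 < x.fuel := by
        by_contra hf
        exact absurd h (not_lt.2 (mul_nonpos_of_nonpos_of_nonneg (not_lt.1 hf) hk0))
      have := (mul_pos_iff_of_pos_left hf0).1 h
      have : 0 < k - x.centers.length := by exact_mod_cast this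
      exact ⟨by omega, hf0⟩
    · rintro ⟨h, hf0⟩
      have : 0 < k - x.centers.length := by omega
      exact mul_pos hf0 (by exact_mod_cast this)
  · rintro x ⟨h, -⟩ ⟨-, h'⟩
    rw [Nat.cast_zero, zero_mul] at h
    exact absurd h' (not_lt.2 h)
  · rintro n x ⟨hf, hi, hX⟩ ⟨hlen, -⟩ y hy
    have hpos : 0 < x.centers.length := List.length_pos_of_mem hi
    -- A round starts with at least one and fewer than k centers, so the bounds on `c` apply.
    have hk2 : 2 ≤ k := by omega
    rw [seedStep, PMF.mem_support_bind_iff] at hy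
    obtain ⟨i, -, hy⟩ := hy
    rw [Nat.cast_succ] at hf
    by_cases hx : 0 < x.charge
    · have hXc := hX hx hk2
      rw [seedUpdate, if_pos hx, PMF.mem_support_map_iff] at hy
      obtain ⟨o, -, rfl⟩ := hy
      cases o
      · refine ⟨?_, hi, fun _ _ => hXc⟩
        simp only [Bool.false_eq_true, if_false]; linarith
      · refine ⟨?_, List.mem_append_left _ hi, fun h => absurd h (lt_irrefl _)⟩
        simp only [if_true]; linarith
    · rw [seedUpdate, if_neg hx, PMF.support_pure, Set.mem_singleton_iff] at hy
      subst hy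
      refine ⟨?_, hi, fun h _ => ?_⟩
      · have := hcM hk2 i₀
        simp only; linarith
      · obtain ⟨j, hj, e⟩ := exists_dsq_eq V (S := x.centers.toFinset)
          ⟨i₀, List.mem_toFinset.2 hi⟩ i
        simp only [e] at h ⊢
        refine hcd hk2 i j fun hij => ?_
        rw [hij, dist_self] at h
        simp at h
  · rintro n x m ⟨-, hi, -⟩ ⟨hlen, -⟩ hm
    have hpos : 0 < x.centers.length := List.length_pos_of_mem hi
    have hN : 2 ≤ N := by omega
    exact Sim.roundCmd hm (List.ne_nil_of_mem hi) hlen.le (centered_ne_zero hV hN) (by positivity)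
      rfl hU (proposalPMF_toReal (proposalMass_pos hV hN i₀))
  · rintro x - m₃ hm₃
    obtain ⟨-, ⟨-, -, g2, g20⟩, gna, -⟩ := hm₃
    refine Det.le (Det.ite (T₁ := 1) (T₂ := 1) (fun ht => ?_) (fun ht => ?_)) (by norm_num)
    · have hlen : x.centers.length = k := by simpa [Test.Holds, NExp.eval, g2, g20] using ht
      refine Det.setNV ?_
      have hlt : ∀ t : Fin k, (m₃ Side.pub).na 0 0 t < N := fun t => by
        rw [gna t (by rw [hlen]; exact t.2)]; exact Fin.is_lt _
      rw [readOutput, dif_pos ⟨by simp [Store.setNV, NExp.eval], by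
        simpa [Store.setNV] using hlt⟩, listOutput, dif_pos hlen]
      congr 1
      funext t
      ext
      simp [Store.setNV, gna t (by rw [hlen]; exact t.2)]
    · have hlen : x.centers.length ≠ k := by simpa [Test.Holds, NExp.eval, g2, g20] using ht
      refine Det.setNV ?_
      rw [readOutput, dif_neg (by simp [Store.setNV, NExp.eval]), listOutput, dif_neg hlen]

theorem PMF.map_apply_of_iff {α β : Type*} (p : PMF α) (f : α → β) (x : α) (y : β)
    (h : ∀ a, f a = y ↔ a = x) : (p.map f) y = p x := by
  classical
  rw [PMF.map_apply, tsum_eq_single x]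
  · rw [if_pos ((h x).2 rfl).symm]
  · intro a ha
    rw [if_neg fun e => ha ((h a).1 e.symm)]

/-- Only runs whose first center is `s 0` can end in `s`, so a single term of the average over the
first center survives. -/
theorem seedLaw_output {k n : ℕ} {U : PMF (Fin N)} (hU : ∀ i, (U i).toReal = 1 / N)
    (s : Fin (k + 1) → Fin N) :
    (((seedLaw V (k + 1) n U).map fun x => listOutput (k + 1) x.centers) (some s)).toReal =
      1 / N * endProb V (k + 1) U (proposalPMF V U (s 0)) (‖centered V (s 0)‖ ^ 2)
        (proposalMass V (s 0) / N) n ⟨[s 0], 0, initialFuel V (k + 1) (s 0)⟩ (List.ofFn s) := by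
  have e : ((seedLaw V (k + 1) n U).map fun x => listOutput (k + 1) x.centers) =
      ((seedLaw V (k + 1) n U).map SeedState.centers).map (listOutput (k + 1)) := by
    rw [PMF.map_comp]; rfl
  rw [e, PMF.map_apply_of_iff _ _ (List.ofFn s) _ fun l => listOutput_eq_some l s, seedLaw,
    PMF.map_bind, bind_toReal, Finset.sum_eq_single (s 0)]
  · rw [hU]; rfl
  · intro i _ hi
    have := endProb_eq_zero (V := V) (k := k + 1) (U := U) (Q := proposalPMF V U i)
      (M := proposalMass V i / N) (i₀ := i)
      (x := ⟨[i], 0, initialFuel V (k + 1) i⟩) (List.mem_singleton.2 rfl) (L := List.ofFn s)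
      (by
        rw [List.ofFn_succ, List.cons_prefix_cons]
        exact fun h => hi h.1) n
    rw [endProb] at this
    rw [this, mul_zero]
  · intro h; exact absurd (Finset.mem_univ _) h

theorem seedingProb_cons {k : ℕ} (s : Fin (k + 1) → Fin N) :
    seedingProb V s = 1 / N * seqProb V {s 0} (List.ofFn fun t : Fin k => s t.succ) := by
  rw [seedingProb_eq, List.ofFn_succ, seqProb, dsqProb, if_pos rfl, insert_empty_eq]

theorem seedLaw_output_bounds {k n : ℕ} {c : ℝ} (hV : Function.Injective V) (hk : 1 ≤ k)
    (hkN : k ≤ N) (hcM : 2 ≤ k → ∀ i, c ≤ proposalMass V i / N)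
    (hcd : 2 ≤ k → ∀ i j, i ≠ j → c ≤ dist (V i) (V j) ^ 2)
    (hn : ∀ i, initialFuel V k i ≤ n * c) {U : PMF (Fin N)} (hU : ∀ i, (U i).toReal = 1 / N)
    (s : Fin k → Fin N) :
    0.99 * seedingProb V s ≤
      (((seedLaw V k n U).map fun x => listOutput k x.centers) (some s)).toReal ∧
    (((seedLaw V k n U).map fun x => listOutput k x.centers) (some s)).toReal ≤
      seedingProb V s := by
  obtain ⟨r, rfl⟩ := Nat.exists_eq_add_of_le' hk
  have hN : (0 : ℝ) < N := by exact_mod_cast (s 0).pos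
  have hN' : (0 : ℝ) ≤ 1 / N := by positivity
  rw [seedLaw_output hU, seedingProb_cons]
  -- For a single center the seeding is over before any round.
  rcases Nat.eq_zero_or_pos r with rfl | hr
  · rw [endProb_of_not (Or.inr fun h => absurd h.1 (by simp))]
    simp only [List.ofFn_zero, List.ofFn_succ, seqProb, if_true]
    constructor <;> nlinarith
  have hZ := proposalMass_pos hV (by omega) (s 0)
  have hQ := proposalPMF_toReal (U := U) hZ
  have e : List.ofFn s = [s 0] ++ List.ofFn fun t : Fin r => s t.succ := by
    rw [List.ofFn_succ]; rfl
  have hsum : 0 < ∑ q ∈ Finset.Ico 1 (r + 1), 1 / ((N : ℝ) - q) := by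
    refine Finset.sum_pos (fun q hq => ?_) ⟨1, by simp; omega⟩
    have : (q : ℝ) < N := by exact_mod_cast (Finset.mem_Ico.1 hq).2.trans_le hkN
    have := sub_pos.2 this
    positivity
  have hF : 0 < initialFuel V (r + 1) (s 0) := by
    unfold initialFuel; positivity
  have hup := endProb_le (k := r + 1) (U := U) (M := proposalMass V (s 0) / N) hZ.le hQ n
    ⟨[s 0], 0, initialFuel V (r + 1) (s 0)⟩
    (List.mem_singleton.2 rfl) (List.ofFn fun t : Fin r => s t.succ)
  have hlo := le_endProb (k := r + 1) (U := U) hV hkN hZ hF.le rfl (hcM (by omega) (s 0))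
    (hcd (by omega)) hU hQ n ⟨[s 0], 0, initialFuel V (r + 1) (s 0)⟩
    (List.mem_singleton.2 rfl) (List.nodup_singleton _) (List.ofFn fun t : Fin r => s t.succ)
    (by simp; omega) (Or.inl rfl) (hn _) le_rfl
  -- The 300 in the fuel is 100 times the 3 in `expCharge`: the expected charge is a hundredth of
  -- the fuel, which leaves the factor 0.99.
  have hE : stateCharge V (r + 1) (proposalMass V (s 0)) [s 0] 0 =
      initialFuel V (r + 1) (s 0) / 100 := by
    rw [stateCharge, if_neg (lt_irrefl _), expCharge, initialFuel, Finset.mul_sum,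
      Finset.sum_div, List.length_singleton]
    refine Finset.sum_congr rfl fun q _ => ?_
    ring
  simp only [hE, List.toFinset_cons, List.toFinset_nil, insert_empty_eq] at hlo hup
  rw [e]
  refine ⟨?_, mul_le_mul_of_nonneg_left hup hN'⟩
  have h99 : 0.99 * seqProb V {s 0} (List.ofFn fun t : Fin r => s t.succ) ≤
      endProb V (r + 1) U (proposalPMF V U (s 0)) (‖centered V (s 0)‖ ^ 2)
        (proposalMass V (s 0) / N) n ⟨[s 0], 0, initialFuel V (r + 1) (s 0)⟩
        ([s 0] ++ List.ofFn fun t : Fin r => s t.succ) := by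
    refine le_of_mul_le_mul_left ?_ hF
    refine le_trans (le_of_eq ?_) hlo
    ring
  calc _ = 1 / (N : ℝ) * (0.99 * seqProb V {s 0} (List.ofFn fun t : Fin r => s t.succ)) := by ring
    _ ≤ _ := mul_le_mul_of_nonneg_left h99 hN'

end data

end

/-! ### Time bounds in terms of the aspect ratio, and the conditional cost -/

noncomputable section

section data

variable {N d : ℕ} {V : Fin N → EuclideanSpace ℝ (Fin d)}

theorem exists_aspectRatio_eq (hV : Function.Injective V) (hN : 2 ≤ N) :
    ∃ δ Δ : ℝ, 0 < δ ∧ δ ≤ Δ ∧ aspectRatio V = Δ / δ ∧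
      ∀ i j, i ≠ j → δ ≤ dist (V i) (V j) ∧ dist (V i) (V j) ≤ Δ := by
  have hp : Nonempty {p : Fin N × Fin N // p.1 ≠ p.2} :=
    ⟨⟨(⟨0, by omega⟩, ⟨1, by omega⟩), by simp⟩⟩
  set f : {p : Fin N × Fin N // p.1 ≠ p.2} → ℝ := fun p => dist (V p.1.1) (V p.1.2) with hf
  have h1 : ∀ p, ⨅ p, f p ≤ f p := fun p => ciInf_le (Set.finite_range f).bddBelow p
  have h2 : ∀ p, f p ≤ ⨆ p, f p := fun p => le_ciSup (Set.finite_range f).bddAbove p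
  refine ⟨⨅ p, f p, ⨆ p, f p, ?_, ?_, rfl, fun i j hij => ⟨h1 ⟨(i, j), hij⟩, h2 ⟨(i, j), hij⟩⟩⟩
  · obtain ⟨p, e⟩ := exists_eq_ciInf_of_finite (f := f)
    rw [← e]
    exact dist_pos.2 fun h => p.2 (hV h)
  · obtain ⟨p⟩ := hp
    exact (h1 p).trans (h2 p)

theorem norm_centered_eq (i : Fin N) : ‖centered V i‖ = dist (V i) (V ⟨0, i.pos⟩) :=
  (dist_eq_norm _ _).symm

theorem proposalMass_le {Δ : ℝ} (hΔ : 0 ≤ Δ)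
    (h : ∀ i j, i ≠ j → dist (V i) (V j) ≤ Δ) (i : Fin N) :
    proposalMass V i ≤ 2 * N * Δ ^ 2 := by
  have h1 : ∀ l, ‖centered V l‖ ^ 2 ≤ Δ ^ 2 := by
    intro l
    refine pow_le_pow_left₀ (norm_nonneg _) ?_ 2
    rw [norm_centered_eq]
    by_cases hl : l = ⟨0, l.pos⟩
    · rw [← hl, dist_self]; exact hΔ
    · exact h _ _ hl
  have h2 : ∑ l, ‖centered V l‖ ^ 2 ≤ ∑ _l : Fin N, Δ ^ 2 := Finset.sum_le_sum fun l _ => h1 l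
  rw [Finset.sum_const, Finset.card_univ, Fintype.card_fin, nsmul_eq_mul] at h2
  have h3 := mul_le_mul_of_nonneg_left (h1 i) (Nat.cast_nonneg N : (0 : ℝ) ≤ N)
  unfold proposalMass
  linarith

/-- Every row but the first has norm at least δ, and (N - 1)/N ≥ 1/2. -/
theorem le_proposalMass {δ : ℝ} (hδ : 0 ≤ δ) (hN : 2 ≤ N)
    (h : ∀ i j, i ≠ j → δ ≤ dist (V i) (V j)) (i : Fin N) :
    δ ^ 2 / 2 ≤ proposalMass V i / N := by
  have h1 : ∑ l, (if l = (⟨0, i.pos⟩ : Fin N) then 0 else δ ^ 2) ≤ ∑ l, ‖centered V l‖ ^ 2 := by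
    refine Finset.sum_le_sum fun l _ => ?_
    split_ifs with hl
    · positivity
    · refine pow_le_pow_left₀ hδ ?_ 2
      rw [norm_centered_eq]
      exact h _ _ hl
  have h2 : ∑ l, (if l = (⟨0, i.pos⟩ : Fin N) then 0 else δ ^ 2) = (N - 1) * δ ^ 2 := by
    have : ∀ l : Fin N, (if l = (⟨0, i.pos⟩ : Fin N) then 0 else δ ^ 2) =
        δ ^ 2 - if l = (⟨0, i.pos⟩ : Fin N) then δ ^ 2 else 0 := fun l => by split_ifs <;> ring
    simp_rw [this]
    rw [Finset.sum_sub_distrib, Finset.sum_ite_eq' Finset.univ]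
    simp
    ring
  have hN' : (2 : ℝ) ≤ N := by exact_mod_cast hN
  rw [div_le_div_iff₀ (by norm_num) (by linarith)]
  unfold proposalMass
  have h3 : 0 ≤ (N : ℝ) * ‖centered V i‖ ^ 2 := by positivity
  nlinarith [sq_nonneg δ]

/-- N/(N - r) decreases in N, so N may be replaced by k, and a harmonic sum remains. This removes N
from the number of rounds. -/
theorem sum_one_div_sub_le {k : ℕ} (hk : 1 ≤ k) (hkN : k ≤ N) :
    N * ∑ r ∈ Finset.Ico 1 k, 1 / ((N : ℝ) - r) ≤ k * (1 + Real.log k) := by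
  have h1 : N * ∑ r ∈ Finset.Ico 1 k, 1 / ((N : ℝ) - r) ≤
      k * ∑ r ∈ Finset.Ico 1 k, 1 / ((k : ℝ) - r) := by
    rw [Finset.mul_sum, Finset.mul_sum]
    refine Finset.sum_le_sum fun r hr => ?_
    have a1 : (r : ℝ) < k := by exact_mod_cast (Finset.mem_Ico.1 hr).2
    have a2 : (k : ℝ) ≤ N := by exact_mod_cast hkN
    have a3 : (0 : ℝ) ≤ r := Nat.cast_nonneg r
    rw [mul_one_div, mul_one_div, div_le_div_iff₀ (by linarith) (by linarith)]
    nlinarith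
  have h2 : ∑ r ∈ Finset.Ico 1 k, 1 / ((k : ℝ) - r) =
      ∑ i ∈ Finset.range (k - 1), 1 / ((i : ℝ) + 1) := by
    rw [← Finset.sum_range_reflect, Finset.sum_Ico_eq_sum_range]
    refine Finset.sum_congr rfl fun r hr => ?_
    have hr' := Finset.mem_range.1 hr
    have : ((k - 1 - 1 - r : ℕ) : ℝ) = k - 1 - 1 - r := by
      rw [Nat.sub_sub, Nat.sub_sub, Nat.cast_sub (by omega)]
      push_cast
      ring
    rw [this]
    push_cast
    ring_nf
  rw [h2] at h1
  exact h1.trans (mul_le_mul_of_nonneg_left (sum_one_div_pred_le_log hk) (Nat.cast_nonneg k))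

theorem one_le_log {n : ℝ} (hn : 2 ≤ n) : 1 ≤ 3 / 2 * Real.log n := by
  have h := Real.log_two_gt_d9
  have := Real.log_le_log (by norm_num) hn
  linarith

/-- Bounds for the charge of a round and for the number of rounds. -/
theorem exists_rounds (hV : Function.Injective V) {k : ℕ} (hk : 1 ≤ k) (hkN : k ≤ N) :
    ∃ (c : ℝ) (n : ℕ), (2 ≤ k → ∀ i, c ≤ proposalMass V i / N) ∧
      (2 ≤ k → ∀ i j, i ≠ j → c ≤ dist (V i) (V j) ^ 2) ∧
      (∀ i, initialFuel V k i ≤ n * c) ∧ (k = 1 → n = 0) ∧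
      (2 ≤ k → 1 ≤ aspectRatio V ∧ (n : ℝ) ≤ 3001 * (aspectRatio V ^ 2 * k * Real.log k)) := by
  -- For k = 1 the fuel is an empty sum, so no rounds are needed.
  rcases hk.eq_or_lt with rfl | hk2
  · exact ⟨1, 0, fun h => by omega, fun h => by omega, fun i => by simp [initialFuel],
      fun _ => rfl, fun h => by omega⟩
  obtain ⟨δ, Δ, hδ, hle, hζ, h⟩ := exists_aspectRatio_eq hV (le_trans hk2 hkN)
  set ζ := aspectRatio V with hζdef
  have hζ1 : 1 ≤ ζ := by rw [hζ]; exact (one_le_div hδ).2 hle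
  have hk' : (2 : ℝ) ≤ k := by exact_mod_cast hk2
  have hlog := one_le_log hk'
  have hζk : 2 ≤ ζ ^ 2 * k := by nlinarith [one_le_pow₀ (n := 2) hζ1]
  -- δ²/2 lies below both M and all squared distances; the number of rounds is the fuel bound 600 Δ²
  -- k (1 + log k) divided by it.
  refine ⟨δ ^ 2 / 2, ⌈1200 * (ζ ^ 2 * k * (1 + Real.log k))⌉₊, fun _ =>
    le_proposalMass hδ.le (le_trans hk2 hkN) fun i j hij => (h i j hij).1, fun _ i j hij => ?_,
    fun i => ?_, fun hk1 => by omega, fun _ => ⟨hζ1, ?_⟩⟩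
  · have := pow_le_pow_left₀ hδ.le (h i j hij).1 2
    have := sq_nonneg δ
    linarith
  · have h1 := proposalMass_le (hδ.le.trans hle) (fun i j hij => (h i j hij).2) i
    have h2 := sum_one_div_sub_le hk hkN
    have h3 : 0 ≤ ∑ r ∈ Finset.Ico 1 k, 1 / ((N : ℝ) - r) := Finset.sum_nonneg fun r hr => by
      have : (r : ℝ) < N := by exact_mod_cast (Finset.mem_Ico.1 hr).2.trans_le hkN
      have := sub_pos.2 this
      positivity
    have hΔ : Δ = ζ * δ := by rw [hζ]; field_simp
    calc initialFuel V k i ≤ 300 * (2 * N * Δ ^ 2) * ∑ r ∈ Finset.Ico 1 k, 1 / ((N : ℝ) - r) := by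
          unfold initialFuel
          gcongr
      _ = 600 * Δ ^ 2 * (N * ∑ r ∈ Finset.Ico 1 k, 1 / ((N : ℝ) - r)) := by ring
      _ ≤ 600 * Δ ^ 2 * (k * (1 + Real.log k)) := by gcongr
      _ = 1200 * (ζ ^ 2 * k * (1 + Real.log k)) * (δ ^ 2 / 2) := by rw [hΔ]; ring
      _ ≤ _ := by
        gcongr
        exact Nat.le_ceil _
  · have hpos : 0 ≤ 1200 * (ζ ^ 2 * k * (1 + Real.log k)) := by
      have : 0 ≤ Real.log k := by linarith
      positivity
    refine (Nat.ceil_lt_add_one hpos).le.trans ?_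
    -- As 1 ≤ (3/2) log k, the factor 1200 becomes 3000; the one round from rounding up is absorbed
    -- since ζ² k log k ≥ 1.
    have h1 : ζ ^ 2 * k * (1 + Real.log k) ≤ ζ ^ 2 * k * (5 / 2 * Real.log k) :=
      mul_le_mul_of_nonneg_left (by linarith) (by linarith)
    nlinarith

theorem clog_le_self (n : ℕ) : Nat.clog 2 n ≤ n :=
  Nat.clog_le_of_le_pow (Nat.lt_two_pow_self).le

theorem seedTime_one_le {N d : ℕ} (hN : 1 ≤ N) (hd : 1 ≤ d) :
    (seedTime N d 1 0 : ℝ) ≤ 50 * (N * d) := by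
  have h : seedTime N d 1 0 ≤ 50 * (N * d) := by
    have h1 := clog_le_self N
    have h2 : N ≤ N * d := Nat.le_mul_of_pos_right N hd
    simp only [seedTime]
    omega
  exact_mod_cast h

/-- A round takes at most 140 k d log(Nd) steps and there are at most 3001 ζ² k log k of them; the
work outside the rounds adds at most 100 k d log(Nd). -/
theorem seedTime_le {N d k n : ℕ} {ζ : ℝ} (hd : 1 ≤ d) (hk : 2 ≤ k) (hkN : k ≤ N) (hζ : 1 ≤ ζ)
    (hn : (n : ℝ) ≤ 3001 * (ζ ^ 2 * k * Real.log k)) :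
    (seedTime N d k n : ℝ) ≤
      500000 * (ζ ^ 2 * k ^ 2 * d * Real.log k * Real.log (N * d)) := by
  have hd' : (1 : ℝ) ≤ d := by exact_mod_cast hd
  have hk' : (2 : ℝ) ≤ k := by exact_mod_cast hk
  have hN' : (2 : ℝ) ≤ N := by exact_mod_cast hk.trans hkN
  have hNd : (N : ℝ) ≤ N * d := by nlinarith
  have hl := one_le_log (hN'.trans hNd)
  set l := Real.log (N * d) with hldef
  have hL : (Nat.clog 2 N : ℝ) ≤ 1 + 2 * l := (clog_le (by omega)).trans (by
    have := Real.log_le_log (by linarith) hNd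
    linarith)
  have hlk := one_le_log hk'
  have hl0 : 0 < l := by linarith
  have hkd : (1 : ℝ) ≤ k * d := by nlinarith
  have hkkd : (k : ℝ) ≤ k * d := by nlinarith
  set X := ζ ^ 2 * k * Real.log k with hX
  have hX1 : 1 ≤ X := by
    have h1 : 1 ≤ ζ ^ 2 := one_le_pow₀ hζ
    have h2 : 1 ≤ k * Real.log k := by nlinarith
    rw [hX, mul_assoc]
    nlinarith
  have hkdl : l ≤ k * d * l := by nlinarith
  have hkl : (k : ℝ) * d ≤ 3 / 2 * (k * d * l) := by nlinarith
  have hround : (roundTime N d k : ℝ) + 2 ≤ 140 * (k * d * l) := by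
    simp only [roundTime]
    push_cast
    nlinarith
  have hround0 : (0 : ℝ) ≤ (roundTime N d k : ℝ) + 2 := by positivity
  have hrest : (Nat.clog 2 N : ℝ) * 8 + 5 * k + 37 ≤ 100 * (k * d * l) := by nlinarith
  have hkdl0 : 0 ≤ k * d * l := by positivity
  have h1 : (n : ℝ) * ((roundTime N d k : ℝ) + 2) ≤ 3001 * X * (140 * (k * d * l)) :=
    mul_le_mul hn hround hround0 (by positivity)
  have h2 : 100 * (k * d * l) ≤ 100 * (X * (k * d * l)) := by nlinarith
  have e : ζ ^ 2 * k ^ 2 * d * Real.log k * l = X * (k * d * l) := by rw [hX]; ring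
  rw [e]
  simp only [seedTime]
  push_cast
  have h3 : 0 ≤ X * (k * d * l) := by positivity
  nlinarith

theorem kmeansCost_nonneg (S : Set (EuclideanSpace ℝ (Fin d))) : 0 ≤ kmeansCost V S :=
  Finset.sum_nonneg fun _ _ => sq_nonneg _

theorem kmeansOpt_nonneg (k : ℕ) : 0 ≤ kmeansOpt V k :=
  Real.iInf_nonneg fun _ => kmeansCost_nonneg _

end data

/-- Only the upper bound on the output probabilities matters for the numerator; dividing by at least
0.99 inflates the constant 36 slightly. -/
theorem conditional_cost_le {N d k : ℕ} {V : Fin N → EuclideanSpace ℝ (Fin d)}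
    (hk : 1 ≤ k) {P : (Fin k → Fin N) → ℝ}
    (hP : ∀ s, P s ≤ seedingProb V s) (hsum : 0.99 ≤ ∑ s, P s) :
    (∑ s, P s * kmeansCost V (Set.range fun t => V (s t))) / ∑ s, P s ≤
      1000000 * (1 + Real.log k) * kmeansOpt V k := by
  rw [div_le_iff₀ (by linarith)]
  have h1 : ∑ s, P s * kmeansCost V (Set.range fun t => V (s t)) ≤
      36 * (1 + Real.log k) * kmeansOpt V k :=
    (Finset.sum_le_sum fun s _ =>
      mul_le_mul_of_nonneg_right (hP s) (kmeansCost_nonneg _)).trans (seeding_cost_le V hk)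
  have h2 : 0 ≤ (1 + Real.log k) * kmeansOpt V k :=
    mul_nonneg (by
      have : 0 ≤ Real.log k := Real.log_nonneg (by exact_mod_cast hk)
      linarith) (kmeansOpt_nonneg k)
  nlinarith

end

theorem theorem2 :
    ∃ (setup seed : Cmd) (env : SQOp → Cmd) (C : ℝ), 0 < C ∧ seed.IsPublic ∧
      ∀ (N d k : ℕ) (V : Fin N → EuclideanSpace ℝ (Fin d)),
        1 ≤ d → 1 ≤ k → k ≤ N → Function.Injective V →
        -- in time `O(Nd)`, the first phase sets up sample-query access to the data set
        (∃ T₀ : ℕ, (T₀ : ℝ) ≤ C * (N * d) ∧ HaltsWithin env setup (inputMem V k) T₀ ∧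
          ∀ m ∈ (memLaw env setup (inputMem V k) T₀).support,
            m Side.pub = inputMem V k Side.pub ∧
            ProvidesSQ env C (centered V) (m Side.hid) ∧
            -- once it is set up, the seeding takes time independent of `N` up to a logarithm
            (2 ≤ k → ∃ T₁ : ℕ,
              (T₁ : ℝ) ≤ C * (aspectRatio V ^ 2 * k ^ 2 * d * Real.log k * Real.log (N * d)) ∧
              HaltsWithin env seed m T₁)) ∧
        -- the whole algorithm
        ∃ T : ℕ,
          (T : ℝ) ≤ C * (N * d +
            aspectRatio V ^ 2 * k ^ 2 * d * Real.log k * Real.log (N * d)) ∧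
          HaltsWithin env (Cmd.seq setup seed) (inputMem V k) T ∧
          -- with probability at least 0.99 the output is an exact seeding
          (∀ s : Fin k → Fin N,
            0.99 * seedingProb V s ≤ outputProb env (Cmd.seq setup seed) V T s ∧
            outputProb env (Cmd.seq setup seed) V T s ≤ seedingProb V s) ∧
          0.99 ≤ ∑ s : Fin k → Fin N, outputProb env (Cmd.seq setup seed) V T s ∧
          -- the expected cost, conditionally on success
          (∑ s : Fin k → Fin N, outputProb env (Cmd.seq setup seed) V T s *
              kmeansCost V (Set.range (fun t => V (s t)))) /
            (∑ s : Fin k → Fin N, outputProb env (Cmd.seq setup seed) V T s)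
            ≤ C * (1 + Real.log k) * kmeansOpt V k := by
  refine ⟨setupCmd, seedCmd, sqEnv, 1000000, by norm_num, seedCmd_isPublic, ?_⟩
  intro N d k V hd hk hkN hV
  have hN : 1 ≤ N := hk.trans hkN
  have hN' : (1 : ℝ) ≤ N := by exact_mod_cast hN
  have hd' : (1 : ℝ) ≤ d := by exact_mod_cast hd
  obtain ⟨c, n, hcM, hcd, hn, hn1, hn2⟩ := exists_rounds hV hk hkN
  obtain ⟨U, hU⟩ : ∃ U : PMF (Fin N), ∀ i, (U i).toReal = 1 / N :=
    ⟨weightedPMF (fun _ => 1 / (N : ℝ)) (fun _ => by positivity)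
      (by simp; field_simp), weightedPMF_toReal _ _ _⟩
  have hsetup := Det.setup_input (env := sqEnv) V k
  have hseed : ∀ m : Mem, m Side.pub = inputMem V k Side.pub ∧
      SQInv (dataArr V) N d (m Side.hid) →
      Sim sqEnv seedCmd m (seedTime N d k n) (seedLaw V k n U)
        (fun x m' => readOutput N k m' = listOutput k x.centers) := fun m hm =>
    Sim.seedCmd hV hk hkN hcM hcd hn hU hm.2 (by rw [hm.1]; rfl) (by rw [hm.1]; rfl)
      (by rw [hm.1]; rfl)
  have hT₀ : ((N * (d * 7 + 9) + 1 : ℕ) : ℝ) ≤ 17 * (N * d) := by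
    push_cast
    nlinarith
  constructor
  · refine ⟨N * (d * 7 + 9) + 1, by nlinarith, hsetup.halts, fun m hm => ?_⟩
    obtain ⟨-, -, hm⟩ := hsetup.memLaw_support hm
    refine ⟨hm.1, providesSQ V hN hd (by norm_num) _ hm.2, fun hk2 =>
      ⟨seedTime N d k n, ?_, (hseed m hm).halts⟩⟩
    refine (seedTime_le hd hk2 hkN (hn2 hk2).1 (hn2 hk2).2).trans ?_
    have h0 : (0 : ℝ) ≤ seedTime N d k n := Nat.cast_nonneg _
    have := h0.trans (seedTime_le hd hk2 hkN (hn2 hk2).1 (hn2 hk2).2)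
    linarith
  have hall := Sim.det_seq hsetup hseed
  have hprob : ∀ s, outputProb sqEnv (Cmd.seq setupCmd seedCmd) V
      (N * (d * 7 + 9) + 1 + seedTime N d k n + 1) s =
      (((seedLaw V k n U).map fun x => listOutput k x.centers) (some s)).toReal := fun s => by
    rw [outputProb, hall.map_memLaw _ _ fun _ _ h => h]
  have hbounds : ∀ s, 0.99 * seedingProb V s ≤ outputProb sqEnv (Cmd.seq setupCmd seedCmd) V
      (N * (d * 7 + 9) + 1 + seedTime N d k n + 1) s ∧
      outputProb sqEnv (Cmd.seq setupCmd seedCmd) V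
      (N * (d * 7 + 9) + 1 + seedTime N d k n + 1) s ≤ seedingProb V s := fun s => by
    rw [hprob]
    exact seedLaw_output_bounds hV hk hkN hcM hcd hn hU s
  have hsum : 0.99 ≤ ∑ s : Fin k → Fin N, outputProb sqEnv (Cmd.seq setupCmd seedCmd) V
      (N * (d * 7 + 9) + 1 + seedTime N d k n + 1) s := by
    -- Exact seeding probabilities add up to one, so the pointwise lower bounds add up to 0.99.
    have h1 : ∑ s : Fin k → Fin N, seedingProb V s = 1 := by
      simp_rw [seedingProb_eq]
      exact sum_seqProb hV k ∅ (by simpa using hkN)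
    calc (0.99 : ℝ) = ∑ s : Fin k → Fin N, 0.99 * seedingProb V s := by
          rw [← Finset.mul_sum, h1, mul_one]
      _ ≤ _ := Finset.sum_le_sum fun s _ => (hbounds s).1
  refine ⟨N * (d * 7 + 9) + 1 + seedTime N d k n + 1, ?_, hall.halts, hbounds, hsum,
    conditional_cost_le hk (fun s => (hbounds s).2) hsum⟩
  rw [Nat.cast_add, Nat.cast_add, Nat.cast_one]
  have hNd : (1 : ℝ) ≤ N * d := by nlinarith
  rcases hk.eq_or_lt with rfl | hk2
  · have := seedTime_one_le hN hd
    rw [hn1 rfl]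
    simp only [Nat.cast_one, Real.log_one, mul_zero, zero_mul, add_zero]
    linarith
  · have h1 := seedTime_le hd hk2 hkN (hn2 hk2).1 (hn2 hk2).2
    have h0 : (0 : ℝ) ≤ seedTime N d k n := Nat.cast_nonneg _
    have := h0.trans h1
    linarith
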